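/- **Setting.** Let $d\ge 2$, let $\mathbb S^{d-1}\subset\mathbb R^d$ carry its surface measure, and let $\lambda,\sigma,\alpha,T>0$. Let $\mathcal E\in C^2(\mathbb S^{d-1})$, $\underline{\mathcal E}=\inf\mathcal E\ge 0$, $\overline{\mathcal E}=\sup\mathcal E$, $\|\nabla_{\mathbb S^{d-1}}\mathcal E\|_\infty\le c_1$, and suppose that there are $C_0,\beta>0$ such that for every $v\in\mathbb S^{d-1}$ there is a minimizer $v^*$ of $\mathcal E$ with $|v-v^*|\le C_0|\mathcal E(v)-\underline{\mathcal E}|^\beta$. Put $\omega(v)=e^{-\alpha\mathcal E(v)}$, $C_{\alpha,\mathcal E}=e^{\alpha(\overline{\mathcal E}-\underline{\mathcal E})}$, $C_{\sigma,d}=\frac{(d-1)\sigma^2}{2}$, and, for a probability density $\rho$ on $\mathbb S^{d-1}$, $$E(\rho)=\int v\,d\rho,\qquad V(\rho)=\tfrac12\int|v-E(\rho)|^2d\rho,\qquad v_{\alpha,\mathcal E}(\rho)=\frac{\int v\,\omega\,d\rho}{\|\omega\|_{L^1(\rho)}} .$$ Let $\rho_0\in L^2(\mathbb S^{d-1})$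 be a probability density and let $\rho$ be a weak solution on $[0,T]$, in the class $L^\infty(0,T;L^2(\mathbb S^{d-1}))\cap L^2(0,T;H^1(\mathbb S^{d-1}))$ and consisting of probability densities $\rho_t$, of $$\partial_t\rho_t=\lambda\nabla_{\mathbb S^{d-1}}\cdot\big((\langle v_{\alpha,\mathcal E}(\rho_t),v\rangle v-v_{\alpha,\mathcal E}(\rho_t))\rho_t\big)+\tfrac{\sigma^2}{2}\Delta_{\mathbb S^{d-1}}\big(|v-v_{\alpha,\mathcal E}(\rho_t)|^2\rho_t\big)$$ with initial datum $\rho_0$. For $0<\vartheta<\delta<1$, $0<\varepsilon<1$ and real numbers $C$ and $C^*>0$, put $$\kappa=\lambda\vartheta-4C_{\alpha,\mathcal E}C_{\sigma,d},\qquad R(C)=\frac{\lambda C}{\kappa}\,\delta^{\frac{d-2}{4}} .$$ The datum and the parameters are called *well-prepared with constants* $(C,C^*)$ if $\kappa>0$, $$C_{\alpha,\mathcal E}^{2\max\{1,\beta\}}\big(V(\rho_0)+R(C)\big)^{\frac12\min\{1,\beta\}}+\varepsilon^\beta<\frac{\delta-\vartheta}{C^*},$$ $$V(\rho_0)+R(C)\le\min\Big\{T^{-1}\|\omega\|_{L^1(\rho_0)}^2,\;T^{-1}\lambda^{-2}\|\omega\|_{L^1(\rho_0)}^4,\;\tfrac38\Big\}.$$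 **Proposition 3.2.** There are positive constants $C_T$, depending only on $\lambda,\sigma,T,\|\rho_0\|_2$, and $C^*$, depending only on $c_1,\beta,C_0$ (in particular neither depends on $d$), such that in the above setting, for every $\alpha>0$, the following holds. 1. For all $\delta\in(0,1)$, $t\in[0,T]$ and $u\in\mathbb S^{d-1}$: $\;4\,\rho_t\big(\{v:\langle v,u\rangle\le-1+\delta\}\big)\le C_T\,\delta^{\frac{d-2}{4}}$. 2. If the datum and the parameters are well-prepared with constants $(C_T,C^*)$, then $$V(\rho_t)\le V(\rho_0)\,e^{-(\lambda\vartheta-4C_{\alpha,\mathcal E}C_{\sigma,d})t}+\frac{\lambda C_T}{\lambda\vartheta-4C_{\alpha,\mathcal E}C_{\sigma,d}}\,\delta^{\frac{d-2}{4}}\qquad\text{for all }t\in[0,T].$$ 3. The assertion of 2. also holds with $C_T$ replaced, in the hypothesis and in the conclusion, by any number $C$ such that $4\,\rho_t(\{v:\langle v,u\rangle\le-1+\delta\})\le C\,\delta^{\frac{d-2}{4}}$ for all $t\in[0,T]$ and all unit vectors $u$ with $E(\rho_t)=|E(\rho_t)|\,u$. -/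

import Mathlib

open MeasureTheory Set
open scoped ContDiff InnerProductSpace

noncomputable section

namespace SphereCBO

/-- The ambient space `ℝ^d` with its Euclidean norm. -/
abbrev Vec (d : ℕ) : Type := EuclideanSpace ℝ (Fin d)

/-- The unit sphere `S^{d-1}` in `ℝ^d`. -/
abbrev Sph (d : ℕ) : Type := Metric.sphere (0 : Vec d) 1

/-- The (unnormalised) surface measure on `S^{d-1}`. -/
def surf (d : ℕ) : Measure (Sph d) := (volume : Measure (Vec d)).toSphere

/-! ### Differential operators on the sphere

A function on the sphere is given by a function on `ℝ^d` of which only the values on the sphere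
matter; it is differentiated through its extension `x ↦ φ (x / |x|)`. -/

/-- The extension `x ↦ φ (x / |x|)`, constant along rays, of the restriction of `φ` to the
sphere. -/
def homExt {d : ℕ} {F : Type*} (φ : Vec d → F) (x : Vec d) : F := φ (‖x‖⁻¹ • x)

/-- Gradient on the sphere. -/
def sphGrad {d : ℕ} (φ : Vec d → ℝ) (v : Vec d) : Vec d := gradient (homExt φ) v

/-- Laplace-Beltrami operator on the sphere. -/
def sphLap {d : ℕ} (φ : Vec d → ℝ) (v : Vec d) : ℝ := Laplacian.laplacian (homExt φ) v

/-- Divergence on the sphere (used for vector fields that are tangential on the sphere). -/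
def sphDiv {d : ℕ} (X : Vec d → Vec d) (v : Vec d) : ℝ :=
  LinearMap.trace ℝ (Vec d) (fderiv ℝ (homExt X) v : Vec d →ₗ[ℝ] Vec d)

/-- `G` is the weak gradient of `g` on the sphere, and it is square integrable: `G` is tangential
and `∫ g div X = - ∫ ⟨G, X⟩` for all smooth tangential vector fields `X`. A function `g ∈ L²`
belongs to `H¹(S^{d-1})` if and only if it has such a gradient. -/
structure IsWeakGradient {d : ℕ} (g : Sph d → ℝ) (G : Sph d → Vec d) : Prop where
  memLp : MemLp G 2 (surf d)
  tangential : ∀ᵐ v ∂(surf d), ⟪G v, (v : Vec d)⟫_ℝ = 0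
  by_parts : ∀ X : Vec d → Vec d, ContDiff ℝ ∞ X →
    (∀ v : Sph d, ⟪X v, (v : Vec d)⟫_ℝ = 0) →
    ∫ v, g v * sphDiv X v ∂(surf d) = - ∫ v, ⟪G v, X v⟫_ℝ ∂(surf d)

/-! ### Densities and their statistics -/

/-- `g` is the density, with respect to the surface measure, of a probability measure in
`P_ac(S^{d-1}) ∩ L²(S^{d-1})`. -/
structure IsL2Density {d : ℕ} (g : Sph d → ℝ) : Prop where
  nonneg : ∀ᵐ v ∂(surf d), 0 ≤ g v
  mass : ∫ v, g v ∂(surf d) = 1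
  memLp : MemLp g 2 (surf d)

/-- The norm of `L²(S^{d-1})`. -/
def norm2 {d : ℕ} (g : Sph d → ℝ) : ℝ := (eLpNorm g 2 (surf d)).toReal

/-- The expectation `E(ρ) = ∫ v dρ(v)`. -/
def mean {d : ℕ} (g : Sph d → ℝ) : Vec d := ∫ v, g v • (v : Vec d) ∂(surf d)

/-- The variance `V(ρ) = 1/2 ∫ |v - E(ρ)|² dρ(v)`. -/
def variance {d : ℕ} (g : Sph d → ℝ) : ℝ :=
  (1 / 2) * ∫ v, ‖(v : Vec d) - mean g‖ ^ 2 * g v ∂(surf d)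

/-- The weight `ω(v) = exp (-α 𝓔(v))`. -/
def weight {d : ℕ} (α : ℝ) (𝓔 : Vec d → ℝ) (v : Vec d) : ℝ := Real.exp (-α * 𝓔 v)

/-- `‖ω‖_{L¹(ρ)}`. -/
def weightNorm {d : ℕ} (α : ℝ) (𝓔 : Vec d → ℝ) (g : Sph d → ℝ) : ℝ :=
  ∫ v, weight α 𝓔 (v : Vec d) * g v ∂(surf d)

/-- The consensus point `v_{α,𝓔}(ρ) = ∫ v ω(v) dρ(v) / ‖ω‖_{L¹(ρ)}`. -/
def consensus {d : ℕ} (α : ℝ) (𝓔 : Vec d → ℝ) (g : Sph d → ℝ) : Vec d :=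
  (weightNorm α 𝓔 g)⁻¹ • ∫ v, (weight α 𝓔 (v : Vec d) * g v) • (v : Vec d) ∂(surf d)

/-! ### The objective function -/

/-- `inf 𝓔` over the sphere. -/
def infE {d : ℕ} (𝓔 : Vec d → ℝ) : ℝ := ⨅ v : Sph d, 𝓔 v

/-- `sup 𝓔` over the sphere. -/
def supE {d : ℕ} (𝓔 : Vec d → ℝ) : ℝ := ⨆ v : Sph d, 𝓔 v

/-- The assumptions on the objective function. Boundedness of `𝓔` and of its second derivatives
on the sphere follows from `contDiff` by compactness. -/
structure IsObjective {d : ℕ} (𝓔 : Vec d → ℝ) (c₁ C₀ β : ℝ) : Prop where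
  contDiff : ContDiffOn ℝ 2 (homExt 𝓔) {0}ᶜ
  inf_nonneg : 0 ≤ infE 𝓔
  grad_le : ∀ v : Sph d, ‖sphGrad 𝓔 v‖ ≤ c₁
  beta_pos : 0 < β
  C₀_pos : 0 < C₀
  inverse_continuity : ∀ v : Sph d, ∃ w : Sph d, (∀ u : Sph d, 𝓔 w ≤ 𝓔 u) ∧
    ‖(v : Vec d) - (w : Vec d)‖ ≤ C₀ * |𝓔 v - infE 𝓔| ^ β

/-- `C_{α,𝓔} = exp (α (sup 𝓔 - inf 𝓔))`. -/
def cAlpha {d : ℕ} (α : ℝ) (𝓔 : Vec d → ℝ) : ℝ := Real.exp (α * (supE 𝓔 - infE 𝓔))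

/-- `C_{σ,d} = (d - 1) σ² / 2`. -/
def cSigma (σ : ℝ) (d : ℕ) : ℝ := ((d : ℝ) - 1) * σ ^ 2 / 2

/-! ### The mean-field equation -/

/-- `ρ` is a weak solution on `[0, T]` of
`∂ₜρ = λ div ((⟨m, v⟩ v - m) ρ) + (σ² / 2) Δ (|v - m|² ρ)` on `S^{d-1}`, where
`m = v_{α,𝓔}(ρ_t)`, with initial datum `ρ₀`, in the class `L^∞(0,T; L²) ∩ L²(0,T; H¹)`.
The weak formulation is integrated in time; it makes `t ↦ ρ_t` weakly continuous and yields
`∂ₜρ ∈ L²(0,T; (H¹)')`. -/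
structure IsWeakSolution {d : ℕ} (lam σ α : ℝ) (𝓔 : Vec d → ℝ) (T : ℝ) (ρ₀ : Sph d → ℝ)
    (ρ : ℝ → Sph d → ℝ) : Prop where
  measurable : Measurable (fun p : ℝ × Sph d => ρ p.1 p.2)
  density : ∀ t ∈ Icc 0 T, IsL2Density (ρ t)
  initial : ρ 0 =ᵐ[surf d] ρ₀
  bounded : ∃ M : ℝ, ∀ t ∈ Icc 0 T, norm2 (ρ t) ≤ M
  sobolev : ∃ G : ℝ → Sph d → Vec d, Measurable (fun p : ℝ × Sph d => G p.1 p.2) ∧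
    (∀ᵐ t ∂(volume.restrict (Icc 0 T)), IsWeakGradient (ρ t) (G t)) ∧
    ∫⁻ t in Icc 0 T, ∫⁻ v, ‖G t v‖ₑ ^ 2 ∂(surf d) < ⊤
  weak_eq : ∀ φ : Vec d → ℝ, ContDiff ℝ ∞ φ → ∀ t ∈ Icc 0 T,
    ∫ v, φ v * ρ t v ∂(surf d) - ∫ v, φ v * ρ₀ v ∂(surf d) =
      ∫ s in (0 : ℝ)..t,
        (-lam * ∫ v, ⟪⟪consensus α 𝓔 (ρ s), (v : Vec d)⟫_ℝ • (v : Vec d) - consensus α 𝓔 (ρ s),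
              sphGrad φ v⟫_ℝ * ρ s v ∂(surf d)
          + σ ^ 2 / 2 * ∫ v, ‖(v : Vec d) - consensus α 𝓔 (ρ s)‖ ^ 2 * sphLap φ v * ρ s v
              ∂(surf d))

/-! ### Well-preparation -/

/-- The decay rate `λ ϑ - 4 C_{α,𝓔} C_{σ,d}`. -/
def rate {d : ℕ} (lam σ α ϑ : ℝ) (𝓔 : Vec d → ℝ) : ℝ :=
  lam * ϑ - 4 * cAlpha α 𝓔 * cSigma σ d

/-- The remainder `λ C / (λ ϑ - 4 C_{α,𝓔} C_{σ,d}) * δ ^ ((d - 2) / 4)`; here `C` stands for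
`C_T`. -/
def remainder {d : ℕ} (lam σ α δ ϑ C : ℝ) (𝓔 : Vec d → ℝ) : ℝ :=
  lam * C / rate lam σ α ϑ 𝓔 * δ ^ (((d : ℝ) - 2) / 4)

/-- Well-preparation of the datum `ρ₀` and the parameters for the time horizon `T` and the
parameter `α`, with the constants `C` (standing for `C_T`) and `Cs` (standing for `C^*`). -/
structure WellPrepared {d : ℕ} (lam σ α T β ε δ ϑ C Cs : ℝ) (𝓔 : Vec d → ℝ)
    (ρ₀ : Sph d → ℝ) : Prop where
  datum : IsL2Density ρ₀
  eps_pos : 0 < ε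
  eps_lt : ε < 1
  delta_pos : 0 < δ
  delta_lt : δ < 1
  theta_pos : 0 < ϑ
  theta_lt : ϑ < δ
  small : cAlpha α 𝓔 ^ (2 * max 1 β) *
      (variance ρ₀ + remainder lam σ α δ ϑ C 𝓔) ^ ((1 / 2) * min 1 β) + ε ^ β < (δ - ϑ) / Cs
  bound : variance ρ₀ + remainder lam σ α δ ϑ C 𝓔 ≤
    min (T⁻¹ * weightNorm α 𝓔 ρ₀ ^ 2)
      (min (T⁻¹ * (lam ^ 2)⁻¹ * weightNorm α 𝓔 ρ₀ ^ 4) (3 / 8))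
  rate_pos : 0 < rate lam σ α ϑ 𝓔

/-- The mass of `ρ` in the spherical cap `{v | ⟨v, u⟩ ≤ -1 + δ}`, opposite to the unit
vector `u`. -/
def capMass {d : ℕ} (g : Sph d → ℝ) (u : Sph d) (δ : ℝ) : ℝ :=
  ∫ v in {v : Sph d | ⟪(v : Vec d), (u : Vec d)⟫_ℝ ≤ -1 + δ}, g v ∂(surf d)

/-- The claimed estimate of the variance on `[0, T]`. -/
def VarianceDecay {d : ℕ} (lam σ α T δ ϑ C : ℝ) (𝓔 : Vec d → ℝ) (ρ₀ : Sph d → ℝ)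
    (ρ : ℝ → Sph d → ℝ) : Prop :=
  ∀ t ∈ Icc 0 T, variance (ρ t) ≤
    variance ρ₀ * Real.exp (-(rate lam σ α ϑ 𝓔) * t) + remainder lam σ α δ ϑ C 𝓔

end SphereCBO

end

open SphereCBO

namespace SphereCBO

/-! The proof has two independent halves: an `L²` bound whose growth rate does not see `d`, and a
differential inequality for the variance whose only defect is the mass opposite to the mean.

For the `L²` bound, the equation is tested with `ρ_t` itself. Moving one derivative of the diffusion
onto the weight `|v - m|²`, where `m` is the consensus point, gives a drift with coefficient `λ +
σ²` and the dissipation `(σ²/2) ∫ |v - m|² |∇ρ|²`. The dissipation degenerates at `m`, but so does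
the drift: the tangential part of `m` at `v` has length at most `|v - m|`. Young's inequality
absorbs the drift, and Grönwall gives a rate depending on `λ` and `σ` only (`limit_flux_le`,
`energy_inequality`, `norm2_le`). Since only smooth test functions constant in time are admissible,
`ρ_t` is replaced by its `L²` projection onto polynomials of degree at most `n`. The Laplacian
preserves these polynomials (`exists_mem_polySpace_sphLap`), so the projection does not increase the
Dirichlet energy, and its gradients converge weakly to the weak gradient of `ρ_t`; dominated
convergence in time then passes to the limit.

By Cauchy-Schwarz the mass of a cap is at most the `L²` norm times the square root of the area. The
cone over the cap is covered by about `δ^(-1/2)` balls of radius `3√δ`, and the volume of the unit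
ball decays superexponentially in `d`, so the constant is uniform in `d` (`surf_cap_le`,
`exists_surf_cap_le`).

For the variance, `V = (1 - |E|²)/2` on the sphere, so `V'` is minus the flux of the linear function
`⟨E, ·⟩`. Linear functions are eigenfunctions of the Laplacian, and the diffusion costs at most `4
C_α C_σ V`. With `E` in place of `m`, the drift gains `λ |E|² ∫ (1 - ⟨u,v⟩²) dρ`; since `1 - x² ≥ δ
(1 - x)` off the cap, this is at least `λ δ V (1 - 2V)` up to cap mass (`drift_mean_ge`). Replacing
`m` by `E` costs only a multiple of `V |E - m|`, and `|E - m|² ≤ 2 C_α V` by Jensen (`drift_ge`).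
Hence `V' ≤ -κ V + 4 λ (cap mass)` as long as `C_α V ≤ ((δ - ϑ)/8)²`. Well-preparation keeps the
comparison solution strictly below this barrier, so `V` never reaches it
(`le_exp_of_conditional_integral_le`). -/

/-! ### Calculus on the sphere -/

/-- The map `h ↦ h - ⟨v, h⟩ v`; for a unit vector `v` it is the orthogonal projection onto the
tangent space of the sphere at `v`. -/
noncomputable def tangProj {d : ℕ} (v : Vec d) : Vec d →L[ℝ] Vec d :=
  ContinuousLinearMap.id ℝ (Vec d) - (innerSL ℝ v).smulRight v

theorem tangProj_apply {d : ℕ} (v h : Vec d) : tangProj v h = h - ⟪v, h⟫_ℝ • v := by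
  simp [tangProj]

theorem norm_coe_sph {d : ℕ} (v : Sph d) : ‖(v : Vec d)‖ = 1 := by simp

theorem inner_coe_self {d : ℕ} (v : Sph d) : ⟪(v : Vec d), (v : Vec d)⟫_ℝ = 1 := by
  simp

theorem coe_sph_ne_zero {d : ℕ} (v : Sph d) : (v : Vec d) ≠ 0 := by
  intro h
  have := norm_coe_sph v
  simp [h] at this

theorem inner_tangProj_comm {d : ℕ} (v h k : Vec d) :
    ⟪tangProj v h, k⟫_ℝ = ⟪h, tangProj v k⟫_ℝ := by
  simp only [tangProj_apply, inner_sub_left, inner_sub_right, inner_smul_left, inner_smul_right]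
  simp only [real_inner_comm v h, RCLike.conj_to_real]
  ring

theorem inner_tangProj_self {d : ℕ} (v : Sph d) (h : Vec d) :
    ⟪tangProj (v : Vec d) h, (v : Vec d)⟫_ℝ = 0 := by
  rw [tangProj_apply, inner_sub_left, inner_smul_left, inner_coe_self, real_inner_comm]
  simp

theorem tangProj_of_tangential {d : ℕ} (v h : Vec d) (hv : ⟪h, v⟫_ℝ = 0) :
    tangProj v h = h := by
  rw [tangProj_apply, real_inner_comm, hv]
  simp

theorem norm_tangProj_sq {d : ℕ} (v : Sph d) (h : Vec d) :
    ‖tangProj (v : Vec d) h‖ ^ 2 = ‖h‖ ^ 2 - ⟪(v : Vec d), h⟫_ℝ ^ 2 := by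
  rw [tangProj_apply, norm_sub_sq_real, inner_smul_right, norm_smul, norm_coe_sph,
    real_inner_comm]
  simp only [Real.norm_eq_abs, mul_one, sq_abs]
  ring

theorem norm_tangProj_le {d : ℕ} (v : Sph d) (h : Vec d) : ‖tangProj (v : Vec d) h‖ ≤ ‖h‖ := by
  have := norm_tangProj_sq v h
  refine le_of_sq_le_sq ?_ (norm_nonneg _)
  nlinarith [sq_nonneg ⟪(v : Vec d), h⟫_ℝ]

theorem norm_smul_inv_norm_eq_one {d : ℕ} {x : Vec d} (hx : x ≠ 0) : ‖‖x‖⁻¹ • x‖ = 1 := by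
  rw [norm_smul, norm_inv, norm_norm, inv_mul_cancel₀ (norm_ne_zero_iff.2 hx)]

theorem hasFDerivAt_norm_coe {d : ℕ} (v : Sph d) :
    HasFDerivAt (fun x : Vec d => ‖x‖) (innerSL ℝ (v : Vec d)) (v : Vec d) := by
  have h := (hasStrictFDerivAt_norm_sq (v : Vec d)).hasFDerivAt.sqrt (by simp)
  have h2 : (fun x : Vec d => Real.sqrt (‖x‖ ^ 2)) = fun x => ‖x‖ := by
    ext x; exact Real.sqrt_sq (norm_nonneg x)
  rw [h2] at h
  have h3 : (1 / (2 * Real.sqrt (‖(v : Vec d)‖ ^ 2))) • 2 • (innerSL ℝ) (v : Vec d) =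
      innerSL ℝ (v : Vec d) := by
    ext1 k; simp
  rwa [h3] at h

theorem hasFDerivAt_inv_norm_smul {d : ℕ} (v : Sph d) :
    HasFDerivAt (fun x : Vec d => ‖x‖⁻¹ • x) (tangProj (v : Vec d)) (v : Vec d) := by
  have h1 := (hasDerivAt_inv (x := ‖(v : Vec d)‖) (by simp)).comp_hasFDerivAt _
    (hasFDerivAt_norm_coe v)
  have h := h1.smul (hasFDerivAt_id (v : Vec d))
  refine h.congr_fderiv ?_
  ext1 k
  simp [tangProj_apply, sub_eq_add_neg]

theorem homExt_coe {d : ℕ} {F : Type*} (φ : Vec d → F) (v : Sph d) : homExt φ v = φ v := by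
  simp [homExt]

theorem homExt_smul {d : ℕ} {F : Type*} (φ : Vec d → F) {c : ℝ} (hc : 0 < c) (x : Vec d) :
    homExt φ (c • x) = homExt φ x := by
  unfold homExt
  congr 1
  rw [norm_smul, Real.norm_of_nonneg hc.le, smul_smul, mul_inv]
  congr 1
  field_simp

theorem homExt_congr {d : ℕ} {F : Type*} {φ ψ : Vec d → F} (h : ∀ v : Sph d, φ v = ψ v)
    {x : Vec d} (hx : x ≠ 0) : homExt φ x = homExt ψ x :=
  h ⟨‖x‖⁻¹ • x, by simpa using norm_smul_inv_norm_eq_one hx⟩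

theorem homExt_eventuallyEq {d : ℕ} {F : Type*} {φ ψ : Vec d → F} (h : ∀ v : Sph d, φ v = ψ v)
    {x : Vec d} (hx : x ≠ 0) : homExt φ =ᶠ[nhds x] homExt ψ := by
  filter_upwards [isOpen_ne.mem_nhds hx] with y hy using homExt_congr h hy

theorem contDiffAt_inv_norm_smul {d : ℕ} {n : WithTop ℕ∞} {x : Vec d} (hx : x ≠ 0) :
    ContDiffAt ℝ n (fun x : Vec d => ‖x‖⁻¹ • x) x :=
  ((contDiffAt_norm ℝ hx).inv (norm_ne_zero_iff.2 hx)).smul contDiffAt_id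

theorem contDiffAt_homExt {d : ℕ} {F : Type*} [NormedAddCommGroup F] [NormedSpace ℝ F]
    {n : WithTop ℕ∞} {φ : Vec d → F} (hφ : ContDiff ℝ n φ) {x : Vec d} (hx : x ≠ 0) :
    ContDiffAt ℝ n (homExt φ) x :=
  ContDiffAt.comp x hφ.contDiffAt (contDiffAt_inv_norm_smul hx)

theorem hasFDerivAt_homExt {d : ℕ} {F : Type*} [NormedAddCommGroup F] [NormedSpace ℝ F]
    {φ : Vec d → F} (v : Sph d) (hφ : DifferentiableAt ℝ φ v) :
    HasFDerivAt (homExt φ) ((fderiv ℝ φ v).comp (tangProj (v : Vec d))) (v : Vec d) := by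
  have h1 : HasFDerivAt φ (fderiv ℝ φ v) ((fun x : Vec d => ‖x‖⁻¹ • x) (v : Vec d)) := by
    simpa using hφ.hasFDerivAt
  exact HasFDerivAt.comp (f := fun x : Vec d => ‖x‖⁻¹ • x) (v : Vec d) h1
    (hasFDerivAt_inv_norm_smul v)

theorem sphGrad_eq {d : ℕ} {φ : Vec d → ℝ} (v : Sph d) (hφ : DifferentiableAt ℝ φ v) :
    sphGrad φ v = tangProj (v : Vec d) (gradient φ v) := by
  refine ext_inner_right ℝ fun k => ?_
  rw [inner_tangProj_comm, sphGrad, gradient, gradient, InnerProductSpace.toDual_symm_apply,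
    InnerProductSpace.toDual_symm_apply, (hasFDerivAt_homExt v hφ).fderiv]
  rfl

theorem sphGrad_congr {d : ℕ} {φ ψ : Vec d → ℝ} (h : ∀ v : Sph d, φ v = ψ v) (v : Sph d) :
    sphGrad φ v = sphGrad ψ v := by
  rw [sphGrad, sphGrad, gradient, gradient,
    (homExt_eventuallyEq h (coe_sph_ne_zero v)).fderiv_eq]

theorem sphDiv_congr {d : ℕ} {X Y : Vec d → Vec d} (h : ∀ v : Sph d, X v = Y v) (v : Sph d) :
    sphDiv X v = sphDiv Y v := by
  rw [sphDiv, sphDiv, (homExt_eventuallyEq h (coe_sph_ne_zero v)).fderiv_eq]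

theorem inner_sphGrad_self {d : ℕ} {φ : Vec d → ℝ} (hφ : ContDiff ℝ ∞ φ) (v : Sph d) :
    ⟪sphGrad φ v, (v : Vec d)⟫_ℝ = 0 := by
  rw [sphGrad_eq v (hφ.differentiable (by simp) _), inner_tangProj_self]

/-- The gradient of the sphere, extended smoothly to the whole space. -/
noncomputable def gradField {d : ℕ} (φ : Vec d → ℝ) (x : Vec d) : Vec d :=
  ‖x‖ ^ 2 • gradient φ x - ⟪x, gradient φ x⟫_ℝ • x

theorem contDiff_gradient {d : ℕ} {φ : Vec d → ℝ} (hφ : ContDiff ℝ ∞ φ) :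
    ContDiff ℝ ∞ (gradient φ) := by
  have h1 : ContDiff ℝ ∞ (fderiv ℝ φ) := hφ.fderiv_right (by simp)
  exact (InnerProductSpace.toDual ℝ (Vec d)).symm.contDiff.comp h1

theorem contDiff_gradField {d : ℕ} {φ : Vec d → ℝ} (hφ : ContDiff ℝ ∞ φ) :
    ContDiff ℝ ∞ (gradField φ) := by
  have h := contDiff_gradient hφ
  exact ((contDiff_norm_sq ℝ).smul h).sub ((contDiff_id.inner ℝ h).smul contDiff_id)

theorem gradField_coe {d : ℕ} {φ : Vec d → ℝ} (hφ : ContDiff ℝ ∞ φ) (v : Sph d) :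
    gradField φ v = sphGrad φ v := by
  rw [sphGrad_eq v (hφ.differentiable (by simp) _), gradField, tangProj_apply]
  simp

theorem sphGrad_mul {d : ℕ} {φ ψ : Vec d → ℝ} (hφ : ContDiff ℝ ∞ φ) (hψ : ContDiff ℝ ∞ ψ)
    (v : Sph d) : sphGrad (fun x => φ x * ψ x) v = φ v • sphGrad ψ v + ψ v • sphGrad φ v := by
  have h1 := hφ.differentiable (by simp) (v : Vec d)
  have h2 := hψ.differentiable (by simp) (v : Vec d)
  rw [sphGrad_eq v (h1.fun_mul h2), sphGrad_eq v h1, sphGrad_eq v h2, ← map_smul, ← map_smul,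
    ← map_add]
  congr 1
  simp only [gradient]
  rw [fderiv_fun_mul h1 h2]
  simp

theorem sphGrad_add {d : ℕ} {φ ψ : Vec d → ℝ} (hφ : ContDiff ℝ ∞ φ) (hψ : ContDiff ℝ ∞ ψ)
    (v : Sph d) : sphGrad (fun x => φ x + ψ x) v = sphGrad φ v + sphGrad ψ v := by
  have h1 := hφ.differentiable (by simp) (v : Vec d)
  have h2 := hψ.differentiable (by simp) (v : Vec d)
  rw [sphGrad_eq v (h1.fun_add h2), sphGrad_eq v h1, sphGrad_eq v h2, ← map_add]
  congr 1
  simp only [gradient]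
  rw [fderiv_fun_add h1 h2]
  simp

theorem sphGrad_const_mul {d : ℕ} {φ : Vec d → ℝ} (c : ℝ) (hφ : ContDiff ℝ ∞ φ)
    (v : Sph d) : sphGrad (fun x => c * φ x) v = c • sphGrad φ v := by
  have h1 := hφ.differentiable (by simp) (v : Vec d)
  rw [sphGrad_eq v (h1.const_mul c), sphGrad_eq v h1, ← map_smul]
  congr 1
  simp only [gradient]
  rw [fderiv_const_mul h1 c]
  simp

theorem gradient_inner_right {d : ℕ} (z x : Vec d) :
    gradient (fun y : Vec d => ⟪z, y⟫_ℝ) x = z := by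
  refine HasGradientAt.gradient ?_
  exact (innerSL ℝ z).hasFDerivAt

theorem sphGrad_inner {d : ℕ} (z : Vec d) (v : Sph d) :
    sphGrad (fun y : Vec d => ⟪z, y⟫_ℝ) v = tangProj (v : Vec d) z := by
  rw [sphGrad_eq (φ := fun y => ⟪z, y⟫_ℝ) v (innerSL ℝ z).differentiableAt, gradient_inner_right]

theorem trace_smulRight_eq {d : ℕ} (f : Vec d →L[ℝ] ℝ) (z : Vec d) :
    LinearMap.trace ℝ (Vec d) (f.smulRight z : Vec d →ₗ[ℝ] Vec d) = f z := by
  have : (f.smulRight z : Vec d →ₗ[ℝ] Vec d) = dualTensorHom ℝ (Vec d) (Vec d)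
      ((f : Vec d →ₗ[ℝ] ℝ) ⊗ₜ[ℝ] z) := by
    ext1 x; simp
  rw [this, LinearMap.trace_eq_contract_apply]
  simp

theorem sphDiv_eq {d : ℕ} {X : Vec d → Vec d} (hX : ContDiff ℝ ∞ X) (v : Sph d) :
    sphDiv X v = LinearMap.trace ℝ (Vec d)
      ((fderiv ℝ X v).comp (tangProj (v : Vec d)) : Vec d →ₗ[ℝ] Vec d) := by
  rw [sphDiv, (hasFDerivAt_homExt v (hX.differentiable (by simp) _)).fderiv]

theorem sphDiv_smul {d : ℕ} {φ : Vec d → ℝ} {X : Vec d → Vec d} (hφ : ContDiff ℝ ∞ φ)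
    (hX : ContDiff ℝ ∞ X) (v : Sph d) :
    sphDiv (fun x => φ x • X x) v = φ v * sphDiv X v + ⟪sphGrad φ v, X v⟫_ℝ := by
  have h1 := hφ.differentiable (by simp) (v : Vec d)
  have h2 := hX.differentiable (by simp) (v : Vec d)
  rw [sphDiv_eq (X := fun x => φ x • X x) (hφ.smul hX), sphDiv_eq hX, fderiv_fun_smul h1 h2]
  have : ((φ v • fderiv ℝ X v + (fderiv ℝ φ v).smulRight (X v)).comp (tangProj (v : Vec d))
        : Vec d →ₗ[ℝ] Vec d) =
      φ v • (((fderiv ℝ X v).comp (tangProj (v : Vec d)) : Vec d →L[ℝ] Vec d) :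
        Vec d →ₗ[ℝ] Vec d) +
      ((((fderiv ℝ φ v).comp (tangProj (v : Vec d))).smulRight (X v) : Vec d →L[ℝ] Vec d) :
        Vec d →ₗ[ℝ] Vec d) := by
    ext1 x; simp
  rw [this, map_add, map_smul, trace_smulRight_eq, smul_eq_mul, sphGrad_eq v h1,
    inner_tangProj_comm, gradient, InnerProductSpace.toDual_symm_apply]
  rfl

theorem sphDiv_add {d : ℕ} {X Y : Vec d → Vec d} (hX : ContDiff ℝ ∞ X)
    (hY : ContDiff ℝ ∞ Y) (v : Sph d) :
    sphDiv (fun x => X x + Y x) v = sphDiv X v + sphDiv Y v := by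
  have h1 := hX.differentiable (by simp) (v : Vec d)
  have h2 := hY.differentiable (by simp) (v : Vec d)
  rw [sphDiv_eq (hX.add hY), sphDiv_eq hX, sphDiv_eq hY, fderiv_fun_add h1 h2, ← map_add]
  rfl

theorem gradient_homExt_smul {d : ℕ} (φ : Vec d → ℝ) {c : ℝ} (hc : 0 < c) (x : Vec d) :
    gradient (homExt φ) (c • x) = c⁻¹ • gradient (homExt φ) x := by
  have h1 : (homExt φ <| c • ·) = homExt φ := by
    ext y; exact homExt_smul φ hc y
  have h2 := fderiv_comp_smul (𝕜 := ℝ) (f := homExt φ) (x := x) c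
  rw [h1] at h2
  rw [gradient, gradient, h2, map_smul, smul_smul, inv_mul_cancel₀ hc.ne', one_smul]

theorem fderiv_homExt_smul {d : ℕ} (X : Vec d → Vec d) {c : ℝ} (hc : 0 < c) (x : Vec d) :
    fderiv ℝ (homExt X) (c • x) = c⁻¹ • fderiv ℝ (homExt X) x := by
  have h1 : (homExt X <| c • ·) = homExt X := by
    funext y; exact homExt_smul X hc y
  have h2 := fderiv_comp_smul (𝕜 := ℝ) (f := homExt X) (x := x) c
  rw [h1] at h2
  rw [h2, smul_smul, inv_mul_cancel₀ hc.ne', one_smul]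

/-- The gradient of `homExt φ` is homogeneous of degree `-1`, so the degree-zero extension of the
spherical gradient is `‖x‖` times it. The trace of its derivative is the Laplacian plus `⟨v, ∇
homExt φ⟩`, which vanishes because `homExt φ` is constant along rays. -/
theorem sphDiv_gradField {d : ℕ} {φ : Vec d → ℝ} (hφ : ContDiff ℝ ∞ φ) (v : Sph d) :
    sphDiv (gradField φ) v = sphLap φ v := by
  have h0 : sphDiv (gradField φ) v = sphDiv (sphGrad φ) v :=
    sphDiv_congr (fun v => gradField_coe hφ v) v
  have h1 : homExt (sphGrad φ) =ᶠ[nhds (v : Vec d)]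
      fun x => ‖x‖ • gradient (homExt φ) x := by
    filter_upwards [isOpen_ne.mem_nhds (coe_sph_ne_zero v)] with x hx
    rw [homExt, sphGrad, gradient_homExt_smul _ (inv_pos.2 (norm_pos_iff.2 hx)), inv_inv]
  have hd : DifferentiableAt ℝ (fderiv ℝ (homExt φ)) v := by
    have := (contDiffAt_homExt hφ (coe_sph_ne_zero v)).fderiv_right (m := 1) (by norm_cast)
    exact this.differentiableAt (by simp)
  -- The inverse Riesz map is typed as conjugate-linear; it is repackaged as an `ℝ`-linear map for
  -- the chain rule.
  let J₀ : (Vec d →L[ℝ] ℝ) →ₗ[ℝ] Vec d :=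
    { toFun := fun f => (InnerProductSpace.toDual ℝ (Vec d)).symm f
      map_add' := fun f g => by simp
      map_smul' := fun c f => by simp }
  let J : (Vec d →L[ℝ] ℝ) →L[ℝ] Vec d := J₀.toContinuousLinearMap
  have hg : HasFDerivAt (gradient (homExt φ))
      (J.comp (fderiv ℝ (fderiv ℝ (homExt φ)) v)) v :=
    J.hasFDerivAt.comp (v : Vec d) hd.hasFDerivAt
  have h2 := (hasFDerivAt_norm_coe v).fun_smul hg
  rw [h0, sphDiv, h1.fderiv_eq, h2.fderiv, sphLap,
    InnerProductSpace.laplacian_eq_iteratedFDeriv_stdOrthonormalBasis]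
  have : ((‖(v : Vec d)‖ • (J.comp (fderiv ℝ (fderiv ℝ (homExt φ)) v)) +
        (innerSL ℝ (v : Vec d)).smulRight (gradient (homExt φ) v) : Vec d →L[ℝ] Vec d)
        : Vec d →ₗ[ℝ] Vec d) =
      (((J.comp (fderiv ℝ (fderiv ℝ (homExt φ)) v)) :
          Vec d →L[ℝ] Vec d) : Vec d →ₗ[ℝ] Vec d) +
      (((innerSL ℝ (v : Vec d)).smulRight (gradient (homExt φ) v) : Vec d →L[ℝ] Vec d) :
        Vec d →ₗ[ℝ] Vec d) := by
    ext1 x; simp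
  rw [this, map_add, trace_smulRight_eq]
  have h3 : innerSL ℝ (v : Vec d) (gradient (homExt φ) v) = 0 := by
    have := inner_sphGrad_self hφ v
    rw [real_inner_comm] at this
    exact this
  rw [h3, add_zero, LinearMap.trace_eq_sum_inner _ (stdOrthonormalBasis ℝ (Vec d))]
  refine Finset.sum_congr rfl fun i _ => ?_
  rw [real_inner_comm, iteratedFDeriv_two_apply]
  simp only [ContinuousLinearMap.coe_coe, ContinuousLinearMap.comp_apply]
  exact InnerProductSpace.toDual_symm_apply

theorem sphLap_mul {d : ℕ} {φ ψ : Vec d → ℝ} (hφ : ContDiff ℝ ∞ φ) (hψ : ContDiff ℝ ∞ ψ)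
    (v : Sph d) : sphLap (fun x => φ x * ψ x) v =
      φ v * sphLap ψ v + ψ v * sphLap φ v + 2 * ⟪sphGrad φ v, sphGrad ψ v⟫_ℝ := by
  rw [← sphDiv_gradField (hφ.mul hψ), ← sphDiv_gradField hφ, ← sphDiv_gradField hψ]
  have h : ∀ w : Sph d, gradField (fun x => φ x * ψ x) w =
      (fun x => φ x • gradField ψ x + ψ x • gradField φ x) w := by
    intro w
    simp only [gradField_coe (hφ.mul hψ), gradField_coe hφ, gradField_coe hψ]
    exact sphGrad_mul hφ hψ w
  rw [sphDiv_congr (Y := fun x => φ x • gradField ψ x + ψ x • gradField φ x) h,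
    sphDiv_add (X := fun x => φ x • gradField ψ x) (Y := fun x => ψ x • gradField φ x)
    (hφ.smul (contDiff_gradField hψ)) (hψ.smul (contDiff_gradField hφ)), sphDiv_smul hφ (contDiff_gradField hψ),
    sphDiv_smul hψ (contDiff_gradField hφ), gradField_coe hφ, gradField_coe hψ,
    real_inner_comm (sphGrad φ v)]
  ring

theorem sphLap_add {d : ℕ} {φ ψ : Vec d → ℝ} (hφ : ContDiff ℝ ∞ φ) (hψ : ContDiff ℝ ∞ ψ)
    (v : Sph d) : sphLap (fun x => φ x + ψ x) v = sphLap φ v + sphLap ψ v := by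
  rw [← sphDiv_gradField (hφ.add hψ), ← sphDiv_gradField hφ, ← sphDiv_gradField hψ,
    ← sphDiv_add (contDiff_gradField hφ) (contDiff_gradField hψ)]
  refine sphDiv_congr (fun w => ?_) v
  rw [gradField_coe (hφ.add hψ), gradField_coe hφ, gradField_coe hψ, sphGrad_add hφ hψ]

theorem sphLap_const_mul {d : ℕ} {φ : Vec d → ℝ} (c : ℝ) (hφ : ContDiff ℝ ∞ φ) (v : Sph d) :
    sphLap (fun x => c * φ x) v = c * sphLap φ v :=
  InnerProductSpace.laplacian_smul c
    ((contDiffAt_homExt hφ (coe_sph_ne_zero v)).of_le (by norm_cast))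

theorem trace_tangProj {d : ℕ} (v : Sph d) :
    LinearMap.trace ℝ (Vec d) (tangProj (v : Vec d) : Vec d →ₗ[ℝ] Vec d) = d - 1 := by
  have : (tangProj (v : Vec d) : Vec d →ₗ[ℝ] Vec d) =
      LinearMap.id -
        (((innerSL ℝ (v : Vec d)).smulRight (v : Vec d) : Vec d →L[ℝ] Vec d) :
          Vec d →ₗ[ℝ] Vec d) := by
    ext1 x; simp [tangProj]
  rw [this, map_sub, trace_smulRight_eq]
  simp

/-- On the sphere the gradient field is `z - ⟨z, x⟩ x`, and the identity field has divergence `d -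
1`. This eigenvalue is the source of `C_{σ,d}`. -/
theorem sphLap_inner {d : ℕ} (z : Vec d) (v : Sph d) :
    sphLap (fun y : Vec d => ⟪z, y⟫_ℝ) v = -((d : ℝ) - 1) * ⟪z, (v : Vec d)⟫_ℝ := by
  have hc : ContDiff ℝ ∞ (fun y : Vec d => ⟪z, y⟫_ℝ) := (innerSL ℝ z).contDiff
  rw [← sphDiv_gradField hc]
  have h : ∀ w : Sph d, gradField (fun y : Vec d => ⟪z, y⟫_ℝ) w =
      (fun x : Vec d => z + (-⟪z, x⟫_ℝ) • x) w := by
    intro w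
    simp only [gradField_coe hc, sphGrad_inner, tangProj_apply, real_inner_comm, neg_smul,
      sub_eq_add_neg]
  rw [sphDiv_congr (Y := fun x : Vec d => z + (-⟪z, x⟫_ℝ) • x) h,
    sphDiv_add (X := fun _ => z) (Y := fun x => (-⟪z, x⟫_ℝ) • x) contDiff_const
      (hc.neg.smul contDiff_id),
    sphDiv_smul (X := fun x => x) hc.neg contDiff_id]
  have h1 : sphDiv (fun _ : Vec d => z) v = 0 := by
    rw [sphDiv_eq contDiff_const]
    simp
  have h2 : sphDiv (fun x : Vec d => x) v = d - 1 := by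
    rw [sphDiv_eq (X := fun x => x) contDiff_id, ← trace_tangProj v]
    congr 1
    ext1 x
    simp
  rw [h1, h2, inner_sphGrad_self hc.neg]
  ring

/-! ### The divergence theorem on the sphere -/

instance {d : ℕ} : IsFiniteMeasure (surf d) :=
  inferInstanceAs (IsFiniteMeasure (volume : Measure (Vec d)).toSphere)

/-- Polar coordinates for a product of an angular and a radial function. Integrability is not
needed, because `integral_prod_mul` holds unconditionally. -/
theorem integral_eq_mul_of_polar {d : ℕ} [NeZero d] {f : Vec d → ℝ} {h : Sph d → ℝ} {g : ℝ → ℝ}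
    (H : ∀ (v : Sph d) (r : ℝ), 0 < r → f (r • (v : Vec d)) = h v * g r) :
    ∫ x, f x = (∫ v, h v ∂(surf d)) *
      ∫ r : Ioi (0 : ℝ), g r ∂(Measure.volumeIoiPow (Module.finrank ℝ (Vec d) - 1)) := by
  calc
    ∫ x, f x = ∫ x : ({(0)}ᶜ : Set (Vec d)), f x.1 ∂((volume : Measure (Vec d)).comap (↑)) := by
      rw [integral_subtype_comap (measurableSet_singleton _).compl fun x ↦ f x,
        restrict_compl_singleton]
    _ = ∫ p, h p.1 * g p.2 ∂((surf d).prod (.volumeIoiPow (Module.finrank ℝ (Vec d) - 1))) := by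
      rw [surf, ← (volume : Measure (Vec d)).measurePreserving_homeomorphUnitSphereProd.integral_comp
        (Homeomorph.measurableEmbedding _)]
      refine integral_congr_ae (Filter.Eventually.of_forall fun x => ?_)
      have hx : (x : Vec d) ≠ 0 := x.2
      have hx' : 0 < ‖(x : Vec d)‖ := norm_pos_iff.2 hx
      simp only [homeomorphUnitSphereProd_apply_snd_coe]
      rw [← H _ _ hx']
      simp [smul_smul, mul_inv_cancel₀ hx'.ne']
    _ = _ := integral_prod_mul (μ := surf d)
      (ν := Measure.volumeIoiPow (Module.finrank ℝ (Vec d) - 1)) h (fun r => g r)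

/-- A smooth radial function which vanishes near the origin. -/
noncomputable def radialCutoff {d : ℕ} (x : Vec d) : ℝ :=
  (⟨1 / 2, 1, by norm_num, by norm_num⟩ : ContDiffBump (2 : ℝ)) (‖x‖ ^ 2)

theorem contDiff_radialCutoff {d : ℕ} : ContDiff ℝ ∞ (radialCutoff (d := d)) :=
  (ContDiffBump.contDiff _).comp (contDiff_norm_sq ℝ)

theorem radialCutoff_nonneg {d : ℕ} (x : Vec d) : 0 ≤ radialCutoff x := ContDiffBump.nonneg _

theorem tsupport_radialCutoff_subset {d : ℕ} :
    tsupport (radialCutoff (d := d)) ⊆ {x | 1 ≤ ‖x‖ ^ 2 ∧ ‖x‖ ^ 2 ≤ 3} := by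
  refine closure_minimal ?_ ?_
  · intro x hx
    have h1 : ‖x‖ ^ 2 ∈ Metric.ball (2 : ℝ) 1 := by
      have := ContDiffBump.support_eq
        (⟨1 / 2, 1, by norm_num, by norm_num⟩ : ContDiffBump (2 : ℝ))
      simp only at this
      rw [← this]
      exact hx
    rw [Real.ball_eq_Ioo] at h1
    constructor <;> linarith [h1.1, h1.2]
  · exact (isClosed_le continuous_const (continuous_norm.pow 2)).inter
      (isClosed_le (continuous_norm.pow 2) continuous_const)

theorem ne_zero_of_mem_tsupport_radialCutoff {d : ℕ} {x : Vec d}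
    (hx : x ∈ tsupport (radialCutoff (d := d))) : x ≠ 0 := by
  rintro rfl
  have := (tsupport_radialCutoff_subset hx).1
  norm_num at this

theorem hasCompactSupport_radialCutoff {d : ℕ} : HasCompactSupport (radialCutoff (d := d)) := by
  refine HasCompactSupport.of_support_subset_isCompact
    (isCompact_closedBall (0 : Vec d) 2) (subset_closure.trans ?_)
  intro x hx
  have := (tsupport_radialCutoff_subset hx).2
  rw [mem_closedBall_zero_iff]
  nlinarith [norm_nonneg x]

theorem integrable_radialCutoff_mul {d : ℕ} {f g : Vec d → ℝ} (hf : Continuous f)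
    (hs : tsupport f ⊆ tsupport (radialCutoff (d := d)))
    (hg : ∀ x : Vec d, x ≠ 0 → ContinuousAt g x) :
    Continuous (fun x => f x * g x) ∧ HasCompactSupport (fun x => f x * g x) := by
  constructor
  · refine continuous_of_tsupport fun x hx => ?_
    have : x ∈ tsupport f := closure_mono (Function.support_mul_subset_left f g) hx
    exact hf.continuousAt.mul (hg x (ne_zero_of_mem_tsupport_radialCutoff (hs this)))
  · have : HasCompactSupport f :=
      hasCompactSupport_radialCutoff.mono' (subset_closure.trans hs)
    exact this.mul_right

/-- The cutoff is a function of `‖x‖`, so its gradient is radial and pairs to zero with a tangential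
field. -/
theorem fderiv_radialCutoff {d : ℕ} (x : Vec d) :
    ∃ c : ℝ, ∀ h, fderiv ℝ radialCutoff x h = c * ⟪x, h⟫_ℝ := by
  set b := (⟨1 / 2, 1, by norm_num, by norm_num⟩ : ContDiffBump (2 : ℝ))
  have h1 : DifferentiableAt ℝ b (‖x‖ ^ 2) := b.contDiffAt.differentiableAt (n := 1) (by simp)
  have h2 := h1.hasDerivAt.comp_hasFDerivAt x (hasStrictFDerivAt_norm_sq x).hasFDerivAt
  refine ⟨2 * deriv b (‖x‖ ^ 2), fun h => ?_⟩
  have h3 : fderiv ℝ radialCutoff x = _ := h2.fderiv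
  rw [h3]
  simp
  ring

/-- Integrate the Euclidean divergence of `homExt X` against a radial cutoff. Integration by parts
puts the derivative on the cutoff, where tangentiality makes the integrand vanish. The divergence is
homogeneous of degree `-1`, so in polar coordinates the vanishing integral is the wanted one times a
radial factor, which is then shown to be nonzero. -/
theorem integral_sphDiv {d : ℕ} {X : Vec d → Vec d} (hX : ContDiff ℝ ∞ X)
    (ht : ∀ v : Sph d, ⟪X v, (v : Vec d)⟫_ℝ = 0) : ∫ v, sphDiv X v ∂(surf d) = 0 := by
  rcases Nat.eq_zero_or_pos d with rfl | hd
  · have : surf 0 = 0 := by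
      rw [surf, Measure.toSphere_eq_zero_iff]
      infer_instance
    simp [this]
  have : NeZero d := ⟨hd.ne'⟩
  set e := stdOrthonormalBasis ℝ (Vec d)
  let g : Fin _ → Vec d → ℝ := fun i x => ⟪e i, homExt X x⟫_ℝ
  have hgc : ∀ i (x : Vec d), x ≠ 0 → ContDiffAt ℝ 2 (g i) x := fun i x hx =>
    contDiffAt_const.inner ℝ ((contDiffAt_homExt hX hx).of_le (by norm_cast))
  have hgd : ∀ i (x : Vec d), x ≠ 0 →
      fderiv ℝ (g i) x (e i) = ⟪e i, fderiv ℝ (homExt X) x (e i)⟫_ℝ := by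
    intro i x hx
    have := ((contDiffAt_homExt hX hx).differentiableAt (by simp)).hasFDerivAt
    have h2 := (innerSL ℝ (e i)).hasFDerivAt.comp x this
    have h3 : fderiv ℝ (g i) x = _ := h2.fderiv
    rw [h3]
    simp
  have hη := contDiff_radialCutoff (d := d)
  have hηd : Continuous (fun x => fderiv ℝ (radialCutoff (d := d)) x) :=
    hη.continuous_fderiv (by simp)
  have I1 : ∀ i, Integrable (fun x => fderiv ℝ (radialCutoff (d := d)) x (e i) * g i x) := by
    intro i
    obtain ⟨h1, h2⟩ := integrable_radialCutoff_mul (d := d)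
      (f := fun x => fderiv ℝ radialCutoff x (e i)) (g := g i)
      (hηd.clm_apply continuous_const)
      (by
        refine (closure_mono fun x hx => ?_).trans
          (tsupport_fderiv_subset ℝ (f := radialCutoff (d := d)))
        intro h
        exact hx (by simp [h]))
      (fun x hx => (hgc i x hx).continuousAt)
    exact h1.integrable_of_hasCompactSupport h2
  have I2 : ∀ i, Integrable (fun x => radialCutoff x * fderiv ℝ (g i) x (e i)) := by
    intro i
    obtain ⟨h1, h2⟩ := integrable_radialCutoff_mul (d := d)
      (f := radialCutoff) (g := fun x => fderiv ℝ (g i) x (e i)) hη.continuous subset_rfl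
      (fun x hx => (((hgc i x hx).fderiv_right (m := 1) (by norm_num)).continuousAt.clm_apply
        continuousAt_const))
    exact h1.integrable_of_hasCompactSupport h2
  have I3 : ∀ i, Integrable (fun x => radialCutoff x * g i x) := by
    intro i
    obtain ⟨h1, h2⟩ := integrable_radialCutoff_mul (d := d)
      (f := radialCutoff) (g := g i) hη.continuous subset_rfl
      (fun x hx => (hgc i x hx).continuousAt)
    exact h1.integrable_of_hasCompactSupport h2
  have key : ∀ i, ∫ x, radialCutoff x * fderiv ℝ (g i) x (e i) =
      - ∫ x, fderiv ℝ radialCutoff x (e i) * g i x := fun i =>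
    integral_mul_fderiv_eq_neg_fderiv_mul_of_integrable (I1 i) (I2 i) (I3 i)
      (fun x _ => hη.differentiable (by simp) x)
      (fun x hx => (hgc i x (ne_zero_of_mem_tsupport_radialCutoff hx)).differentiableAt (by simp))
  have key2 : ∫ x : Vec d, radialCutoff x *
      LinearMap.trace ℝ (Vec d) (fderiv ℝ (homExt X) x : Vec d →ₗ[ℝ] Vec d) = 0 := by
    have e1 : ∀ x : Vec d, radialCutoff x *
        LinearMap.trace ℝ (Vec d) (fderiv ℝ (homExt X) x : Vec d →ₗ[ℝ] Vec d) =
        ∑ i, radialCutoff x * fderiv ℝ (g i) x (e i) := by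
      intro x
      by_cases hx : x ∈ tsupport (radialCutoff (d := d))
      · rw [LinearMap.trace_eq_sum_inner _ e, Finset.mul_sum]
        refine Finset.sum_congr rfl fun i _ => ?_
        rw [hgd i x (ne_zero_of_mem_tsupport_radialCutoff hx)]
        simp
      · simp [image_eq_zero_of_notMem_tsupport hx]
    simp_rw [e1]
    rw [integral_finsetSum _ (fun i _ => I2 i)]
    simp_rw [key]
    rw [Finset.sum_neg_distrib, ← integral_finsetSum _ (fun i _ => I1 i), neg_eq_zero]
    refine integral_eq_zero_of_ae (Filter.Eventually.of_forall fun x => ?_)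
    obtain ⟨c, hc⟩ := fderiv_radialCutoff x
    simp only [hc, Pi.zero_apply]
    by_cases hx : x = 0
    · simp [hx]
    have h1 : ∑ i, c * ⟪x, e i⟫_ℝ * g i x = c * ⟪x, homExt X x⟫_ℝ := by
      rw [← OrthonormalBasis.sum_inner_mul_inner e x (homExt X x), Finset.mul_sum]
      exact Finset.sum_congr rfl fun i _ => by simp only [g]; ring
    rw [h1]
    have h2 := ht ⟨‖x‖⁻¹ • x, by simpa using norm_smul_inv_norm_eq_one hx⟩
    simp only [inner_smul_right, real_inner_comm] at h2
    have h3 : ⟪x, homExt X x⟫_ℝ = 0 := by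
      rcases mul_eq_zero.1 h2 with h | h
      · simp [hx] at h
      · exact h
    rw [h3, mul_zero]
  let θ : ℝ → ℝ := fun r =>
    (⟨1 / 2, 1, by norm_num, by norm_num⟩ : ContDiffBump (2 : ℝ)) (r ^ 2)
  have hθ : ∀ (v : Sph d) (r : ℝ), 0 < r → radialCutoff (r • (v : Vec d)) = θ r := by
    intro v r hr
    simp [radialCutoff, θ, norm_smul]
  have p1 := integral_eq_mul_of_polar (d := d) (f := fun x => radialCutoff x *
      LinearMap.trace ℝ (Vec d) (fderiv ℝ (homExt X) x : Vec d →ₗ[ℝ] Vec d))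
      (h := fun v => sphDiv X v) (g := fun r => θ r * r⁻¹) (by
    intro v r hr
    simp only [hθ v r hr, fderiv_homExt_smul X hr, sphDiv]
    rw [ContinuousLinearMap.toLinearMap_smul, map_smul, smul_eq_mul]
    ring)
  -- A strictly positive integral with the same radial factor: were that factor zero, this integral
  -- would vanish too.
  have p2 := integral_eq_mul_of_polar (d := d) (f := fun x => radialCutoff x * ‖x‖⁻¹)
      (h := fun v => 1) (g := fun r => θ r * r⁻¹) (by
    intro v r hr
    simp only [hθ v r hr, norm_smul, norm_coe_sph, Real.norm_of_nonneg hr.le]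
    ring)
  rw [key2] at p1
  rcases mul_eq_zero.1 p1.symm with h | h
  · exact h
  exfalso
  rw [h, mul_zero] at p2
  obtain ⟨h1, h2⟩ := integrable_radialCutoff_mul (d := d)
      (f := radialCutoff) (g := fun x => ‖x‖⁻¹) hη.continuous subset_rfl
      (fun x hx => continuous_norm.continuousAt.inv₀ (norm_ne_zero_iff.2 hx))
  obtain ⟨w, hw⟩ := exists_norm_eq (Vec d) (c := Real.sqrt 2) (by positivity)
  have h3 : radialCutoff w * ‖w‖⁻¹ ≠ 0 := by
    have : radialCutoff w = 1 := by
      rw [radialCutoff, hw]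
      refine ContDiffBump.one_of_mem_closedBall _ ?_
      simp
    rw [this, hw]
    positivity
  have h4 := h1.integral_pos_of_hasCompactSupport_nonneg_nonzero (μ := volume) h2
    (fun x => mul_nonneg (radialCutoff_nonneg x) (by positivity)) h3
  exact h4.ne' p2

theorem integrable_of_continuous_sph {d : ℕ} {F : Type*} [NormedAddCommGroup F]
    {f : Sph d → F} (hf : Continuous f) : Integrable f (surf d) :=
  hf.integrable_of_hasCompactSupport (HasCompactSupport.of_compactSpace f)

theorem continuous_tangProj_apply {d : ℕ} {Z : Type*} [TopologicalSpace Z] {f g : Z → Vec d}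
    (hf : Continuous f) (hg : Continuous g) : Continuous fun z => tangProj (f z) (g z) := by
  simp_rw [tangProj_apply]
  have h : Continuous fun z => ⟪f z, g z⟫_ℝ := hf.inner hg
  exact hg.sub (h.smul hf)

theorem continuous_sphGrad {d : ℕ} {φ : Vec d → ℝ} (hφ : ContDiff ℝ ∞ φ) :
    Continuous fun v : Sph d => sphGrad φ v := by
  simp_rw [← gradField_coe hφ]
  exact (contDiff_gradField hφ).continuous.comp continuous_subtype_val

theorem continuous_sphDiv {d : ℕ} {X : Vec d → Vec d} (hX : ContDiff ℝ ∞ X) :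
    Continuous fun v : Sph d => sphDiv X v := by
  simp_rw [sphDiv_eq hX, LinearMap.trace_eq_sum_inner _ (stdOrthonormalBasis ℝ (Vec d))]
  refine continuous_finsetSum _ fun i _ => continuous_const.inner ?_
  exact ((hX.continuous_fderiv (by simp)).comp continuous_subtype_val).clm_apply
    (continuous_tangProj_apply continuous_subtype_val continuous_const)

theorem continuous_sphLap {d : ℕ} {φ : Vec d → ℝ} (hφ : ContDiff ℝ ∞ φ) :
    Continuous fun v : Sph d => sphLap φ v := by
  simp_rw [← sphDiv_gradField hφ]
  exact continuous_sphDiv (contDiff_gradField hφ)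

theorem integral_mul_sphDiv {d : ℕ} {φ : Vec d → ℝ} {X : Vec d → Vec d} (hφ : ContDiff ℝ ∞ φ)
    (hX : ContDiff ℝ ∞ X) (ht : ∀ v : Sph d, ⟪X v, (v : Vec d)⟫_ℝ = 0) :
    ∫ v, φ v * sphDiv X v ∂(surf d) = - ∫ v, ⟪sphGrad φ v, X v⟫_ℝ ∂(surf d) := by
  have h := integral_sphDiv (X := fun x => φ x • X x) (hφ.smul hX) (fun v => by
    rw [inner_smul_left, ht v, mul_zero])
  simp_rw [sphDiv_smul hφ hX] at h
  rw [integral_add (integrable_of_continuous_sph (f := fun v : Sph d => φ v * sphDiv X v)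
      ((hφ.continuous.comp continuous_subtype_val).mul (continuous_sphDiv hX)))
    (integrable_of_continuous_sph (f := fun v : Sph d => ⟪sphGrad φ v, X v⟫_ℝ)
      ((continuous_sphGrad hφ).inner (hX.continuous.comp continuous_subtype_val)))] at h
  linarith

/-- Green's formula on the sphere. -/
theorem integral_mul_sphLap {d : ℕ} {φ ψ : Vec d → ℝ} (hφ : ContDiff ℝ ∞ φ)
    (hψ : ContDiff ℝ ∞ ψ) :
    ∫ v, φ v * sphLap ψ v ∂(surf d) =
      - ∫ v : Sph d, ⟪sphGrad φ v, sphGrad ψ v⟫_ℝ ∂(surf d) := by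
  have h := integral_mul_sphDiv hφ (contDiff_gradField hψ) (fun v => by
    rw [gradField_coe hψ, inner_sphGrad_self hψ])
  simpa only [sphDiv_gradField hψ, gradField_coe hψ] using h

/-! ### Polynomials on the sphere -/

/-- The affine function `x ↦ c + ⟨z, x⟩`, as a linear function of `(c, z)`. -/
noncomputable def affineMap (d : ℕ) : (ℝ × Vec d) →ₗ[ℝ] (Vec d → ℝ) where
  toFun p := fun x => p.1 + ⟪p.2, x⟫_ℝ
  map_add' p q := by
    ext x
    simp only [Prod.fst_add, Prod.snd_add, inner_add_left, Pi.add_apply]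
    ring
  map_smul' c p := by
    ext x
    simp only [Prod.smul_fst, Prod.smul_snd, inner_smul_left, Pi.smul_apply, smul_eq_mul,
      RCLike.conj_to_real, RingHom.id_apply]
    ring

/-- The space of polynomial functions of degree at most `n`. -/
noncomputable def polySpace (d n : ℕ) : Submodule ℝ (Vec d → ℝ) :=
  (LinearMap.range (affineMap d)) ^ n

theorem affine_mem_polySpace {d : ℕ} (c : ℝ) (z : Vec d) :
    (fun x => c + ⟪z, x⟫_ℝ) ∈ polySpace d 1 := by
  rw [polySpace, pow_one]
  exact ⟨(c, z), rfl⟩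

theorem inner_mem_polySpace {d : ℕ} (z : Vec d) :
    (fun x => ⟪z, x⟫_ℝ) ∈ polySpace d 1 := by
  simpa using affine_mem_polySpace 0 z

theorem mul_mem_polySpace {d m n : ℕ} {f g : Vec d → ℝ} (hf : f ∈ polySpace d m)
    (hg : g ∈ polySpace d n) : f * g ∈ polySpace d (m + n) := by
  rw [polySpace, pow_add]
  exact Submodule.mul_mem_mul hf hg

theorem one_le_range_affineMap (d : ℕ) : 1 ≤ LinearMap.range (affineMap d) := by
  rw [Submodule.one_le]
  exact ⟨(1, 0), by ext x; simp [affineMap]⟩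

theorem polySpace_mono {d : ℕ} : Monotone (polySpace d) :=
  pow_right_monotone (one_le_range_affineMap d)

theorem const_mem_polySpace {d : ℕ} (c : ℝ) (n : ℕ) : (fun _ => c) ∈ polySpace d n := by
  refine polySpace_mono (Nat.zero_le n) ?_
  rw [polySpace, pow_zero, Submodule.mem_one]
  exact ⟨c, rfl⟩

instance {d n : ℕ} : FiniteDimensional ℝ (polySpace d n) := by
  refine (Submodule.fg_iff_finiteDimensional _).1 ?_
  refine Submodule.FG.pow ?_ n
  rw [Submodule.fg_iff_finiteDimensional]
  infer_instance

theorem contDiff_of_mem_polySpace {d n : ℕ} {f : Vec d → ℝ} (hf : f ∈ polySpace d n) :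
    ContDiff ℝ ∞ f := by
  refine Submodule.pow_induction_on_left (C := fun f => ContDiff ℝ ∞ f) _
    (fun r => contDiff_const) (fun x y hx hy => hx.add hy) ?_ hf
  rintro _ ⟨p, rfl⟩ x hx
  exact (contDiff_const.add (innerSL ℝ p.2).contDiff).mul hx

theorem contDiff_affine {d : ℕ} (c : ℝ) (z : Vec d) :
    ContDiff ℝ ∞ (fun x : Vec d => c + ⟪z, x⟫_ℝ) :=
  contDiff_const.add (innerSL ℝ z).contDiff

theorem contDiff_inner_const {d : ℕ} (z : Vec d) : ContDiff ℝ ∞ (fun x : Vec d => ⟪z, x⟫_ℝ) :=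
  (innerSL ℝ z).contDiff

theorem sphGrad_const {d : ℕ} (c : ℝ) (v : Sph d) : sphGrad (fun _ : Vec d => c) v = 0 := by
  rw [sphGrad_eq v (differentiableAt_const c)]
  simp [gradient]

theorem sphLap_const {d : ℕ} (c : ℝ) (v : Sph d) : sphLap (fun _ : Vec d => c) v = 0 := by
  have : homExt (fun _ : Vec d => c) = fun _ => c := rfl
  rw [sphLap, this, InnerProductSpace.laplacian_const]
  rfl

theorem sphGrad_affine {d : ℕ} (c : ℝ) (z : Vec d) (v : Sph d) :
    sphGrad (fun x : Vec d => c + ⟪z, x⟫_ℝ) v = tangProj (v : Vec d) z := by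
  rw [sphGrad_add contDiff_const (contDiff_inner_const z), sphGrad_const, zero_add,
    sphGrad_inner]

/-- By the product rule it suffices to treat an affine factor, where `⟨P_v z, P_v w⟩ = ⟨z, w⟩ - ⟨z,
v⟩ ⟨w, v⟩`: the projection raises the degree by one. -/
theorem exists_mem_polySpace_inner_sphGrad {d n : ℕ} {f : Vec d → ℝ} (hf : f ∈ polySpace d n)
    (z : Vec d) : ∃ h ∈ polySpace d (n + 1), ∀ v : Sph d,
      ⟪tangProj (v : Vec d) z, sphGrad f v⟫_ℝ = h v := by
  refine Submodule.pow_induction_on_left' (LinearMap.range (affineMap d))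
    (C := fun n f _ => ∃ h ∈ polySpace d (n + 1), ∀ v : Sph d,
      ⟪tangProj (v : Vec d) z, sphGrad f v⟫_ℝ = h v) ?_ ?_ ?_ hf
  · intro r
    refine ⟨0, zero_mem _, fun v => ?_⟩
    have : (algebraMap ℝ (Vec d → ℝ)) r = fun _ => r := rfl
    rw [this, sphGrad_const, inner_zero_right]
    rfl
  · rintro x y i hx hy ⟨h, hh, hh'⟩ ⟨k, hk, hk'⟩
    refine ⟨h + k, add_mem hh hk, fun v => ?_⟩
    have : x + y = fun w => x w + y w := rfl
    rw [this, sphGrad_add (contDiff_of_mem_polySpace hx) (contDiff_of_mem_polySpace hy),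
      inner_add_right, hh', hk']
    rfl
  · rintro _ ⟨⟨c, w⟩, rfl⟩ i x hx ⟨h, hh, hh'⟩
    have h2 : (fun _ => ⟪z, w⟫_ℝ) - (fun v : Vec d => ⟪z, v⟫_ℝ) * (fun v => ⟪w, v⟫_ℝ) ∈
        polySpace d 2 :=
      sub_mem (const_mem_polySpace _ 2)
        (mul_mem_polySpace (inner_mem_polySpace z) (inner_mem_polySpace w))
    refine ⟨x * ((fun _ => ⟪z, w⟫_ℝ) - (fun v => ⟪z, v⟫_ℝ) * (fun v => ⟪w, v⟫_ℝ)) +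
      (fun v => c + ⟪w, v⟫_ℝ) * h, ?_, fun v => ?_⟩
    · refine add_mem ?_ ?_
      · exact mul_mem_polySpace (m := i) hx h2
      · have := mul_mem_polySpace (affine_mem_polySpace c w) hh
        rwa [show 1 + (i + 1) = i.succ + 1 by omega] at this
    · have : affineMap d (c, w) * x = fun v => (c + ⟪w, v⟫_ℝ) * x v := rfl
      rw [this, sphGrad_mul (contDiff_affine c w) (contDiff_of_mem_polySpace hx),
        sphGrad_affine, inner_add_right, inner_smul_right, inner_smul_right, hh',
        inner_tangProj_comm, tangProj_of_tangential (v : Vec d) _ (inner_tangProj_self v w),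
        tangProj_apply, inner_sub_right, inner_smul_right]
      simp only [Pi.add_apply, Pi.mul_apply, Pi.sub_apply, real_inner_comm]
      ring

/-- Induction over products with an affine factor: the cross term of the product rule is the
derivative controlled by `exists_mem_polySpace_inner_sphGrad`, whose degree is exactly that of the
product. Invariance under the Laplacian is what makes polynomials the right Galerkin spaces. -/
theorem exists_mem_polySpace_sphLap {d n : ℕ} {f : Vec d → ℝ} (hf : f ∈ polySpace d n) :
    ∃ h ∈ polySpace d n, ∀ v : Sph d, sphLap f v = h v := by
  refine Submodule.pow_induction_on_left' (LinearMap.range (affineMap d))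
    (C := fun n f _ => ∃ h ∈ polySpace d n, ∀ v : Sph d, sphLap f v = h v) ?_ ?_ ?_ hf
  · intro r
    refine ⟨0, zero_mem _, fun v => ?_⟩
    have : (algebraMap ℝ (Vec d → ℝ)) r = fun _ => r := rfl
    rw [this, sphLap_const]
    rfl
  · rintro x y i hx hy ⟨h, hh, hh'⟩ ⟨k, hk, hk'⟩
    refine ⟨h + k, add_mem hh hk, fun v => ?_⟩
    have : x + y = fun w => x w + y w := rfl
    rw [this, sphLap_add (contDiff_of_mem_polySpace hx) (contDiff_of_mem_polySpace hy), hh', hk']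
    rfl
  · rintro _ ⟨⟨c, w⟩, rfl⟩ i x hx ⟨h, hh, hh'⟩
    obtain ⟨k, hk, hk'⟩ := exists_mem_polySpace_inner_sphGrad hx w
    refine ⟨(fun v => c + ⟪w, v⟫_ℝ) * h + x * (fun v => 0 + ⟪(-((d : ℝ) - 1)) • w, v⟫_ℝ) +
      (2 : ℝ) • k, ?_, fun v => ?_⟩
    · refine add_mem (add_mem ?_ ?_) (Submodule.smul_mem _ _ hk)
      · have := mul_mem_polySpace (affine_mem_polySpace c w) hh
        rwa [show 1 + i = i.succ by omega] at this
      · exact mul_mem_polySpace hx (affine_mem_polySpace _ _)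
    · have : affineMap d (c, w) * x = fun v => (c + ⟪w, v⟫_ℝ) * x v := rfl
      rw [this, sphLap_mul (contDiff_affine c w) (contDiff_of_mem_polySpace hx),
        sphLap_add contDiff_const (contDiff_inner_const w), sphLap_const, sphLap_inner,
        sphGrad_affine, hh', hk']
      simp only [Pi.add_apply, Pi.mul_apply, Pi.smul_apply, smul_eq_mul, inner_smul_left,
        RCLike.conj_to_real, zero_add]

/-! ### Orthogonal projection onto polynomials -/

/-- Restriction of a polynomial function to the sphere. -/
noncomputable def polyRestrict (d n : ℕ) : polySpace d n →ₗ[ℝ] C(Sph d, ℝ) where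
  toFun f := ⟨fun v => (f : Vec d → ℝ) v,
    (contDiff_of_mem_polySpace f.2).continuous.comp continuous_subtype_val⟩
  map_add' _ _ := rfl
  map_smul' _ _ := rfl

/-- The image of the polynomials of degree at most `n` in `L²`. -/
noncomputable def polyL2 (d n : ℕ) : Submodule ℝ (Lp ℝ 2 (surf d)) :=
  LinearMap.range
    ((ContinuousMap.toLp (E := ℝ) 2 (surf d) ℝ : C(Sph d, ℝ) →ₗ[ℝ] Lp ℝ 2 (surf d)).comp
      (polyRestrict d n))

instance {d n : ℕ} : FiniteDimensional ℝ (polyL2 d n) := by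
  unfold polyL2
  infer_instance

theorem toLp_mem_polyL2 {d n : ℕ} {f : Vec d → ℝ} (hf : f ∈ polySpace d n)
    (g : C(Sph d, ℝ)) (hg : ∀ v, g v = f v) :
    ContinuousMap.toLp (E := ℝ) 2 (surf d) ℝ g ∈ polyL2 d n := by
  refine ⟨⟨f, hf⟩, ?_⟩
  have : polyRestrict d n ⟨f, hf⟩ = g := by
    ext v; exact (hg v).symm
  simp [this]

theorem polyL2_mono {d : ℕ} : Monotone (polyL2 d) := by
  rintro m n hmn _ ⟨f, rfl⟩
  exact toLp_mem_polyL2 (polySpace_mono hmn f.2) _ (fun v => rfl)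

/-- The algebra of polynomial functions on the sphere. -/
noncomputable def polyAlgebra (d : ℕ) : Subalgebra ℝ C(Sph d, ℝ) where
  carrier := {g | ∃ n, ∃ f ∈ polySpace d n, ∀ v, g v = f v}
  mul_mem' := by
    rintro a b ⟨m, f, hf, hf'⟩ ⟨n, g, hg, hg'⟩
    exact ⟨m + n, f * g, mul_mem_polySpace hf hg, fun v => by simp [hf', hg']⟩
  add_mem' := by
    rintro a b ⟨m, f, hf, hf'⟩ ⟨n, g, hg, hg'⟩
    exact ⟨max m n, f + g, add_mem (polySpace_mono (le_max_left m n) hf)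
      (polySpace_mono (le_max_right m n) hg), fun v => by simp [hf', hg']⟩
  algebraMap_mem' r := ⟨0, fun _ => r, const_mem_polySpace r 0, fun v => rfl⟩

theorem separatesPoints_polyAlgebra (d : ℕ) : (polyAlgebra d).SeparatesPoints := by
  intro v w hvw
  refine ⟨fun x => ⟪(v : Vec d), (x : Vec d)⟫_ℝ,
    ⟨⟨fun x => ⟪(v : Vec d), (x : Vec d)⟫_ℝ, by fun_prop⟩,
      ⟨1, _, inner_mem_polySpace (v : Vec d), fun x => rfl⟩, rfl⟩, ?_⟩
  intro h
  refine hvw (Subtype.ext ?_)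
  simp only [inner_coe_self] at h
  exact (inner_eq_one_iff_of_norm_eq_one (norm_coe_sph v) (norm_coe_sph w)).1 h.symm

/-- Stone-Weierstrass in the continuous functions, followed by their density in `L²`. -/
theorem polyL2_dense (d : ℕ) : ⊤ ≤ (⨆ n, polyL2 d n).topologicalClosure := by
  have h1 : Dense (polyAlgebra d : Set C(Sph d, ℝ)) := by
    rw [dense_iff_closure_eq]
    have := ContinuousMap.subalgebra_topologicalClosure_eq_top_of_separatesPoints _
      (separatesPoints_polyAlgebra d)
    have h2 := congrArg (fun A : Subalgebra ℝ C(Sph d, ℝ) => (A : Set C(Sph d, ℝ))) this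
    simpa using h2
  have h2 := (ContinuousMap.toLp_denseRange ℝ (surf d) ℝ (p := 2) (by simp)).dense_image
    (ContinuousMap.toLp (E := ℝ) 2 (surf d) ℝ).continuous h1
  have h3 : ContinuousMap.toLp (E := ℝ) 2 (surf d) ℝ '' (polyAlgebra d : Set C(Sph d, ℝ)) ⊆
      ((⨆ n, polyL2 d n : Submodule ℝ (Lp ℝ 2 (surf d))) : Set (Lp ℝ 2 (surf d))) := by
    rintro _ ⟨g, ⟨n, f, hf, hg⟩, rfl⟩
    exact (le_iSup (polyL2 d) n) (toLp_mem_polyL2 hf g hg)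
  intro x _
  exact (h2.mono h3) x

/-- Lifts the orthonormal basis from `L²` classes to actual polynomials, which are admissible as
test functions. -/
theorem exists_galerkinBasis (d n : ℕ) :
    ∃ p : Fin (Module.finrank ℝ (polyL2 d n)) → polySpace d n, ∀ i,
      (ContinuousMap.toLp (E := ℝ) 2 (surf d) ℝ) (polyRestrict d n (p i)) =
        (stdOrthonormalBasis ℝ (polyL2 d n) i : Lp ℝ 2 (surf d)) := by
  have : ∀ i, ∃ f : polySpace d n,
      (ContinuousMap.toLp (E := ℝ) 2 (surf d) ℝ) (polyRestrict d n f) =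
        (stdOrthonormalBasis ℝ (polyL2 d n) i : Lp ℝ 2 (surf d)) := fun i =>
    (stdOrthonormalBasis ℝ (polyL2 d n) i).2
  exact ⟨fun i => (this i).choose, fun i => (this i).choose_spec⟩

/-- Polynomials whose restrictions to the sphere form an orthonormal basis of `polyL2 d n`. -/
noncomputable def galerkinBasis (d n : ℕ) (i : Fin (Module.finrank ℝ (polyL2 d n))) :
    Vec d → ℝ :=
  (exists_galerkinBasis d n).choose i

theorem galerkinBasis_mem {d n : ℕ} (i) : galerkinBasis d n i ∈ polySpace d n :=
  ((exists_galerkinBasis d n).choose i).2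

theorem coeFn_stdOrthonormalBasis {d n : ℕ} (i) :
    ((stdOrthonormalBasis ℝ (polyL2 d n) i : Lp ℝ 2 (surf d)) : Sph d → ℝ) =ᵐ[surf d]
      fun v => galerkinBasis d n i v := by
  rw [← (exists_galerkinBasis d n).choose_spec i]
  exact ContinuousMap.coeFn_toLp _ _

/-- The `L²`-orthogonal projection of `g` onto the polynomials of degree at most `n`. -/
noncomputable def galerkinProj {d : ℕ} (n : ℕ) (g : Sph d → ℝ) (x : Vec d) : ℝ :=
  ∑ i, (∫ v, galerkinBasis d n i v * g v ∂(surf d)) * galerkinBasis d n i x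

theorem galerkinProj_mem {d : ℕ} (n : ℕ) (g : Sph d → ℝ) :
    galerkinProj n g ∈ polySpace d n := by
  have : galerkinProj n g = ∑ i, (∫ v, galerkinBasis d n i v * g v ∂(surf d)) •
      galerkinBasis d n i := by
    ext x; simp [galerkinProj]
  rw [this]
  exact Submodule.sum_mem _ fun i _ => Submodule.smul_mem _ _ (galerkinBasis_mem i)

theorem memLp_of_continuous_sph {d : ℕ} {F : Type*} [NormedAddCommGroup F] {p : ENNReal}
    {f : Sph d → F} (hf : Continuous f) : MemLp f p (surf d) := by
  obtain ⟨C, hC⟩ := isCompact_univ.exists_bound_of_continuousOn hf.continuousOn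
  exact MemLp.of_bound hf.aestronglyMeasurable_of_compactSpace C
    (Filter.Eventually.of_forall fun v => hC v (mem_univ v))

theorem inner_toLp {d : ℕ} {f g : Sph d → ℝ} (hf : MemLp f 2 (surf d))
    (hg : MemLp g 2 (surf d)) : ⟪hf.toLp f, hg.toLp g⟫_ℝ = ∫ v, f v * g v ∂(surf d) := by
  rw [L2.inner_def]
  refine integral_congr_ae ?_
  filter_upwards [hf.coeFn_toLp, hg.coeFn_toLp] with v h1 h2
  rw [h1, h2]
  exact mul_comm _ _

theorem abs_integral_inner_le {Ω E : Type*} [MeasurableSpace Ω] {μ : Measure Ω}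
    [NormedAddCommGroup E] [InnerProductSpace ℝ E] {f g : Ω → E}
    (hf : MemLp f 2 μ) (hg : MemLp g 2 μ) :
    |∫ x, ⟪f x, g x⟫_ℝ ∂μ| ≤ √(∫ x, ‖f x‖ ^ 2 ∂μ) * √(∫ x, ‖g x‖ ^ 2 ∂μ) := by
  have key : ∀ {f g : Ω → E} (hf : MemLp f 2 μ) (hg : MemLp g 2 μ),
      ⟪hf.toLp f, hg.toLp g⟫_ℝ = ∫ x, ⟪f x, g x⟫_ℝ ∂μ := by
    intro f g hf hg
    rw [L2.inner_def]
    refine integral_congr_ae ?_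
    filter_upwards [hf.coeFn_toLp, hg.coeFn_toLp] with v h1 h2
    rw [h1, h2]
  have hn : ∀ {f : Ω → E} (hf : MemLp f 2 μ), √(∫ x, ‖f x‖ ^ 2 ∂μ) = ‖hf.toLp f‖ := by
    intro f hf
    rw [norm_eq_sqrt_real_inner, key]
    simp_rw [real_inner_self_eq_norm_sq]
  rw [← key hf hg, hn hf, hn hg]
  exact abs_real_inner_le_norm _ _

theorem integrable_inner_of_memLp {Ω E : Type*} [MeasurableSpace Ω] {μ : Measure Ω}
    [NormedAddCommGroup E] [InnerProductSpace ℝ E] {f g : Ω → E}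
    (hf : MemLp f 2 μ) (hg : MemLp g 2 μ) : Integrable (fun x => ⟪f x, g x⟫_ℝ) μ := by
  refine (L2.integrable_inner (𝕜 := ℝ) (hf.toLp f) (hg.toLp g)).congr ?_
  filter_upwards [hf.coeFn_toLp, hg.coeFn_toLp] with v h1 h2
  rw [h1, h2]

theorem memLp_galerkinProj {d : ℕ} (n : ℕ) (g : Sph d → ℝ) :
    MemLp (fun v : Sph d => galerkinProj n g v) 2 (surf d) :=
  memLp_of_continuous_sph
    ((contDiff_of_mem_polySpace (galerkinProj_mem n g)).continuous.comp continuous_subtype_val)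

theorem toLp_galerkinProj {d : ℕ} (n : ℕ) {g : Sph d → ℝ} (hg : MemLp g 2 (surf d)) :
    (memLp_galerkinProj n g).toLp _ = (polyL2 d n).starProjection (hg.toLp g) := by
  have hp : ∀ i, MemLp (fun v : Sph d => galerkinBasis d n i v) 2 (surf d) := fun i =>
    memLp_of_continuous_sph
      ((contDiff_of_mem_polySpace (galerkinBasis_mem i)).continuous.comp continuous_subtype_val)
  have hb : ∀ i, (stdOrthonormalBasis ℝ (polyL2 d n) i : Lp ℝ 2 (surf d)) = (hp i).toLp _ := by
    intro i
    refine Lp.ext ?_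
    filter_upwards [coeFn_stdOrthonormalBasis (d := d) (n := n) i, (hp i).coeFn_toLp] with v h1 h2
    rw [h1, h2]
  rw [Submodule.starProjection_apply,
    (stdOrthonormalBasis ℝ (polyL2 d n)).orthogonalProjectionOnto_apply_eq_sum]
  simp only [hb, inner_toLp, Submodule.coe_sum, Submodule.coe_smul]
  refine Lp.ext ?_
  refine (MemLp.coeFn_toLp _).trans ?_
  have h2 : ∀ᵐ v ∂(surf d), ∀ i, (((∫ v, galerkinBasis d n i v * g v ∂(surf d)) •
      (hp i).toLp _ : Lp ℝ 2 (surf d)) : Sph d → ℝ) v =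
        (∫ v, galerkinBasis d n i v * g v ∂(surf d)) * galerkinBasis d n i v := by
    rw [ae_all_iff]
    intro i
    filter_upwards [Lp.coeFn_smul (∫ v, galerkinBasis d n i v * g v ∂(surf d)) ((hp i).toLp _),
      (hp i).coeFn_toLp] with v h3 h4
    rw [h3, Pi.smul_apply, h4, smul_eq_mul]
  have h3 := Lp.coeFn_finsetSum Finset.univ (fun i =>
    ((∫ v, galerkinBasis d n i v * g v ∂(surf d)) • (hp i).toLp _ : Lp ℝ 2 (surf d)))
  filter_upwards [h2, h3] with v h4 h5
  rw [h5, Finset.sum_apply]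
  simp only [h4]
  rfl

theorem integral_mul_galerkinProj {d n : ℕ} {g : Sph d → ℝ} (hg : MemLp g 2 (surf d))
    {q : Vec d → ℝ} (hq : q ∈ polySpace d n) :
    ∫ v, q v * galerkinProj n g v ∂(surf d) = ∫ v, q v * g v ∂(surf d) := by
  have hqc : Continuous (fun v : Sph d => q v) :=
    (contDiff_of_mem_polySpace hq).continuous.comp continuous_subtype_val
  have hqm : MemLp (fun v : Sph d => q v) 2 (surf d) := memLp_of_continuous_sph hqc
  have hmem : hqm.toLp _ ∈ polyL2 d n := toLp_mem_polyL2 hq ⟨_, hqc⟩ (fun v => rfl)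
  rw [← inner_toLp hqm (memLp_galerkinProj n g), ← inner_toLp hqm hg, toLp_galerkinProj n hg,
    ← Submodule.inner_starProjection_left_eq_right,
    Submodule.starProjection_eq_self_iff.2 hmem]

theorem tendsto_toLp_galerkinProj {d : ℕ} {g : Sph d → ℝ} (hg : MemLp g 2 (surf d)) :
    Filter.Tendsto (fun n => (memLp_galerkinProj n g).toLp _) Filter.atTop
      (nhds (hg.toLp g)) := by
  simp_rw [toLp_galerkinProj _ hg]
  exact Submodule.starProjection_tendsto_self _ polyL2_mono _ (polyL2_dense d)

theorem tendsto_integral_mul_galerkinProj {d : ℕ} {g h : Sph d → ℝ} (hg : MemLp g 2 (surf d))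
    (hh : MemLp h 2 (surf d)) :
    Filter.Tendsto (fun n => ∫ v, h v * galerkinProj n g v ∂(surf d)) Filter.atTop
      (nhds (∫ v, h v * g v ∂(surf d))) := by
  have := (tendsto_const_nhds (x := hh.toLp h)).inner (𝕜 := ℝ) (tendsto_toLp_galerkinProj hg)
  simpa only [inner_toLp] using this

theorem tendsto_integral_sub_galerkinProj_sq {d : ℕ} {g : Sph d → ℝ} (hg : MemLp g 2 (surf d)) :
    Filter.Tendsto (fun n => ∫ v, ‖g v - galerkinProj n g v‖ ^ 2 ∂(surf d)) Filter.atTop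
      (nhds 0) := by
  have h1 := (tendsto_const_nhds (x := hg.toLp g)).sub (tendsto_toLp_galerkinProj hg)
  have h2 := h1.inner (𝕜 := ℝ) h1
  rw [sub_self, inner_zero_left] at h2
  refine h2.congr fun n => ?_
  rw [← MemLp.toLp_sub, inner_toLp]
  refine integral_congr_ae (Filter.Eventually.of_forall fun v => ?_)
  simp [sq]

theorem sum_sq_galerkinCoeff {d : ℕ} (n : ℕ) {g : Sph d → ℝ} (hg : MemLp g 2 (surf d)) :
    ∑ i, (∫ v, galerkinBasis d n i v * g v ∂(surf d)) ^ 2 =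
      ∫ v, g v * galerkinProj n g v ∂(surf d) := by
  have hp : ∀ i, MemLp (fun v : Sph d => galerkinBasis d n i v) 2 (surf d) := fun i =>
    memLp_of_continuous_sph
      ((contDiff_of_mem_polySpace (galerkinBasis_mem i)).continuous.comp continuous_subtype_val)
  have hi : ∀ i, Integrable (fun v : Sph d => galerkinBasis d n i v * g v) (surf d) := fun i =>
    (hp i).integrable_mul hg
  have e : ∀ v : Sph d, g v * galerkinProj n g v =
      ∑ i, (∫ v, galerkinBasis d n i v * g v ∂(surf d)) * (galerkinBasis d n i v * g v) := by
    intro v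
    rw [galerkinProj, Finset.mul_sum]
    exact Finset.sum_congr rfl fun i _ => by ring
  simp_rw [e]
  rw [integral_finsetSum _ (fun i _ => (hi i).const_mul _)]
  refine Finset.sum_congr rfl fun i _ => ?_
  rw [integral_const_mul, sq]

/-! ### Weak gradients and projections -/

theorem IsWeakGradient.integral_mul_sphLap {d : ℕ} {g : Sph d → ℝ} {G : Sph d → Vec d}
    (h : IsWeakGradient g G) {φ : Vec d → ℝ} (hφ : ContDiff ℝ ∞ φ) :
    ∫ v, g v * sphLap φ v ∂(surf d) = - ∫ v, ⟪G v, sphGrad φ v⟫_ℝ ∂(surf d) := by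
  have := h.by_parts _ (contDiff_gradField hφ) (fun v => by
    rw [gradField_coe hφ, inner_sphGrad_self hφ])
  simpa only [sphDiv_gradField hφ, gradField_coe hφ] using this

theorem memLp_sphGrad {d : ℕ} {φ : Vec d → ℝ} (hφ : ContDiff ℝ ∞ φ) :
    MemLp (fun v : Sph d => sphGrad φ v) 2 (surf d) :=
  memLp_of_continuous_sph (continuous_sphGrad hφ)

/-- Let `u` be the projection. As `Δu` is again in the polynomial space, `∫ |∇u|² = -∫ u Δu = -∫ g
Δu = ∫ ⟨G, ∇u⟩`, and Cauchy-Schwarz concludes. -/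
theorem IsWeakGradient.norm_sphGrad_galerkinProj_le {d : ℕ} {g : Sph d → ℝ}
    {G : Sph d → Vec d} (h : IsWeakGradient g G) (hg : MemLp g 2 (surf d)) (n : ℕ) :
    √(∫ v : Sph d, ‖sphGrad (galerkinProj n g) v‖ ^ 2 ∂(surf d)) ≤
      √(∫ v, ‖G v‖ ^ 2 ∂(surf d)) := by
  have hu := contDiff_of_mem_polySpace (galerkinProj_mem n g)
  obtain ⟨q, hq, hq'⟩ := exists_mem_polySpace_sphLap (galerkinProj_mem n g)
  have h1 : ∫ v : Sph d, ‖sphGrad (galerkinProj n g) v‖ ^ 2 ∂(surf d) =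
      ∫ v, ⟪G v, sphGrad (galerkinProj n g) v⟫_ℝ ∂(surf d) := by
    have e1 := SphereCBO.integral_mul_sphLap hu hu
    have e2 := h.integral_mul_sphLap hu
    have e3 := integral_mul_galerkinProj hg hq
    simp_rw [real_inner_self_eq_norm_sq, hq', mul_comm _ (q _)] at e1
    simp_rw [hq', mul_comm _ (q _)] at e2
    linarith
  have h2 := (le_abs_self _).trans (abs_integral_inner_le h.memLp (memLp_sphGrad hu))
  rw [← h1] at h2
  set A := √(∫ v : Sph d, ‖sphGrad (galerkinProj n g) v‖ ^ 2 ∂(surf d))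
  have hA : 0 ≤ A := Real.sqrt_nonneg _
  have h3 : A ^ 2 = ∫ v : Sph d, ‖sphGrad (galerkinProj n g) v‖ ^ 2 ∂(surf d) :=
    Real.sq_sqrt (integral_nonneg fun v => by positivity)
  rw [← h3] at h2
  rcases hA.eq_or_lt with h0 | h0
  · exact h0.symm.le.trans (Real.sqrt_nonneg _)
  · nlinarith

/-- Against a smooth tangential field both sides can be integrated by parts, and the projections
converge in `L²`. -/
theorem IsWeakGradient.tendsto_integral_smooth {d : ℕ} {g : Sph d → ℝ}
    {G : Sph d → Vec d} (h : IsWeakGradient g G) (hg : MemLp g 2 (surf d))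
    {X : Vec d → Vec d} (hX : ContDiff ℝ ∞ X) (ht : ∀ v : Sph d, ⟪X v, (v : Vec d)⟫_ℝ = 0) :
    Filter.Tendsto (fun n => ∫ v, ⟪sphGrad (galerkinProj n g) v, X v⟫_ℝ ∂(surf d))
      Filter.atTop (nhds (∫ v, ⟪G v, X v⟫_ℝ ∂(surf d))) := by
  have h1 := tendsto_integral_mul_galerkinProj hg
    (memLp_of_continuous_sph (p := 2) (continuous_sphDiv hX))
  have h2 := h.by_parts X hX ht
  simp_rw [mul_comm (sphDiv X _)] at h1
  rw [h2] at h1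
  have h3 := h1.neg
  rw [neg_neg] at h3
  refine h3.congr fun n => ?_
  rw [integral_mul_sphDiv (contDiff_of_mem_polySpace (galerkinProj_mem n g)) hX ht, neg_neg]

/-- Density argument for weak convergence: `f` is replaced by a projection of its own, which is
smooth, at a cost uniform in `n` because all gradients have norm at most `K`. -/
theorem IsWeakGradient.tendsto_integral_smul {d : ℕ} {g f : Sph d → ℝ}
    {G : Sph d → Vec d} (h : IsWeakGradient g G) (hg : MemLp g 2 (surf d))
    (hf : MemLp f 2 (surf d)) (z : Vec d) :
    Filter.Tendsto (fun n => ∫ v, ⟪f v • z, sphGrad (galerkinProj n g) v⟫_ℝ ∂(surf d))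
      Filter.atTop (nhds (∫ v, ⟪f v • z, G v⟫_ℝ ∂(surf d))) := by
  have hu := fun n => contDiff_of_mem_polySpace (galerkinProj_mem n g)
  set K := √(∫ v, ‖G v‖ ^ 2 ∂(surf d)) with hK
  have hK0 : 0 ≤ K := Real.sqrt_nonneg _
  have smulz : ∀ {f : Sph d → ℝ}, MemLp f 2 (surf d) → MemLp (fun v => f v • z) 2 (surf d) :=
    fun hf => (ContinuousLinearMap.toSpanSingleton ℝ z).comp_memLp' hf
  have hδ : Filter.Tendsto (fun m => √(∫ v, ‖(f v - galerkinProj m f v) • z‖ ^ 2 ∂(surf d)))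
      Filter.atTop (nhds 0) := by
    have h1 := ((tendsto_integral_sub_galerkinProj_sq hf).mul_const (‖z‖ ^ 2)).sqrt
    rw [zero_mul, Real.sqrt_zero] at h1
    refine h1.congr fun m => ?_
    simp_rw [norm_smul, mul_pow]
    rw [integral_mul_const]
  rw [Metric.tendsto_atTop]
  intro ε hε
  obtain ⟨m, hm⟩ := (hδ.eventually (gt_mem_nhds (show 0 < ε / (4 * (K + 1)) by positivity))).exists
  set δ := √(∫ v, ‖(f v - galerkinProj m f v) • z‖ ^ 2 ∂(surf d))
  have hδ0 : 0 ≤ δ := Real.sqrt_nonneg _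
  have hδK : δ * K ≤ ε / 4 := by
    have : δ * (K + 1) ≤ ε / 4 := by
      rw [lt_div_iff₀ (by positivity)] at hm
      linarith
    nlinarith
  have hfm := memLp_galerkinProj m f
  have close : ∀ {W : Sph d → Vec d}, MemLp W 2 (surf d) →
      √(∫ v, ‖W v‖ ^ 2 ∂(surf d)) ≤ K →
      |∫ v, ⟪f v • z, W v⟫_ℝ ∂(surf d) - ∫ v, ⟪galerkinProj m f v • z, W v⟫_ℝ ∂(surf d)|
        ≤ ε / 4 := by
    intro W hW hWK
    rw [← integral_sub (integrable_inner_of_memLp (smulz hf) hW)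
      (integrable_inner_of_memLp (smulz hfm) hW)]
    simp_rw [← inner_sub_left, ← sub_smul]
    refine (abs_integral_inner_le (smulz (hf.sub hfm)) hW).trans (le_trans ?_ hδK)
    exact mul_le_mul_of_nonneg_left hWK hδ0
  have hXs : ContDiff ℝ ∞ (fun x : Vec d => ‖x‖ ^ 2 • z - ⟪x, z⟫_ℝ • x) :=
    ((contDiff_norm_sq ℝ).smul contDiff_const).sub
      ((contDiff_id.inner ℝ contDiff_const).smul contDiff_id)
  have hXv : ∀ v : Sph d, ‖(v : Vec d)‖ ^ 2 • z - ⟪(v : Vec d), z⟫_ℝ • (v : Vec d) =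
      tangProj (v : Vec d) z := by
    intro v
    rw [tangProj_apply]
    simp
  have hX := h.tendsto_integral_smooth hg
    (X := fun x => galerkinProj m f x • (‖x‖ ^ 2 • z - ⟪x, z⟫_ℝ • x))
    ((contDiff_of_mem_polySpace (galerkinProj_mem m f)).smul hXs) (fun v => by
      rw [hXv, inner_smul_left, inner_tangProj_self, mul_zero])
  -- A tangential vector sees only the tangential part of `z`, so the constant vector may be traded
  -- for a smooth tangential field.
  have swap : ∀ {W : Vec d} {v : Sph d} (c : ℝ), ⟪W, (v : Vec d)⟫_ℝ = 0 →
      ⟪W, c • (‖(v : Vec d)‖ ^ 2 • z - ⟪(v : Vec d), z⟫_ℝ • (v : Vec d))⟫_ℝ = ⟪c • z, W⟫_ℝ := by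
    intro W v c hW
    rw [hXv, inner_smul_right, ← inner_tangProj_comm, tangProj_of_tangential _ _ hW,
      inner_smul_left, real_inner_comm]
    rfl
  have hX' : Filter.Tendsto
      (fun n => ∫ v, ⟪galerkinProj m f v • z, sphGrad (galerkinProj n g) v⟫_ℝ ∂(surf d))
      Filter.atTop (nhds (∫ v, ⟪galerkinProj m f v • z, G v⟫_ℝ ∂(surf d))) := by
    have e : ∫ v, ⟪galerkinProj m f v • z, G v⟫_ℝ ∂(surf d) = ∫ v, ⟪G v, galerkinProj m f v •
        (‖(v : Vec d)‖ ^ 2 • z - ⟪(v : Vec d), z⟫_ℝ • (v : Vec d))⟫_ℝ ∂(surf d) := by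
      refine integral_congr_ae ?_
      filter_upwards [h.tangential] with v hv
      exact (swap _ hv).symm
    rw [e]
    refine hX.congr fun n => ?_
    refine integral_congr_ae (Filter.Eventually.of_forall fun v => ?_)
    exact swap _ (inner_sphGrad_self (hu n) v)
  obtain ⟨N, hN⟩ := Metric.tendsto_atTop.1 hX' (ε / 4) (by positivity)
  refine ⟨N, fun n hn => ?_⟩
  have h1 := close (memLp_sphGrad (hu n)) (h.norm_sphGrad_galerkinProj_le hg n)
  have h2 := close h.memLp le_rfl
  have h3 := hN n hn
  rw [Real.dist_eq] at h3 ⊢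
  rw [abs_le] at h1 h2
  rw [abs_lt] at h3 ⊢
  constructor <;> linarith [h1.1, h1.2, h2.1, h2.2, h3.1, h3.2]

theorem IsWeakGradient.tendsto_integral_inner {d : ℕ} {g : Sph d → ℝ}
    {G F : Sph d → Vec d} (h : IsWeakGradient g G) (hg : MemLp g 2 (surf d))
    (hF : MemLp F 2 (surf d)) :
    Filter.Tendsto (fun n => ∫ v, ⟪F v, sphGrad (galerkinProj n g) v⟫_ℝ ∂(surf d))
      Filter.atTop (nhds (∫ v, ⟪F v, G v⟫_ℝ ∂(surf d))) := by
  set e := stdOrthonormalBasis ℝ (Vec d)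
  have hFi : ∀ i, MemLp (fun v => ⟪e i, F v⟫_ℝ) 2 (surf d) := fun i =>
    (innerSL ℝ (e i)).comp_memLp' hF
  have smulz : ∀ i, MemLp (fun v => ⟪e i, F v⟫_ℝ • e i) 2 (surf d) :=
    fun i => (ContinuousLinearMap.toSpanSingleton ℝ (e i)).comp_memLp' (hFi i)
  have split : ∀ {W : Sph d → Vec d}, MemLp W 2 (surf d) →
      ∫ v, ⟪F v, W v⟫_ℝ ∂(surf d) = ∑ i, ∫ v, ⟪⟪e i, F v⟫_ℝ • e i, W v⟫_ℝ ∂(surf d) := by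
    intro W hW
    rw [← integral_finsetSum _ fun i _ => integrable_inner_of_memLp (smulz i) hW]
    refine integral_congr_ae (Filter.Eventually.of_forall fun v => ?_)
    simp only
    rw [← sum_inner, e.sum_repr']
  rw [split h.memLp]
  simp_rw [split (memLp_sphGrad (contDiff_of_mem_polySpace (galerkinProj_mem _ g)))]
  exact tendsto_finsetSum _ fun i _ => h.tendsto_integral_smul hg (hFi i) (e i)

/-! ### Primitives -/

/-- The chain rule for `c²` where `c' = b` holds only almost everywhere: a primitive of an
integrable function is absolutely continuous, and such functions can be integrated by parts. -/
theorem sq_sub_sq_of_eq_integral {T : ℝ} {b c : ℝ → ℝ}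
    (hb : IntervalIntegrable b volume 0 T)
    (hc : ∀ t ∈ Icc 0 T, c t = c 0 + ∫ r in (0 : ℝ)..t, b r) {s t : ℝ} (hs : 0 ≤ s)
    (hst : s ≤ t) (ht : t ≤ T) :
    c t ^ 2 - c s ^ 2 = ∫ r in s..t, 2 * (c r * b r) := by
  have hT : 0 ≤ T := hs.trans (hst.trans ht)
  have hsub : uIcc s t ⊆ uIcc 0 T := by
    rw [uIcc_of_le hst, uIcc_of_le hT]
    exact Icc_subset_Icc hs ht
  set F : ℝ → ℝ := fun r => c 0 + ∫ x in (0 : ℝ)..r, b x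
  have hFc : ∀ r ∈ uIcc s t, c r = F r := fun r hr =>
    hc r (by simpa [uIcc_of_le hT] using hsub hr)
  have h1 := hb.absolutelyContinuousOnInterval_intervalIntegral (c := 0) (by simp)
  have hconst : AbsolutelyContinuousOnInterval (fun _ : ℝ => c 0) 0 T :=
    (LipschitzWith.const (c 0)).lipschitzOnWith.absolutelyContinuousOnInterval
  have hF : AbsolutelyContinuousOnInterval F s t := (hconst.add h1).mono hsub
  have h2 := hF.integral_deriv_mul_eq_sub hF
  rw [hFc t right_mem_uIcc, hFc s left_mem_uIcc, sq, sq, ← h2]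
  refine intervalIntegral.integral_congr_ae ?_
  filter_upwards [hb.ae_hasDerivAt_integral] with x hx hxs
  have hx2 : x ∈ uIcc s t := uIoc_subset_uIcc hxs
  have h3 : HasDerivAt F (b x) x := (hx (hsub hx2) 0 (by simp)).const_add (c 0)
  rw [h3.deriv, hFc x hx2]
  ring

/-! ### Weighted averages -/

theorem IsObjective.continuous {d : ℕ} {𝓔 : Vec d → ℝ} {c₁ C₀ β : ℝ}
    (h : IsObjective 𝓔 c₁ C₀ β) : Continuous fun v : Sph d => 𝓔 v := by
  have h1 := h.contDiff.continuousOn.comp_continuous (f := fun v : Sph d => (v : Vec d))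
    continuous_subtype_val (fun v => coe_sph_ne_zero v)
  simpa only [Function.comp_def, homExt_coe] using h1

theorem infE_le {d : ℕ} {𝓔 : Vec d → ℝ} (h : Continuous fun v : Sph d => 𝓔 v) (v : Sph d) :
    infE 𝓔 ≤ 𝓔 v :=
  ciInf_le (isCompact_range h).bddBelow v

theorem le_supE {d : ℕ} {𝓔 : Vec d → ℝ} (h : Continuous fun v : Sph d => 𝓔 v) (v : Sph d) :
    𝓔 v ≤ supE 𝓔 :=
  le_ciSup (isCompact_range h).bddAbove v

theorem continuous_weight {d : ℕ} {𝓔 : Vec d → ℝ} (h : Continuous fun v : Sph d => 𝓔 v) (α : ℝ) :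
    Continuous fun v : Sph d => weight α 𝓔 v :=
  Real.continuous_exp.comp (continuous_const.mul h)

theorem weight_pos {d : ℕ} (α : ℝ) (𝓔 : Vec d → ℝ) (v : Vec d) : 0 < weight α 𝓔 v :=
  Real.exp_pos _

namespace IsL2Density

variable {d : ℕ} {g : Sph d → ℝ}

theorem integrable (hg : IsL2Density g) : Integrable g (surf d) :=
  hg.memLp.integrable (by norm_num)

theorem integrable_mul (hg : IsL2Density g) {f : Sph d → ℝ} (hf : Continuous f) :
    Integrable (fun v => f v * g v) (surf d) :=
  (memLp_of_continuous_sph (p := 2) hf).integrable_mul hg.memLp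

theorem integral_mul_le (hg : IsL2Density g) {f h : Sph d → ℝ} (hf : Continuous f)
    (hh : Continuous h) (hfh : ∀ v, f v ≤ h v) :
    ∫ v, f v * g v ∂(surf d) ≤ ∫ v, h v * g v ∂(surf d) := by
  refine integral_mono_ae (hg.integrable_mul hf) (hg.integrable_mul hh) ?_
  filter_upwards [hg.nonneg] with v hv
  exact mul_le_mul_of_nonneg_right (hfh v) hv

theorem integral_const_mul (hg : IsL2Density g) (c : ℝ) : ∫ v, c * g v ∂(surf d) = c := by
  rw [MeasureTheory.integral_const_mul, hg.mass, mul_one]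

theorem integral_mul_nonneg (hg : IsL2Density g) {f : Sph d → ℝ} (hf : ∀ v, 0 ≤ f v) :
    0 ≤ ∫ v, f v * g v ∂(surf d) := by
  refine integral_nonneg_of_ae ?_
  filter_upwards [hg.nonneg] with v hv
  exact mul_nonneg (hf v) hv

theorem abs_integral_mul_le (hg : IsL2Density g) {f : Sph d → ℝ} (hf : Continuous f) {C : ℝ}
    (hC : ∀ v, |f v| ≤ C) : |∫ v, f v * g v ∂(surf d)| ≤ C := by
  rw [abs_le]
  constructor
  · have := hg.integral_mul_le (continuous_const (y := -C)) hf (fun v => (abs_le.1 (hC v)).1)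
    rwa [hg.integral_const_mul] at this
  · have := hg.integral_mul_le hf (continuous_const (y := C)) (fun v => (abs_le.1 (hC v)).2)
    rwa [hg.integral_const_mul] at this

theorem integrable_smul (hg : IsL2Density g) {f : Sph d → Vec d} (hf : Continuous f) :
    Integrable (fun v => g v • f v) (surf d) := by
  have h := (memLp_of_continuous_sph (p := 2) hf).smul (r := 1) hg.memLp
  exact memLp_one_iff_integrable.1 h

theorem inner_mean (hg : IsL2Density g) (z : Vec d) :
    ⟪z, mean g⟫_ℝ = ∫ v, ⟪z, (v : Vec d)⟫_ℝ * g v ∂(surf d) := by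
  rw [mean, ← integral_inner (hg.integrable_smul continuous_subtype_val)]
  refine integral_congr_ae (Filter.Eventually.of_forall fun v => ?_)
  simp only [inner_smul_right]
  ring

theorem norm_mean_le (hg : IsL2Density g) : ‖mean g‖ ≤ 1 := by
  have h1 := hg.inner_mean (mean g)
  have h2 := hg.abs_integral_mul_le (f := fun v : Sph d => ⟪mean g, (v : Vec d)⟫_ℝ)
    (by fun_prop) (C := ‖mean g‖) (fun v => by
      have := abs_real_inner_le_norm (mean g) (v : Vec d)
      rwa [norm_coe_sph, mul_one] at this)
  rw [← h1, real_inner_self_eq_norm_sq, abs_of_nonneg (by positivity)] at h2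
  nlinarith [norm_nonneg (mean g)]

theorem weightNorm_pos (hg : IsL2Density g) {𝓔 : Vec d → ℝ}
    (h : Continuous fun v : Sph d => 𝓔 v) {α : ℝ} (hα : 0 < α) :
    Real.exp (-α * supE 𝓔) ≤ weightNorm α 𝓔 g := by
  have := hg.integral_mul_le (continuous_const (y := Real.exp (-α * supE 𝓔)))
    (continuous_weight h α) (fun v => by
      refine Real.exp_le_exp.2 ?_
      nlinarith [le_supE h v])
  rwa [hg.integral_const_mul] at this

theorem inner_consensus (hg : IsL2Density g) {𝓔 : Vec d → ℝ}
    (h : Continuous fun v : Sph d => 𝓔 v) {α : ℝ} (z : Vec d) :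
    ⟪z, consensus α 𝓔 g⟫_ℝ = (weightNorm α 𝓔 g)⁻¹ *
      ∫ v, (⟪z, (v : Vec d)⟫_ℝ * weight α 𝓔 v) * g v ∂(surf d) := by
  have hw := continuous_weight h α
  have hi : Integrable (fun v : Sph d => (weight α 𝓔 (v : Vec d) * g v) • (v : Vec d))
      (surf d) := by
    have := hg.integrable_smul (f := fun v => weight α 𝓔 (v : Vec d) • (v : Vec d))
      (hw.smul continuous_subtype_val)
    refine this.congr (Filter.Eventually.of_forall fun v => ?_)
    simp only [smul_smul, mul_comm]
  rw [consensus, inner_smul_right, ← integral_inner hi]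
  congr 1
  refine integral_congr_ae (Filter.Eventually.of_forall fun v => ?_)
  simp only [inner_smul_right]
  ring

/-- Jensen's inequality for the squared distance to the consensus point. -/
theorem norm_sub_consensus_sq_mul_le (hg : IsL2Density g) {𝓔 : Vec d → ℝ}
    (h : Continuous fun v : Sph d => 𝓔 v) {α : ℝ} (hα : 0 < α) (z : Vec d) :
    ‖z - consensus α 𝓔 g‖ ^ 2 * weightNorm α 𝓔 g ≤
      ∫ v, (‖(v : Vec d) - z‖ ^ 2 * weight α 𝓔 v) * g v ∂(surf d) := by
  have hw := continuous_weight h α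
  have hW := (Real.exp_pos _).trans_le (hg.weightNorm_pos h hα)
  set m := consensus α 𝓔 g
  have hi := hg.inner_consensus h (α := α) (z - m)
  have h0 : 0 ≤ ∫ v, (‖(v : Vec d) - m‖ ^ 2 * weight α 𝓔 v) * g v ∂(surf d) :=
    hg.integral_mul_nonneg fun v => mul_nonneg (by positivity) (weight_pos _ _ _).le
  have e : ∀ v : Sph d, (‖(v : Vec d) - z‖ ^ 2 * weight α 𝓔 v) * g v =
      (‖(v : Vec d) - m‖ ^ 2 * weight α 𝓔 v) * g v
        - 2 * ((⟪z - m, (v : Vec d)⟫_ℝ * weight α 𝓔 v) * g v)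
        + (2 * ⟪z - m, m⟫_ℝ + ‖z - m‖ ^ 2) * (weight α 𝓔 v * g v) := by
    intro v
    have : ‖(v : Vec d) - z‖ ^ 2 = ‖(v : Vec d) - m‖ ^ 2 - 2 * ⟪z - m, (v : Vec d)⟫_ℝ +
        2 * ⟪z - m, m⟫_ℝ + ‖z - m‖ ^ 2 := by
      have : (v : Vec d) - z = (v - m) - (z - m) := by abel
      rw [this, norm_sub_sq_real, inner_sub_left, real_inner_comm (z - m) (v : Vec d),
        real_inner_comm (z - m) m]
      ring
    rw [this]; ring
  have i1 := hg.integrable_mul (f := fun v : Sph d => ‖(v : Vec d) - m‖ ^ 2 * weight α 𝓔 v)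
    (by fun_prop)
  have i2 := hg.integrable_mul (f := fun v : Sph d => ⟪z - m, (v : Vec d)⟫_ℝ * weight α 𝓔 v)
    (by fun_prop)
  have i3 := hg.integrable_mul hw
  have i4 : Integrable (fun v : Sph d => (‖(v : Vec d) - m‖ ^ 2 * weight α 𝓔 v) * g v
        - 2 * ((⟪z - m, (v : Vec d)⟫_ℝ * weight α 𝓔 v) * g v)) (surf d) := i1.sub (i2.const_mul 2)
  simp_rw [e]
  rw [integral_add i4 (i3.const_mul _),
    integral_sub i1 (i2.const_mul 2), MeasureTheory.integral_const_mul,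
    MeasureTheory.integral_const_mul]
  have h3 : ∫ v, (⟪z - m, (v : Vec d)⟫_ℝ * weight α 𝓔 v) * g v ∂(surf d) =
      ⟪z - m, m⟫_ℝ * weightNorm α 𝓔 g := by
    rw [hi]; field_simp
  rw [h3]
  have h4 : ∫ v, weight α 𝓔 v * g v ∂(surf d) = weightNorm α 𝓔 g := rfl
  rw [h4]
  nlinarith

theorem norm_consensus_le (hg : IsL2Density g) {𝓔 : Vec d → ℝ}
    (h : Continuous fun v : Sph d => 𝓔 v) {α : ℝ} (hα : 0 < α) :
    ‖consensus α 𝓔 g‖ ≤ 1 := by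
  have hW := (Real.exp_pos _).trans_le (hg.weightNorm_pos h hα)
  have h1 := hg.norm_sub_consensus_sq_mul_le h hα 0
  simp only [zero_sub, norm_neg, sub_zero, norm_coe_sph, one_pow, one_mul] at h1
  have h2 : ‖consensus α 𝓔 g‖ ^ 2 ≤ 1 :=
    le_of_mul_le_mul_right (by simpa [weightNorm] using h1) hW
  nlinarith [norm_nonneg (consensus α 𝓔 g)]

theorem integral_sq_eq_norm2_sq (hg : MemLp g 2 (surf d)) :
    ∫ v, g v ^ 2 ∂(surf d) = norm2 g ^ 2 := by
  have h1 := inner_toLp hg hg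
  rw [real_inner_self_eq_norm_sq, Lp.norm_toLp] at h1
  simp_rw [← sq] at h1
  exact h1.symm

end IsL2Density

/-! ### The flux of the mean-field equation -/

/-- The time derivative of `∫ φ dρ` for a solution with density `g` and consensus point `m`. -/
noncomputable def flux {d : ℕ} (lam σ : ℝ) (m : Vec d) (g : Sph d → ℝ) (φ : Vec d → ℝ) : ℝ :=
  -lam * ∫ v, ⟪⟪m, (v : Vec d)⟫_ℝ • (v : Vec d) - m, sphGrad φ v⟫_ℝ * g v ∂(surf d)
    + σ ^ 2 / 2 * ∫ v, ‖(v : Vec d) - m‖ ^ 2 * sphLap φ v * g v ∂(surf d)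

theorem inner_drift_eq {d : ℕ} (m h : Vec d) (v : Sph d) :
    ⟪⟪m, (v : Vec d)⟫_ℝ • (v : Vec d) - m, h⟫_ℝ = -⟪tangProj (v : Vec d) m, h⟫_ℝ := by
  rw [tangProj_apply, real_inner_comm (v : Vec d) m, ← inner_neg_left, neg_sub]

theorem continuous_drift {d : ℕ} (m : Vec d) {φ : Vec d → ℝ} (hφ : ContDiff ℝ ∞ φ) :
    Continuous fun v : Sph d => ⟪⟪m, (v : Vec d)⟫_ℝ • (v : Vec d) - m, sphGrad φ v⟫_ℝ := by
  have := continuous_sphGrad hφ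
  fun_prop

theorem continuous_diffusion {d : ℕ} (m : Vec d) {φ : Vec d → ℝ} (hφ : ContDiff ℝ ∞ φ) :
    Continuous fun v : Sph d => ‖(v : Vec d) - m‖ ^ 2 * sphLap φ v := by
  have := continuous_sphLap hφ
  fun_prop

theorem norm_coe_sub_sq_le {d : ℕ} {m : Vec d} (hm : ‖m‖ ≤ 1) (v : Sph d) :
    ‖(v : Vec d) - m‖ ^ 2 ≤ 4 := by
  have h1 := norm_sub_le (v : Vec d) m
  rw [norm_coe_sph] at h1
  nlinarith [norm_nonneg ((v : Vec d) - m)]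

/-- The bound is uniform in `m` and `g`, hence in time along a solution; this gives integrability of
the flux in time. -/
theorem exists_abs_flux_le {d : ℕ} (lam σ : ℝ) {φ : Vec d → ℝ} (hφ : ContDiff ℝ ∞ φ) :
    ∃ C : ℝ, ∀ (m : Vec d) (g : Sph d → ℝ), ‖m‖ ≤ 1 → IsL2Density g →
      |flux lam σ m g φ| ≤ C := by
  obtain ⟨A, hA⟩ := isCompact_univ.exists_bound_of_continuousOn
    (continuous_sphGrad hφ).continuousOn
  obtain ⟨B, hB⟩ := isCompact_univ.exists_bound_of_continuousOn
    (continuous_sphLap hφ).continuousOn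
  refine ⟨|lam| * A + σ ^ 2 / 2 * (4 * B), fun m g hm hg => ?_⟩
  have h1 := hg.abs_integral_mul_le (continuous_drift m hφ) (C := A) (fun v => by
    rw [inner_drift_eq, abs_neg]
    refine (abs_real_inner_le_norm _ _).trans ?_
    have := (norm_tangProj_le v m).trans hm
    have h2 := hA v (mem_univ v)
    nlinarith [norm_nonneg (sphGrad φ v)])
  have h2 := hg.abs_integral_mul_le (continuous_diffusion m hφ) (C := 4 * B) (fun v => by
    rw [abs_mul, abs_of_nonneg (by positivity)]
    exact mul_le_mul (norm_coe_sub_sq_le hm v) (hB v (mem_univ v)) (abs_nonneg _) (by norm_num))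
  refine (abs_add_le _ _).trans (add_le_add ?_ ?_)
  · rw [abs_mul, abs_neg]
    exact mul_le_mul_of_nonneg_left h1 (abs_nonneg _)
  · rw [abs_mul, abs_of_nonneg (by positivity)]
    exact mul_le_mul_of_nonneg_left h2 (by positivity)

/-- Linearity in the test function lets a test function that varies in time be expanded in finitely
many fixed ones. -/
theorem flux_sum {d : ℕ} (lam σ : ℝ) (m : Vec d) {g : Sph d → ℝ} (hg : MemLp g 2 (surf d))
    {ι : Type*} (s : Finset ι) (c : ι → ℝ) {p : ι → Vec d → ℝ} (hp : ∀ i, ContDiff ℝ ∞ (p i)) :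
    flux lam σ m g (fun x => ∑ i ∈ s, c i * p i x) = ∑ i ∈ s, c i * flux lam σ m g (p i) := by
  classical
  have hi : ∀ {f : Sph d → ℝ}, Continuous f → Integrable (fun v => f v * g v) (surf d) :=
    fun hf => (memLp_of_continuous_sph (p := 2) hf).integrable_mul hg
  have hs : ∀ s : Finset ι, ContDiff ℝ ∞ (fun x => ∑ i ∈ s, c i * p i x) := fun s =>
    ContDiff.sum fun i _ => contDiff_const.mul (hp i)
  induction s using Finset.induction_on with
  | empty => simp [flux, sphGrad_const, sphLap_const]
  | insert a s ha ih =>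
    rw [Finset.sum_insert ha, ← ih]
    simp_rw [Finset.sum_insert ha]
    have hcp : ContDiff ℝ ∞ (fun x => c a * p a x) := contDiff_const.mul (hp a)
    simp only [flux]
    have e1 : ∀ v : Sph d, ⟪⟪m, (v : Vec d)⟫_ℝ • (v : Vec d) - m,
        sphGrad (fun x => c a * p a x + ∑ i ∈ s, c i * p i x) v⟫_ℝ * g v =
        c a * (⟪⟪m, (v : Vec d)⟫_ℝ • (v : Vec d) - m, sphGrad (p a) v⟫_ℝ * g v) +
        ⟪⟪m, (v : Vec d)⟫_ℝ • (v : Vec d) - m,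
          sphGrad (fun x => ∑ i ∈ s, c i * p i x) v⟫_ℝ * g v := by
      intro v
      rw [sphGrad_add hcp (hs s), sphGrad_const_mul _ (hp a), inner_add_right, inner_smul_right]
      ring
    have e2 : ∀ v : Sph d, ‖(v : Vec d) - m‖ ^ 2 *
        sphLap (fun x => c a * p a x + ∑ i ∈ s, c i * p i x) v * g v =
        c a * (‖(v : Vec d) - m‖ ^ 2 * sphLap (p a) v * g v) +
        ‖(v : Vec d) - m‖ ^ 2 * sphLap (fun x => ∑ i ∈ s, c i * p i x) v * g v := by
      intro v
      rw [sphLap_add hcp (hs s), sphLap_const_mul _ (hp a)]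
      ring
    simp_rw [e1, e2]
    rw [integral_add ((hi (continuous_drift m (hp a))).const_mul _)
        (hi (continuous_drift m (hs s))),
      integral_add ((hi (continuous_diffusion m (hp a))).const_mul _)
        (hi (continuous_diffusion m (hs s))),
      integral_const_mul, integral_const_mul]
    ring

/-- The flux in weak form, for a density with a square integrable weak gradient. -/
theorem IsWeakGradient.flux_eq {d : ℕ} (lam σ : ℝ) (m : Vec d) {g : Sph d → ℝ}
    {G : Sph d → Vec d} (h : IsWeakGradient g G) (hg : MemLp g 2 (surf d)) {φ : Vec d → ℝ}
    (hφ : ContDiff ℝ ∞ φ) :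
    flux lam σ m g φ =
      (lam + σ ^ 2) * ∫ v, ⟪g v • tangProj (v : Vec d) m, sphGrad φ v⟫_ℝ ∂(surf d)
      - σ ^ 2 / 2 * ∫ v, ⟪‖(v : Vec d) - m‖ ^ 2 • G v, sphGrad φ v⟫_ℝ ∂(surf d) := by
  have ha : ContDiff ℝ ∞ (fun x : Vec d => ‖x - m‖ ^ 2) :=
    (contDiff_norm_sq ℝ).comp (contDiff_id.sub contDiff_const)
  have hga : ∀ v : Sph d, sphGrad (fun x : Vec d => ‖x - m‖ ^ 2) v =
      (-2 : ℝ) • tangProj (v : Vec d) m := by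
    intro v
    have e : ∀ w : Sph d, ‖(w : Vec d) - m‖ ^ 2 =
        (1 + ‖m‖ ^ 2) + ⟪(-2 : ℝ) • m, (w : Vec d)⟫_ℝ := by
      intro w
      rw [norm_sub_sq_real, norm_coe_sph, inner_smul_left, real_inner_comm]
      simp only [RCLike.conj_to_real]
      ring
    rw [sphGrad_congr (φ := fun x => ‖x - m‖ ^ 2)
      (ψ := fun x => (1 + ‖m‖ ^ 2) + ⟪(-2 : ℝ) • m, x⟫_ℝ) e, sphGrad_affine, map_smul]
  have hi : ∀ {f : Sph d → ℝ}, Continuous f → Integrable (fun v => f v * g v) (surf d) :=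
    fun hf => (memLp_of_continuous_sph (p := 2) hf).integrable_mul hg
  -- Integration by parts against `|x - m|² ∇φ`. The derivative of the weight is `-2` times the
  -- tangential part of `m`, which turns the drift coefficient `λ` into `λ + σ²`.
  have hb := h.by_parts (fun x => ‖x - m‖ ^ 2 • gradField φ x)
    (ha.smul (contDiff_gradField hφ)) (fun v => by
      rw [gradField_coe hφ, inner_smul_left, inner_sphGrad_self hφ, mul_zero])
  have hc : Continuous fun v : Sph d => ⟪tangProj (v : Vec d) m, sphGrad φ v⟫_ℝ :=
    (continuous_tangProj_apply continuous_subtype_val continuous_const).inner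
      (continuous_sphGrad hφ)
  have e1 : ∀ v : Sph d, g v * sphDiv (fun x => ‖x - m‖ ^ 2 • gradField φ x) v =
      ‖(v : Vec d) - m‖ ^ 2 * sphLap φ v * g v -
        2 * (⟪tangProj (v : Vec d) m, sphGrad φ v⟫_ℝ * g v) := by
    intro v
    rw [sphDiv_smul ha (contDiff_gradField hφ), hga, sphDiv_gradField hφ, gradField_coe hφ,
      inner_smul_left]
    simp only [RCLike.conj_to_real]
    ring
  simp_rw [e1] at hb
  rw [integral_sub (hi (continuous_diffusion m hφ)) ((hi hc).const_mul 2),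
    integral_const_mul] at hb
  have e2 : ∫ v, ⟪g v • tangProj (v : Vec d) m, sphGrad φ v⟫_ℝ ∂(surf d) =
      ∫ v, ⟪tangProj (v : Vec d) m, sphGrad φ v⟫_ℝ * g v ∂(surf d) := by
    refine integral_congr_ae (Filter.Eventually.of_forall fun v => ?_)
    simp only [inner_smul_left, RCLike.conj_to_real]
    ring
  have e3 : ∫ v, ⟪‖(v : Vec d) - m‖ ^ 2 • G v, sphGrad φ v⟫_ℝ ∂(surf d) =
      ∫ v, ⟪G v, ‖(v : Vec d) - m‖ ^ 2 • gradField φ v⟫_ℝ ∂(surf d) := by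
    refine integral_congr_ae (Filter.Eventually.of_forall fun v => ?_)
    simp only [gradField_coe hφ, inner_smul_left, inner_smul_right, RCLike.conj_to_real]
  have e4 : ∫ v, ⟪⟪m, (v : Vec d)⟫_ℝ • (v : Vec d) - m, sphGrad φ v⟫_ℝ * g v ∂(surf d) =
      - ∫ v, ⟪tangProj (v : Vec d) m, sphGrad φ v⟫_ℝ * g v ∂(surf d) := by
    rw [← integral_neg]
    refine integral_congr_ae (Filter.Eventually.of_forall fun v => ?_)
    simp only [inner_drift_eq, neg_mul]
  rw [flux, e2, e3, e4]
  linear_combination (σ ^ 2 / 2) * hb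

/-! ### The energy estimate -/

/-- Grönwall's inequality in integral form. -/
theorem le_mul_exp_of_le_integral {T K y₀ : ℝ} {y : ℝ → ℝ} (hK : 0 ≤ K)
    (hy : IntervalIntegrable y volume 0 T)
    (h : ∀ t ∈ Icc 0 T, y t ≤ y₀ + K * ∫ s in (0 : ℝ)..t, y s) {t : ℝ} (ht : t ∈ Icc 0 T) :
    y t ≤ y₀ * Real.exp (K * t) := by
  have hT : 0 ≤ T := ht.1.trans ht.2
  have hsub : uIcc 0 t ⊆ uIcc 0 T := by
    rw [uIcc_of_le ht.1, uIcc_of_le hT]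
    exact Icc_subset_Icc le_rfl ht.2
  -- `y` is merely integrable, so the argument runs on this absolutely continuous majorant: `e^(-Kr)
  -- Y(r)` has nonpositive derivative almost everywhere.
  set Y : ℝ → ℝ := fun r => y₀ + K * ∫ s in (0 : ℝ)..r, y s
  have h1 := hy.absolutelyContinuousOnInterval_intervalIntegral (c := 0) (by simp)
  have hconst : AbsolutelyContinuousOnInterval (fun _ : ℝ => y₀) 0 T :=
    (LipschitzWith.const y₀).lipschitzOnWith.absolutelyContinuousOnInterval
  have hY : AbsolutelyContinuousOnInterval Y 0 t := (hconst.add (h1.const_mul K)).mono hsub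
  have hE : AbsolutelyContinuousOnInterval (fun r => Real.exp (-K * r)) 0 t := by
    refine ContDiffOn.absolutelyContinuousOnInterval ?_
    exact (Real.contDiff_exp.comp (contDiff_const.mul contDiff_id)).contDiffOn
  have h2 := hE.integral_deriv_mul_eq_sub hY
  have h3 : ∫ r in (0 : ℝ)..t, deriv (fun r => Real.exp (-K * r)) r * Y r +
      Real.exp (-K * r) * deriv Y r ≤ 0 := by
    rw [intervalIntegral.integral_of_le ht.1]
    refine integral_nonpos_of_ae ?_
    rw [Filter.EventuallyLE, ae_restrict_iff' measurableSet_Ioc]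
    filter_upwards [hy.ae_hasDerivAt_integral] with r hr hrt
    have hr0 : r ∈ Icc 0 T := ⟨hrt.1.le, hrt.2.trans ht.2⟩
    have h4 : HasDerivAt Y (K * y r) r :=
      ((hr (by rwa [uIcc_of_le hT]) 0 (by simp)).const_mul K).const_add y₀
    have h5 : HasDerivAt (fun r => Real.exp (-K * r)) (Real.exp (-K * r) * (-K)) r := by
      simpa using ((hasDerivAt_id r).const_mul (-K)).exp
    rw [h4.deriv, h5.deriv]
    have h6 := h r hr0
    have h7 : 0 ≤ Real.exp (-K * r) * K := by positivity
    simp only [Pi.zero_apply]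
    change _ ≤ Y r at h6
    nlinarith
  rw [h2] at h3
  have h8 : Y 0 = y₀ := by simp [Y]
  rw [h8, mul_zero, Real.exp_zero, one_mul] at h3
  have h9 : y t ≤ Y t := h t ht
  have h10 : Real.exp (-K * t) * Real.exp (K * t) = 1 := by
    rw [← Real.exp_add]; simp
  have h11 : Y t ≤ y₀ * Real.exp (K * t) := by
    calc Y t = Real.exp (-K * t) * Y t * Real.exp (K * t) := by
          rw [mul_right_comm, h10, one_mul]
      _ ≤ _ := by
          refine mul_le_mul_of_nonneg_right ?_ (Real.exp_pos _).le
          linarith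
  exact h9.trans h11

namespace IsWeakGradient

variable {d : ℕ} {g : Sph d → ℝ} {G : Sph d → Vec d}

/-- The difference of the two sides is `(⟨v, m⟩ - 1)²`. Thus the drift degenerates at least as fast
as the square root of the diffusion coefficient. -/
theorem _root_.SphereCBO.norm_tangProj_sq_le {d : ℕ} (v : Sph d) (m : Vec d) :
    ‖tangProj (v : Vec d) m‖ ^ 2 ≤ ‖(v : Vec d) - m‖ ^ 2 := by
  rw [norm_tangProj_sq, norm_sub_sq_real, norm_coe_sph]
  nlinarith [sq_nonneg (⟪(v : Vec d), m⟫_ℝ - 1)]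

theorem _root_.SphereCBO.memLp_smul_tangProj {d : ℕ} {g : Sph d → ℝ} (hg : MemLp g 2 (surf d))
    (m : Vec d) : MemLp (fun v => g v • tangProj (v : Vec d) m) 2 (surf d) := by
  have hc : Continuous fun v : Sph d => tangProj (v : Vec d) m :=
    continuous_tangProj_apply continuous_subtype_val continuous_const
  refine hg.of_le_mul (c := ‖m‖)
    (hg.aestronglyMeasurable.smul hc.aestronglyMeasurable_of_compactSpace)
    (Filter.Eventually.of_forall fun v => ?_)
  rw [norm_smul, mul_comm]
  exact mul_le_mul_of_nonneg_right (norm_tangProj_le v m) (norm_nonneg _)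

theorem memLp_smul_norm_sub (h : IsWeakGradient g G) (m : Vec d) :
    MemLp (fun v : Sph d => ‖(v : Vec d) - m‖ ^ 2 • G v) 2 (surf d) := by
  have hc : Continuous fun v : Sph d => ‖(v : Vec d) - m‖ ^ 2 := by fun_prop
  obtain ⟨C, hC⟩ := isCompact_univ.exists_bound_of_continuousOn hc.continuousOn
  refine h.memLp.of_le_mul (c := C)
    (hc.aestronglyMeasurable_of_compactSpace.smul h.memLp.aestronglyMeasurable)
    (Filter.Eventually.of_forall fun v => ?_)
  rw [norm_smul]
  exact mul_le_mul_of_nonneg_right (hC v (mem_univ v)) (norm_nonneg _)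

theorem tendsto_flux (h : IsWeakGradient g G) (hg : MemLp g 2 (surf d)) (lam σ : ℝ) (m : Vec d) :
    Filter.Tendsto (fun n => flux lam σ m g (galerkinProj n g)) Filter.atTop
      (nhds ((lam + σ ^ 2) * ∫ v, ⟪g v • tangProj (v : Vec d) m, G v⟫_ℝ ∂(surf d)
      - σ ^ 2 / 2 * ∫ v : Sph d, ⟪‖(v : Vec d) - m‖ ^ 2 • G v, G v⟫_ℝ ∂(surf d))) := by
  simp_rw [h.flux_eq lam σ m hg (contDiff_of_mem_polySpace (galerkinProj_mem _ g))]
  exact ((h.tendsto_integral_inner hg (memLp_smul_tangProj hg m)).const_mul _).sub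
    ((h.tendsto_integral_inner hg (h.memLp_smul_norm_sub m)).const_mul _)

/-- Pointwise Young inequality for `(λ + σ²)|g|/σ` and `σ |v - m| |G|`: the dissipation absorbs the
drift term exactly, and no dimensional constant enters. -/
theorem limit_flux_le (h : IsWeakGradient g G) (hg : MemLp g 2 (surf d)) {lam σ : ℝ}
    (hσ : 0 < σ) (m : Vec d) :
    (lam + σ ^ 2) * ∫ v, ⟪g v • tangProj (v : Vec d) m, G v⟫_ℝ ∂(surf d)
      - σ ^ 2 / 2 * ∫ v : Sph d, ⟪‖(v : Vec d) - m‖ ^ 2 • G v, G v⟫_ℝ ∂(surf d) ≤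
      (lam + σ ^ 2) ^ 2 / σ ^ 2 / 2 * ∫ v, g v ^ 2 ∂(surf d) := by
  have i1 := integrable_inner_of_memLp (memLp_smul_tangProj hg m) h.memLp
  have i2 := integrable_inner_of_memLp (h.memLp_smul_norm_sub m) h.memLp
  rw [← integral_const_mul, ← integral_const_mul, ← integral_const_mul,
    ← integral_sub (i1.const_mul _) (i2.const_mul _)]
  refine integral_mono ((i1.const_mul _).sub (i2.const_mul _)) (hg.integrable_sq.const_mul _) ?_
  intro v
  simp only [inner_smul_left, RCLike.conj_to_real, real_inner_self_eq_norm_sq]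
  set L := lam + σ ^ 2
  have h1 : L * g v * ⟪tangProj (v : Vec d) m, G v⟫_ℝ ≤
      |L * g v| * (‖(v : Vec d) - m‖ * ‖G v‖) := by
    refine (le_abs_self _).trans ?_
    rw [abs_mul]
    refine mul_le_mul_of_nonneg_left ((abs_real_inner_le_norm _ _).trans ?_) (abs_nonneg _)
    refine mul_le_mul_of_nonneg_right ?_ (norm_nonneg _)
    exact le_of_sq_le_sq (norm_tangProj_sq_le v m) (norm_nonneg _)
  have h2 : |L * g v| * (‖(v : Vec d) - m‖ * ‖G v‖) ≤
      L ^ 2 / σ ^ 2 / 2 * g v ^ 2 + σ ^ 2 / 2 * (‖(v : Vec d) - m‖ ^ 2 * ‖G v‖ ^ 2) := by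
    have h3 : L ^ 2 / σ ^ 2 / 2 * g v ^ 2 = (|L * g v| / σ) ^ 2 / 2 := by
      rw [div_pow, sq_abs]; ring
    have h4 : |L * g v| * (‖(v : Vec d) - m‖ * ‖G v‖) =
        (|L * g v| / σ) * (σ * (‖(v : Vec d) - m‖ * ‖G v‖)) := by
      field_simp
    rw [h3, h4]
    nlinarith [sq_nonneg (|L * g v| / σ - σ * (‖(v : Vec d) - m‖ * ‖G v‖))]
  linarith

/-- A bound independent of `n`, to be used as dominating function in time. -/
theorem abs_flux_galerkinProj_le (h : IsWeakGradient g G) (hg : MemLp g 2 (surf d)) {lam σ : ℝ}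
    (hlam : 0 ≤ lam) {m : Vec d} (hm : ‖m‖ ≤ 1) (n : ℕ) :
    |flux lam σ m g (galerkinProj n g)| ≤
      (lam + σ ^ 2) * (norm2 g * √(∫ v, ‖G v‖ ^ 2 ∂(surf d))) +
        2 * σ ^ 2 * ∫ v, ‖G v‖ ^ 2 ∂(surf d) := by
  have hu := contDiff_of_mem_polySpace (galerkinProj_mem n g)
  have hb := h.norm_sphGrad_galerkinProj_le hg n
  set Γ := √(∫ v, ‖G v‖ ^ 2 ∂(surf d))
  have hΓ : ∫ v, ‖G v‖ ^ 2 ∂(surf d) = Γ * Γ :=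
    (Real.mul_self_sqrt (integral_nonneg fun v => by positivity)).symm
  have hm2 := memLp_smul_tangProj hg m
  have hm3 := h.memLp_smul_norm_sub m
  have h1 : √(∫ v, ‖g v • tangProj (v : Vec d) m‖ ^ 2 ∂(surf d)) ≤ norm2 g := by
    refine Real.sqrt_le_iff.2 ⟨ENNReal.toReal_nonneg, ?_⟩
    rw [← IsL2Density.integral_sq_eq_norm2_sq hg]
    refine integral_mono hm2.norm.integrable_sq hg.integrable_sq fun v => ?_
    simp only [norm_smul, mul_pow, Real.norm_eq_abs, sq_abs]
    have := (norm_tangProj_le v m).trans hm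
    have h5 : ‖tangProj (v : Vec d) m‖ ^ 2 ≤ 1 := by
      nlinarith [norm_nonneg (tangProj (v : Vec d) m)]
    nlinarith [sq_nonneg (g v)]
  have h2 : √(∫ v : Sph d, ‖‖(v : Vec d) - m‖ ^ 2 • G v‖ ^ 2 ∂(surf d)) ≤ 4 * Γ := by
    refine Real.sqrt_le_iff.2 ⟨by positivity, ?_⟩
    rw [mul_pow, sq Γ, ← hΓ, ← integral_const_mul]
    refine integral_mono hm3.norm.integrable_sq (h.memLp.norm.integrable_sq.const_mul _)
      fun v => ?_
    simp only [norm_smul, mul_pow, Real.norm_eq_abs, sq_abs]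
    have := norm_coe_sub_sq_le hm v
    have h5 : (‖(v : Vec d) - m‖ ^ 2) ^ 2 ≤ 4 ^ 2 := pow_le_pow_left₀ (by positivity) this 2
    exact mul_le_mul_of_nonneg_right h5 (by positivity)
  have h3 := (abs_integral_inner_le hm2 (memLp_sphGrad hu)).trans
    (mul_le_mul h1 hb (Real.sqrt_nonneg _) ENNReal.toReal_nonneg)
  have h4 := (abs_integral_inner_le hm3 (memLp_sphGrad hu)).trans
    (mul_le_mul h2 hb (Real.sqrt_nonneg _) (by positivity))
  rw [h.flux_eq lam σ m hg hu, hΓ]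
  refine (abs_sub _ _).trans (add_le_add ?_ ?_)
  · rw [abs_mul, abs_of_nonneg (by positivity)]
    exact mul_le_mul_of_nonneg_left h3 (by positivity)
  · rw [abs_mul, abs_of_nonneg (by positivity)]
    calc _ ≤ σ ^ 2 / 2 * (4 * Γ * Γ) := mul_le_mul_of_nonneg_left h4 (by positivity)
      _ = _ := by ring

end IsWeakGradient

theorem intervalIntegrable_of_measurable_of_bound {f : ℝ → ℝ} (hf : Measurable f) {a b C : ℝ}
    (hab : a ≤ b) (hC : ∀ s ∈ Icc a b, |f s| ≤ C) : IntervalIntegrable f volume a b := by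
  rw [intervalIntegrable_iff_integrableOn_Ioc_of_le hab]
  refine Measure.integrableOn_of_bounded (M := C) (by simp) hf.aestronglyMeasurable ?_
  rw [ae_restrict_iff' measurableSet_Ioc]
  exact Filter.Eventually.of_forall fun s hs => hC s (Ioc_subset_Icc_self hs)

/-! ### The `L²` norm along a solution -/

namespace IsWeakSolution

variable {d : ℕ} {lam σ α T : ℝ} {𝓔 : Vec d → ℝ} {ρ₀ : Sph d → ℝ} {ρ : ℝ → Sph d → ℝ}

theorem measurable_integral (hρ : IsWeakSolution lam σ α 𝓔 T ρ₀ ρ) {f : ℝ × Sph d → ℝ}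
    (hf : Measurable f) : Measurable fun s => ∫ v, f (s, v) * ρ s v ∂(surf d) :=
  (StronglyMeasurable.integral_prod_right (f := fun s v => f (s, v) * ρ s v)
    (hf.mul hρ.measurable).stronglyMeasurable).measurable

theorem measurable_consensus (hρ : IsWeakSolution lam σ α 𝓔 T ρ₀ ρ)
    (h : Continuous fun v : Sph d => 𝓔 v) : Measurable fun s => consensus α 𝓔 (ρ s) := by
  have hw : Measurable fun p : ℝ × Sph d => weight α 𝓔 (p.2 : Vec d) :=
    (continuous_weight h α).measurable.comp measurable_snd
  have h1 := hρ.measurable_integral hw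
  have h2 : Measurable fun s => ∫ v, (weight α 𝓔 (v : Vec d) * ρ s v) • (v : Vec d) ∂(surf d) :=
    (StronglyMeasurable.integral_prod_right
      (f := fun s (v : Sph d) => (weight α 𝓔 (v : Vec d) * ρ s v) • (v : Vec d))
      ((hw.mul hρ.measurable).smul
        (measurable_subtype_coe.comp measurable_snd)).stronglyMeasurable).measurable
  exact h1.inv.smul h2

theorem measurable_flux (hρ : IsWeakSolution lam σ α 𝓔 T ρ₀ ρ)
    (h : Continuous fun v : Sph d => 𝓔 v) {φ : Vec d → ℝ} (hφ : ContDiff ℝ ∞ φ) :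
    Measurable fun s => flux lam σ (consensus α 𝓔 (ρ s)) (ρ s) φ := by
  have hm : Measurable fun p : ℝ × Sph d => consensus α 𝓔 (ρ p.1) :=
    (hρ.measurable_consensus h).comp measurable_fst
  have hv : Measurable fun p : ℝ × Sph d => (p.2 : Vec d) :=
    measurable_subtype_coe.comp measurable_snd
  have hg : Measurable fun p : ℝ × Sph d => sphGrad φ p.2 :=
    (continuous_sphGrad hφ).measurable.comp measurable_snd
  have hl : Measurable fun p : ℝ × Sph d => sphLap φ p.2 :=
    (continuous_sphLap hφ).measurable.comp measurable_snd
  have hd : Measurable fun p : ℝ × Sph d => ⟪⟪consensus α 𝓔 (ρ p.1), (p.2 : Vec d)⟫_ℝ •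
      (p.2 : Vec d) - consensus α 𝓔 (ρ p.1), sphGrad φ p.2⟫_ℝ := by
    have e1 : Measurable fun p : ℝ × Sph d => ⟪consensus α 𝓔 (ρ p.1), (p.2 : Vec d)⟫_ℝ :=
      hm.inner hv
    exact ((e1.smul hv).sub hm).inner hg
  have hs : Measurable fun p : ℝ × Sph d =>
      ‖(p.2 : Vec d) - consensus α 𝓔 (ρ p.1)‖ ^ 2 * sphLap φ p.2 :=
    ((hv.sub hm).norm.pow_const 2).mul hl
  have h1 := (hρ.measurable_integral hd).const_mul (-lam)
  have h2 := (hρ.measurable_integral hs).const_mul (σ ^ 2 / 2)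
  simp only [flux]
  exact h1.add h2

theorem exists_abs_flux_le (hρ : IsWeakSolution lam σ α 𝓔 T ρ₀ ρ)
    (h : Continuous fun v : Sph d => 𝓔 v) (hα : 0 < α) {φ : Vec d → ℝ} (hφ : ContDiff ℝ ∞ φ) :
    ∃ C, ∀ s ∈ Icc 0 T, |flux lam σ (consensus α 𝓔 (ρ s)) (ρ s) φ| ≤ C := by
  obtain ⟨C, hC⟩ := SphereCBO.exists_abs_flux_le lam σ hφ
  exact ⟨C, fun s hs => hC _ _ ((hρ.density s hs).norm_consensus_le h hα) (hρ.density s hs)⟩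

theorem intervalIntegrable_flux (hρ : IsWeakSolution lam σ α 𝓔 T ρ₀ ρ)
    (h : Continuous fun v : Sph d => 𝓔 v) (hα : 0 < α) (hT : 0 ≤ T) {φ : Vec d → ℝ}
    (hφ : ContDiff ℝ ∞ φ) :
    IntervalIntegrable (fun s => flux lam σ (consensus α 𝓔 (ρ s)) (ρ s) φ) volume 0 T := by
  obtain ⟨C, hC⟩ := hρ.exists_abs_flux_le h hα hφ
  exact intervalIntegrable_of_measurable_of_bound (hρ.measurable_flux h hφ) hT hC

theorem integral_eq (hρ : IsWeakSolution lam σ α 𝓔 T ρ₀ ρ) {φ : Vec d → ℝ}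
    (hφ : ContDiff ℝ ∞ φ) {t : ℝ} (ht : t ∈ Icc 0 T) :
    ∫ v, φ v * ρ t v ∂(surf d) = ∫ v, φ v * ρ 0 v ∂(surf d) +
      ∫ s in (0 : ℝ)..t, flux lam σ (consensus α 𝓔 (ρ s)) (ρ s) φ := by
  have h1 := hρ.weak_eq φ hφ t ht
  have h2 : ∫ v, φ v * ρ 0 v ∂(surf d) = ∫ v, φ v * ρ₀ v ∂(surf d) := by
    refine integral_congr_ae ?_
    filter_upwards [hρ.initial] with v hv
    rw [hv]
  rw [h2]
  simp only [flux]
  linarith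

/-- The left side is a difference of sums of squared coefficients. Each coefficient is the integral
against a fixed polynomial, so the equation makes it a primitive of its flux and
`sq_sub_sq_of_eq_integral` applies. -/
theorem galerkin_energy_eq (hρ : IsWeakSolution lam σ α 𝓔 T ρ₀ ρ)
    (h : Continuous fun v : Sph d => 𝓔 v) (hα : 0 < α) (hT : 0 ≤ T) (n : ℕ) {t : ℝ}
    (ht : t ∈ Icc 0 T) :
    ∫ v, ρ t v * galerkinProj n (ρ t) v ∂(surf d) - ∫ v, ρ 0 v * galerkinProj n (ρ 0) v ∂(surf d) =
      ∫ s in (0 : ℝ)..t, ∑ i, 2 * ((∫ v, galerkinBasis d n i v * ρ s v ∂(surf d)) *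
        flux lam σ (consensus α 𝓔 (ρ s)) (ρ s) (galerkinBasis d n i)) := by
  have hp : ∀ i, ContDiff ℝ ∞ (galerkinBasis d n i) := fun i =>
    contDiff_of_mem_polySpace (galerkinBasis_mem i)
  have hpc : ∀ i, Continuous fun v : Sph d => galerkinBasis d n i v := fun i =>
    (hp i).continuous.comp continuous_subtype_val
  rw [← sum_sq_galerkinCoeff n (hρ.density t ht).memLp,
    ← sum_sq_galerkinCoeff n (hρ.density 0 ⟨le_rfl, hT⟩).memLp, ← Finset.sum_sub_distrib,
    intervalIntegral.integral_finsetSum]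
  · refine Finset.sum_congr rfl fun i _ => ?_
    exact sq_sub_sq_of_eq_integral (hρ.intervalIntegrable_flux h hα hT (hp i))
      (c := fun s => ∫ v, galerkinBasis d n i v * ρ s v ∂(surf d))
      (fun s hs => hρ.integral_eq (hp i) hs) le_rfl ht.1 ht.2
  · intro i _
    obtain ⟨C, hC⟩ := hρ.exists_abs_flux_le h hα (hp i)
    obtain ⟨B, hB⟩ := isCompact_univ.exists_bound_of_continuousOn (hpc i).continuousOn
    refine intervalIntegrable_of_measurable_of_bound (C := 2 * (B * C)) ?_ ht.1 fun s hs => ?_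
    · exact ((hρ.measurable_integral ((hpc i).measurable.comp measurable_snd)).mul
        (hρ.measurable_flux h (hp i))).const_mul 2
    · have hs' : s ∈ Icc 0 T := ⟨hs.1, hs.2.trans ht.2⟩
      have h1 := (hρ.density s hs').abs_integral_mul_le (hpc i) (fun v => hB v (mem_univ v))
      rw [abs_mul, abs_mul, abs_two]
      exact mul_le_mul_of_nonneg_left
        (mul_le_mul h1 (hC s hs') (abs_nonneg _) ((abs_nonneg _).trans h1)) (by norm_num)

/-- Limit `n → ∞` in `galerkin_energy_eq`: the left side converges because the projections do, the
right side by dominated convergence from the weak convergence of gradients, and `limit_flux_le`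
bounds the limit. -/
theorem energy_inequality (hρ : IsWeakSolution lam σ α 𝓔 T ρ₀ ρ)
    (h : Continuous fun v : Sph d => 𝓔 v) (hα : 0 < α) (hlam : 0 ≤ lam) (hσ : 0 < σ)
    (hT : 0 ≤ T) {t : ℝ} (ht : t ∈ Icc 0 T) :
    ∫ v, ρ t v ^ 2 ∂(surf d) ≤ ∫ v, ρ 0 v ^ 2 ∂(surf d) +
      (lam + σ ^ 2) ^ 2 / σ ^ 2 * ∫ s in (0 : ℝ)..t, ∫ v, ρ s v ^ 2 ∂(surf d) := by
  obtain ⟨M, hM⟩ := hρ.bounded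
  obtain ⟨G, hGm, hG, hGint⟩ := hρ.sobolev
  have hM0 : 0 ≤ M := (ENNReal.toReal_nonneg).trans (hM 0 ⟨le_rfl, hT⟩)
  have hd : ∀ s ∈ Icc 0 T, MemLp (ρ s) 2 (surf d) := fun s hs => (hρ.density s hs).memLp
  set γ : ℝ → ℝ := fun s => ∫ v, ‖G s v‖ ^ 2 ∂(surf d)
  have hγm : Measurable γ := (StronglyMeasurable.integral_prod_right
    (f := fun s v => ‖G s v‖ ^ 2) (hGm.norm.pow_const 2).stronglyMeasurable).measurable
  have hγ0 : ∀ s, 0 ≤ γ s := fun s => integral_nonneg fun v => by positivity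
  have hγi : IntegrableOn γ (Icc 0 T) := by
    refine ⟨hγm.aestronglyMeasurable, lt_of_le_of_lt (lintegral_mono fun s => ?_) hGint⟩
    refine (enorm_integral_le_lintegral_enorm _).trans (lintegral_mono fun v => ?_)
    simp
  set m : ℝ → Vec d := fun s => consensus α 𝓔 (ρ s)
  have hm : ∀ s ∈ Icc 0 T, ‖m s‖ ≤ 1 := fun s hs => (hρ.density s hs).norm_consensus_le h hα
  set F : ℕ → ℝ → ℝ := fun n s => ∑ i, 2 * ((∫ v, galerkinBasis d n i v * ρ s v ∂(surf d)) *
        flux lam σ (m s) (ρ s) (galerkinBasis d n i))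
  set L : ℝ → ℝ := fun s => 2 * ((lam + σ ^ 2) *
      ∫ v, ⟪ρ s v • tangProj (v : Vec d) (m s), G s v⟫_ℝ ∂(surf d)
      - σ ^ 2 / 2 * ∫ v : Sph d, ⟪‖(v : Vec d) - m s‖ ^ 2 • G s v, G s v⟫_ℝ ∂(surf d))
  have hp : ∀ n i, ContDiff ℝ ∞ (galerkinBasis d n i) := fun n i =>
    contDiff_of_mem_polySpace (galerkinBasis_mem i)
  have hFm : ∀ n, Measurable (F n) := by
    intro n
    refine Finset.measurable_fun_sum _ fun i _ => ?_
    exact ((hρ.measurable_integral (((hp n i).continuous.comp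
      continuous_subtype_val).measurable.comp measurable_snd)).mul
        (hρ.measurable_flux h (hp n i))).const_mul 2
  have hFe : ∀ n, ∀ s ∈ Icc 0 T,
      F n s = 2 * flux lam σ (m s) (ρ s) (galerkinProj n (ρ s)) := by
    intro n s hs
    have := flux_sum lam σ (m s) (hd s hs) Finset.univ
      (fun i => ∫ v, galerkinBasis d n i v * ρ s v ∂(surf d)) (hp n)
    change _ = 2 * flux lam σ (m s) (ρ s) (fun x => ∑ i,
      (∫ v, galerkinBasis d n i v * ρ s v ∂(surf d)) * galerkinBasis d n i x)
    rw [this, Finset.mul_sum]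
  -- The bound of `abs_flux_galerkinProj_le` with `√γ ≤ 1 + γ`; it is integrable because `γ` is.
  set bnd : ℝ → ℝ := fun s => 2 * ((lam + σ ^ 2) * (M * (1 + γ s)) + 2 * σ ^ 2 * γ s)
  have hIoc : Ioc 0 t ⊆ Icc 0 T := fun s hs => ⟨hs.1.le, hs.2.trans ht.2⟩
  have hG' : ∀ᵐ s, s ∈ Ioc 0 t → IsWeakGradient (ρ s) (G s) := by
    rw [ae_restrict_iff' measurableSet_Icc] at hG
    filter_upwards [hG] with s hs hst using hs (hIoc hst)
  have hFb : ∀ n, ∀ᵐ s, s ∈ Ioc 0 t → ‖F n s‖ ≤ bnd s := by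
    intro n
    filter_upwards [hG'] with s hs hst
    have hsT := hIoc hst
    have h1 := (hs hst).abs_flux_galerkinProj_le (hd s hsT) (σ := σ) hlam (hm s hsT) n
    rw [hFe n s hsT, Real.norm_eq_abs, abs_mul, abs_two]
    refine mul_le_mul_of_nonneg_left (h1.trans ?_) (by norm_num)
    have h2 : √(γ s) ≤ 1 + γ s := by
      rw [Real.sqrt_le_iff]
      constructor <;> nlinarith [hγ0 s]
    have h3 : norm2 (ρ s) * √(γ s) ≤ M * (1 + γ s) :=
      mul_le_mul (hM s hsT) h2 (Real.sqrt_nonneg _) hM0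
    have h4 : 0 ≤ lam + σ ^ 2 := by positivity
    exact add_le_add (mul_le_mul_of_nonneg_left h3 h4) le_rfl
  have hγt : IntegrableOn γ (Ioc 0 t) := hγi.mono_set hIoc
  have hbi : IntegrableOn bnd (Ioc 0 t) := by
    have h1 : IntegrableOn (fun _ : ℝ => (1 : ℝ)) (Ioc 0 t) := integrableOn_const (by simp)
    exact (((((h1.add hγt).const_mul M).const_mul (lam + σ ^ 2)).add
      (hγt.const_mul (2 * σ ^ 2))).const_mul 2)
  have hlim : ∀ᵐ s, s ∈ Ioc 0 t →
      Filter.Tendsto (fun n => F n s) Filter.atTop (nhds (L s)) := by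
    filter_upwards [hG'] with s hs hst
    have hsT := hIoc hst
    simp_rw [hFe _ s hsT]
    exact ((hs hst).tendsto_flux (hd s hsT) lam σ (m s)).const_mul 2
  have hLi : IntegrableOn L (Ioc 0 t) := by
    refine hbi.mono' (aestronglyMeasurable_of_tendsto_ae Filter.atTop
      (fun n => (hFm n).aestronglyMeasurable) ?_) ?_
    · rwa [ae_restrict_iff' measurableSet_Ioc]
    · rw [ae_restrict_iff' measurableSet_Ioc]
      filter_upwards [hlim, ae_all_iff.2 hFb] with s h1 h2 hst
      exact le_of_tendsto (h1 hst).norm (Filter.Eventually.of_forall fun n => h2 n hst)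
  have hconv := intervalIntegral.tendsto_integral_filter_of_dominated_convergence
    (μ := volume) (a := 0) (b := t) (l := Filter.atTop) (F := F) (f := L) bnd
    (Filter.Eventually.of_forall fun n => (hFm n).aestronglyMeasurable)
    (Filter.Eventually.of_forall fun n => by
      simpa only [uIoc_of_le ht.1] using hFb n)
    ((intervalIntegrable_iff_integrableOn_Ioc_of_le ht.1).2 hbi)
    (by simpa only [uIoc_of_le ht.1] using hlim)
  have hleft : Filter.Tendsto (fun n => ∫ s in (0 : ℝ)..t, F n s) Filter.atTop
      (nhds (∫ v, ρ t v ^ 2 ∂(surf d) - ∫ v, ρ 0 v ^ 2 ∂(surf d))) := by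
    have h0 := hd 0 ⟨le_rfl, hT⟩
    have h1 := (tendsto_integral_mul_galerkinProj (hd t ht) (hd t ht)).sub
      (tendsto_integral_mul_galerkinProj h0 h0)
    simp_rw [← sq] at h1
    exact h1.congr fun n => hρ.galerkin_energy_eq h hα hT n ht
  have heq := tendsto_nhds_unique hleft hconv
  have hym : Measurable fun s => ∫ v, ρ s v ^ 2 ∂(surf d) :=
    (StronglyMeasurable.integral_prod_right (f := fun s v => ρ s v ^ 2)
      (hρ.measurable.pow_const 2).stronglyMeasurable).measurable
  have hyi : IntervalIntegrable (fun s => ∫ v, ρ s v ^ 2 ∂(surf d)) volume 0 t := by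
    refine intervalIntegrable_of_measurable_of_bound (C := M ^ 2) hym ht.1 fun s hs => ?_
    have hsT : s ∈ Icc 0 T := ⟨hs.1, hs.2.trans ht.2⟩
    rw [IsL2Density.integral_sq_eq_norm2_sq (hd s hsT), abs_of_nonneg (by positivity)]
    exact pow_le_pow_left₀ ENNReal.toReal_nonneg (hM s hsT) 2
  have hle : ∫ s in (0 : ℝ)..t, L s ≤ ∫ s in (0 : ℝ)..t,
      (lam + σ ^ 2) ^ 2 / σ ^ 2 * ∫ v, ρ s v ^ 2 ∂(surf d) := by
    refine intervalIntegral.integral_mono_ae_restrict ht.1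
      ((intervalIntegrable_iff_integrableOn_Ioc_of_le ht.1).2 hLi) (hyi.const_mul _) ?_
    rw [Filter.EventuallyLE, restrict_Ioc_eq_restrict_Icc.symm,
      ae_restrict_iff' measurableSet_Ioc]
    filter_upwards [hG'] with s hs hst
    have := (hs hst).limit_flux_le (hd s (hIoc hst)) (lam := lam) hσ (m s)
    simp only [L]
    linarith
  rw [← heq, intervalIntegral.integral_const_mul] at hle
  linarith

/-- The dimension-free estimate of the `L²` norm. -/
theorem norm2_le (hρ : IsWeakSolution lam σ α 𝓔 T ρ₀ ρ)
    (h : Continuous fun v : Sph d => 𝓔 v) (hα : 0 < α) (hlam : 0 ≤ lam) (hσ : 0 < σ)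
    {t : ℝ} (ht : t ∈ Icc 0 T) :
    norm2 (ρ t) ≤ norm2 ρ₀ * Real.exp ((lam + σ ^ 2) ^ 2 / (2 * σ ^ 2) * T) := by
  have hT : 0 ≤ T := ht.1.trans ht.2
  obtain ⟨M, hM⟩ := hρ.bounded
  have hd : ∀ s ∈ Icc 0 T, MemLp (ρ s) 2 (surf d) := fun s hs => (hρ.density s hs).memLp
  have hym : Measurable fun s => ∫ v, ρ s v ^ 2 ∂(surf d) :=
    (StronglyMeasurable.integral_prod_right (f := fun s v => ρ s v ^ 2)
      (hρ.measurable.pow_const 2).stronglyMeasurable).measurable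
  have hyi : IntervalIntegrable (fun s => ∫ v, ρ s v ^ 2 ∂(surf d)) volume 0 T := by
    refine intervalIntegrable_of_measurable_of_bound (C := M ^ 2) hym hT fun s hs => ?_
    rw [IsL2Density.integral_sq_eq_norm2_sq (hd s hs), abs_of_nonneg (by positivity)]
    exact pow_le_pow_left₀ ENNReal.toReal_nonneg (hM s hs) 2
  have h1 := le_mul_exp_of_le_integral (K := (lam + σ ^ 2) ^ 2 / σ ^ 2) (by positivity) hyi
    (fun s hs => hρ.energy_inequality h hα hlam hσ hT hs) ht
  have h2 : norm2 (ρ 0) = norm2 ρ₀ := by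
    rw [norm2, norm2, eLpNorm_congr_ae hρ.initial]
  rw [IsL2Density.integral_sq_eq_norm2_sq (hd t ht),
    IsL2Density.integral_sq_eq_norm2_sq (hd 0 ⟨le_rfl, hT⟩), h2] at h1
  refine le_of_sq_le_sq (h1.trans ?_) (mul_nonneg ENNReal.toReal_nonneg (Real.exp_pos _).le)
  rw [mul_pow, ← Real.exp_nat_mul]
  refine mul_le_mul_of_nonneg_left (Real.exp_le_exp.2 ?_) (by positivity)
  have h3 : ((2 : ℕ) : ℝ) * ((lam + σ ^ 2) ^ 2 / (2 * σ ^ 2) * T) =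
      (lam + σ ^ 2) ^ 2 / σ ^ 2 * T := by
    push_cast; field_simp
  rw [h3]
  exact mul_le_mul_of_nonneg_left ht.2 (by positivity)

end IsWeakSolution

/-! ### The measure of spherical caps -/

/-- The functional equation of `Γ` gives a two-step recursion with ratio `c² / (n/2 + 1)`, which is
at most one as soon as `n ≥ 2c²`; the finitely many earlier terms are summed. -/
theorem exists_pow_div_Gamma_le (c : ℝ) (hc : 0 ≤ c) :
    ∃ M : ℝ, ∀ n : ℕ, c ^ n / Real.Gamma ((n : ℝ) / 2 + 1) ≤ M := by
  set a : ℕ → ℝ := fun n => c ^ n / Real.Gamma ((n : ℝ) / 2 + 1)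
  have ha : ∀ n, 0 ≤ a n := fun n =>
    div_nonneg (by positivity) (Real.Gamma_pos_of_pos (by positivity)).le
  have hrec : ∀ n, a (n + 2) = c ^ 2 / ((n : ℝ) / 2 + 1) * a n := by
    intro n
    simp only [a]
    have h1 : ((n + 2 : ℕ) : ℝ) / 2 + 1 = ((n : ℝ) / 2 + 1) + 1 := by push_cast; ring
    rw [h1, Real.Gamma_add_one (by positivity), pow_add]
    have := (Real.Gamma_pos_of_pos (show 0 < (n : ℝ) / 2 + 1 by positivity)).ne'
    field_simp
  set N := ⌈2 * c ^ 2⌉₊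
  refine ⟨∑ k ∈ Finset.range (N + 2), a k, fun n => ?_⟩
  change a n ≤ _
  induction n using Nat.strong_induction_on with
  | _ n ih =>
    by_cases hn : n < N + 2
    · exact Finset.single_le_sum (fun i _ => ha i) (Finset.mem_range.2 hn)
    · obtain ⟨k, rfl⟩ : ∃ k, n = k + 2 := ⟨n - 2, by omega⟩
      refine le_trans ?_ (ih k (by omega))
      rw [hrec]
      refine mul_le_of_le_one_left (ha k) ?_
      rw [div_le_one (by positivity)]
      have h1 : 2 * c ^ 2 ≤ N := Nat.le_ceil _
      have h2 : (N : ℝ) ≤ k := by exact_mod_cast (by omega : N ≤ k)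
      linarith

theorem measurableSet_cap {d : ℕ} (u : Sph d) (δ : ℝ) :
    MeasurableSet {v : Sph d | ⟪(v : Vec d), (u : Vec d)⟫_ℝ ≤ -1 + δ} :=
  (isClosed_le (by fun_prop) continuous_const).measurableSet

-- The area is `d` times the volume of the cone over the cap. A point `v` of the cap has `|v + u|² ≤
-- 2δ`, so `r v` is within `2√δ` of `-r u`, and rounding `r` down to a multiple of `1/N ≤ √δ` moves
-- the centre by at most `√δ` more. Hence `N ≤ 2/√δ` balls of radius `3√δ` cover the cone.
open scoped Pointwise in
theorem surf_cap_le {d : ℕ} (u : Sph d) {δ : ℝ} (hδ : 0 < δ) (hδ1 : δ < 1) :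
    (surf d).real {v : Sph d | ⟪(v : Vec d), (u : Vec d)⟫_ℝ ≤ -1 + δ} ≤
      d * (2 / √δ * ((3 * √δ) ^ d * (√Real.pi ^ d / Real.Gamma ((d : ℝ) / 2 + 1)))) := by
  set S := {v : Sph d | ⟪(v : Vec d), (u : Vec d)⟫_ℝ ≤ -1 + δ}
  have hs : 0 < √δ := Real.sqrt_pos.2 hδ
  have hs1 : √δ ≤ 1 := Real.sqrt_le_one.2 hδ1.le
  have hss : √δ ^ 2 = δ := Real.sq_sqrt hδ.le
  set N := ⌈1 / √δ⌉₊
  have hN : 1 / √δ ≤ N := Nat.le_ceil _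
  have hN0 : 0 < (N : ℝ) := lt_of_lt_of_le (by positivity) hN
  have hN2 : (N : ℝ) ≤ 2 / √δ := by
    have h1 : (N : ℝ) < 1 / √δ + 1 := Nat.ceil_lt_add_one (by positivity)
    have h2 : 1 ≤ 1 / √δ := by rw [le_div_iff₀ hs]; linarith
    have h3 : 2 / √δ = 1 / √δ + 1 / √δ := by ring
    linarith
  have hN3 : 1 / (N : ℝ) ≤ √δ := by
    rw [div_le_iff₀ hN0]
    rw [div_le_iff₀ hs] at hN
    linarith
  have hcov : Ioo (0 : ℝ) 1 • ((↑) '' S : Set (Vec d)) ⊆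
      ⋃ j ∈ Finset.range N, Metric.ball (-((j : ℝ) / N) • (u : Vec d)) (3 * √δ) := by
    rintro _ ⟨r, hr, _, ⟨v, hv, rfl⟩, rfl⟩
    have hr0 : 0 ≤ r * N := by have := hr.1; positivity
    have hj : ⌊r * N⌋₊ < N := by
      rw [Nat.floor_lt hr0]
      nlinarith [hr.2]
    simp only [mem_iUnion, Finset.mem_range]
    refine ⟨⌊r * N⌋₊, hj, ?_⟩
    rw [mem_ball_iff_norm]
    set q : ℝ := (⌊r * N⌋₊ : ℝ) / N
    have hq : |r - q| ≤ √δ := by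
      have h1 : (⌊r * N⌋₊ : ℝ) ≤ r * N := Nat.floor_le hr0
      have h2 : r * N < ⌊r * N⌋₊ + 1 := Nat.lt_floor_add_one _
      have h3 : q ≤ r := (div_le_iff₀ hN0).2 h1
      rw [abs_of_nonneg (by linarith)]
      refine le_trans ?_ hN3
      rw [sub_le_iff_le_add, ← add_div, le_div_iff₀ hN0]
      linarith
    have hvu : ‖(v : Vec d) + u‖ ^ 2 ≤ 2 * δ := by
      rw [norm_add_sq_real, norm_coe_sph, norm_coe_sph]
      have : ⟪(v : Vec d), (u : Vec d)⟫_ℝ ≤ -1 + δ := hv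
      linarith
    have hvu' : ‖(v : Vec d) + u‖ < 2 * √δ := by
      refine lt_of_pow_lt_pow_left₀ 2 (by positivity) (hvu.trans_lt ?_)
      rw [mul_pow, hss]
      linarith
    have e : r • (v : Vec d) - -q • (u : Vec d) = r • ((v : Vec d) + u) - (r - q) • (u : Vec d) := by
      module
    change ‖r • (v : Vec d) - -q • (u : Vec d)‖ < 3 * √δ
    rw [e]
    refine (norm_sub_le _ _).trans_lt ?_
    rw [norm_smul, norm_smul, norm_coe_sph, Real.norm_of_nonneg hr.1.le, Real.norm_eq_abs]
    have : r * ‖(v : Vec d) + u‖ ≤ 1 * ‖(v : Vec d) + u‖ :=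
      mul_le_mul_of_nonneg_right hr.2.le (norm_nonneg _)
    linarith
  have hd : Nonempty (Fin d) := by
    rcases Nat.eq_zero_or_pos d with rfl | hd
    · exact absurd (Subsingleton.elim _ _) (coe_sph_ne_zero u)
    · exact ⟨⟨0, hd⟩⟩
  have hball : ∀ x : Vec d, (volume : Measure (Vec d)).real (Metric.ball x (3 * √δ)) =
      (3 * √δ) ^ d * (√Real.pi ^ d / Real.Gamma ((d : ℝ) / 2 + 1)) := by
    intro x
    rw [Measure.real, EuclideanSpace.volume_ball, ENNReal.toReal_mul, ENNReal.toReal_pow,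
      ENNReal.toReal_ofReal (by positivity), ENNReal.toReal_ofReal, Fintype.card_fin]
    exact div_nonneg (by positivity) (Real.Gamma_pos_of_pos (by positivity)).le
  have h1 : (surf d).real S = d * (volume : Measure (Vec d)).real
      (Ioo (0 : ℝ) 1 • ((↑) '' S : Set (Vec d))) := by
    rw [Measure.real, surf, Measure.toSphere_apply' _ (measurableSet_cap u δ), ENNReal.toReal_mul]
    rw [ENNReal.toReal_natCast, finrank_euclideanSpace_fin]
    rfl
  rw [h1]
  refine mul_le_mul_of_nonneg_left ?_ (by positivity)
  have hfin : volume (⋃ j ∈ Finset.range N,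
      Metric.ball (-((j : ℝ) / N) • (u : Vec d)) (3 * √δ)) ≠ ⊤ := by
    refine ((measure_biUnion_finset_le _ _).trans_lt ?_).ne
    exact ENNReal.sum_lt_top.2 fun j _ => measure_ball_lt_top
  refine (measureReal_mono hcov hfin).trans ((measureReal_biUnion_finset_le _ _).trans ?_)
  simp only [hball, Finset.sum_const, Finset.card_range, nsmul_eq_mul]
  refine mul_le_mul_of_nonneg_right hN2 (mul_nonneg (by positivity) ?_)
  exact div_nonneg (by positivity) (Real.Gamma_pos_of_pos (by positivity)).le

theorem exists_surf_cap_le : ∃ A : ℝ, 0 < A ∧ ∀ (d : ℕ) (u : Sph d) (δ : ℝ), 0 < δ → δ < 1 →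
    √((surf d).real {v : Sph d | ⟪(v : Vec d), (u : Vec d)⟫_ℝ ≤ -1 + δ}) ≤
      A * δ ^ (((d : ℝ) - 2) / 4) := by
  obtain ⟨M, hM⟩ := exists_pow_div_Gamma_le (6 * √Real.pi) (by positivity)
  have hM0 : 0 ≤ M := by
    refine le_trans ?_ (hM 0)
    simp
  refine ⟨√(2 * M) + 1, by positivity, fun d u δ hδ hδ1 => ?_⟩
  have hs : 0 < √δ := Real.sqrt_pos.2 hδ
  have hΓ : 0 < Real.Gamma ((d : ℝ) / 2 + 1) := Real.Gamma_pos_of_pos (by positivity)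
  have h0 : 0 ≤ δ ^ (((d : ℝ) - 2) / 4) := by positivity
  suffices h : √((surf d).real {v : Sph d | ⟪(v : Vec d), (u : Vec d)⟫_ℝ ≤ -1 + δ}) ≤
      √(2 * M) * δ ^ (((d : ℝ) - 2) / 4) by nlinarith
  refine Real.sqrt_le_iff.2 ⟨by positivity, (surf_cap_le u hδ hδ1).trans ?_⟩
  rw [mul_pow (√(2 * M)), Real.sq_sqrt (by positivity), ← Real.rpow_natCast (δ ^ _) 2, ← Real.rpow_mul hδ.le]
  have e1 : ((d : ℝ) - 2) / 4 * ((2 : ℕ) : ℝ) = ((d : ℝ) - 2) / 2 := by push_cast; ring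
  have e2 : √δ ^ d = δ ^ ((d : ℝ) / 2) := by
    rw [Real.sqrt_eq_rpow, ← Real.rpow_natCast, ← Real.rpow_mul hδ.le]
    ring_nf
  -- The covering gives the exponent `(d - 1)/2`, which is better than needed.
  have e3 : δ ^ ((d : ℝ) / 2) / √δ ≤ δ ^ (((d : ℝ) - 2) / 2) := by
    rw [Real.sqrt_eq_rpow, ← Real.rpow_sub hδ]
    exact Real.rpow_le_rpow_of_exponent_ge hδ hδ1.le (by linarith)
  -- The prefactor `d ≤ 2^d` joins the radius factor `3^d`, whence the base `6√π` chosen for `M`.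
  have e4 : (d : ℝ) * (3 ^ d * √Real.pi ^ d / Real.Gamma ((d : ℝ) / 2 + 1)) ≤ M := by
    refine le_trans ?_ (hM d)
    rw [← mul_div_assoc]
    refine div_le_div_of_nonneg_right ?_ hΓ.le
    have : (d : ℝ) ≤ 2 ^ d := by exact_mod_cast Nat.lt_two_pow_self.le
    calc (d : ℝ) * (3 ^ d * √Real.pi ^ d) ≤ 2 ^ d * (3 ^ d * √Real.pi ^ d) :=
          mul_le_mul_of_nonneg_right this (by positivity)
      _ = (6 * √Real.pi) ^ d := by rw [← mul_pow, ← mul_pow]; ring_nf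
  rw [e1]
  calc d * (2 / √δ * ((3 * √δ) ^ d * (√Real.pi ^ d / Real.Gamma ((d : ℝ) / 2 + 1))))
      = 2 * ((d : ℝ) * (3 ^ d * √Real.pi ^ d / Real.Gamma ((d : ℝ) / 2 + 1))) *
        (δ ^ ((d : ℝ) / 2) / √δ) := by
        rw [mul_pow, e2]; ring
    _ ≤ 2 * M * δ ^ (((d : ℝ) - 2) / 2) := by
        refine mul_le_mul (by linarith) e3 (by positivity) (by positivity)

/-- Cauchy-Schwarz against the indicator of the cap. -/
theorem capMass_le {d : ℕ} {g : Sph d → ℝ} (hg : MemLp g 2 (surf d)) (u : Sph d) (δ : ℝ) :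
    capMass g u δ ≤
      norm2 g * √((surf d).real {v : Sph d | ⟪(v : Vec d), (u : Vec d)⟫_ℝ ≤ -1 + δ}) := by
  set S := {v : Sph d | ⟪(v : Vec d), (u : Vec d)⟫_ℝ ≤ -1 + δ}
  have hS : MeasurableSet S := measurableSet_cap u δ
  have h1 : MemLp (S.indicator fun _ => (1 : ℝ)) 2 (surf d) :=
    memLp_indicator_const 2 hS 1 (Or.inr (measure_ne_top _ _))
  have h2 := (le_abs_self _).trans (abs_integral_inner_le hg h1)
  have e1 : ∫ v, ⟪g v, S.indicator (fun _ => (1 : ℝ)) v⟫_ℝ ∂(surf d) = capMass g u δ := by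
    rw [capMass, ← integral_indicator hS]
    refine integral_congr_ae (Filter.Eventually.of_forall fun v => ?_)
    by_cases hv : v ∈ S <;> simp [hv]
  have e2 : ∫ v, ‖S.indicator (fun _ => (1 : ℝ)) v‖ ^ 2 ∂(surf d) = (surf d).real S := by
    rw [← integral_indicator_one hS]
    refine integral_congr_ae (Filter.Eventually.of_forall fun v => ?_)
    by_cases hv : v ∈ S <;> simp [hv]
  have e3 : √(∫ v, ‖g v‖ ^ 2 ∂(surf d)) = norm2 g := by
    simp only [Real.norm_eq_abs, sq_abs]
    rw [IsL2Density.integral_sq_eq_norm2_sq hg]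
    exact Real.sqrt_sq ENNReal.toReal_nonneg
  rwa [e1, e2, e3] at h2

/-! ### Decay of the variance -/

/-- Comparison with the solution of `g' = -κ (g - R)` for a function which satisfies the
corresponding differential inequality only as long as it stays below a barrier. -/
theorem le_exp_of_conditional_integral_le {f : ℝ → ℝ} {T κ R M : ℝ} (hf : ContinuousOn f (Icc 0 T))
    (hf0 : 0 ≤ f 0) (hκ : 0 < κ) (hR : 0 ≤ R) (hM : f 0 + R < M)
    (h : ∀ s t, 0 ≤ s → s ≤ t → t ≤ T → (∀ r ∈ Icc s t, f r ≤ M) →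
      f t - f s ≤ ∫ r in s..t, (-κ * f r + κ * R)) {t : ℝ} (ht : t ∈ Icc 0 T) :
    f t ≤ f 0 * Real.exp (-κ * t) + R := by
  set g : ℝ → ℝ := fun r => f 0 * Real.exp (-κ * r) + R
  have hgc : Continuous g := by fun_prop
  have hgM : ∀ r, 0 ≤ r → g r < M := by
    intro r hr
    have : Real.exp (-κ * r) ≤ 1 := Real.exp_le_one_iff.2 (by nlinarith)
    simp only [g]
    nlinarith
  have hg : ∀ a b, ∫ r in a..b, (-κ * g r + κ * R) = g b - g a := by
    intro a b
    refine intervalIntegral.integral_eq_sub_of_hasDerivAt (fun r _ => ?_)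
      (Continuous.intervalIntegrable (by fun_prop) _ _)
    have h1 : HasDerivAt (fun r => Real.exp (-κ * r)) (Real.exp (-κ * r) * (-κ)) r := by
      simpa using ((hasDerivAt_id r).const_mul (-κ)).exp
    convert! (h1.const_mul (f 0)).add_const R using 1
    simp only [g]
    ring
  change f t ≤ g t
  by_contra! hlt
  have hsub : Icc 0 t ⊆ Icc 0 T := Icc_subset_Icc le_rfl ht.2
  set A := Icc 0 t ∩ {r | f r ≤ g r}
  have hAc : IsCompact A := by
    refine isCompact_Icc.of_isClosed_subset ?_ inter_subset_left
    exact isClosed_Icc.isClosed_le (hf.mono hsub) hgc.continuousOn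
  have hA0 : (0 : ℝ) ∈ A := ⟨⟨le_rfl, ht.1⟩, by simpa [g] using hR⟩
  -- The last time before `t` at which `f` lies below the comparison function `g`.
  set t₀ := sSup A
  have ht₀ : t₀ ∈ A := hAc.sSup_mem ⟨0, hA0⟩
  have hlt₀ : t₀ < t := by
    refine lt_of_le_of_ne ht₀.1.2 fun he => ?_
    have := ht₀.2
    rw [he] at this
    exact absurd this (not_le.2 hlt)
  have habove : ∀ r ∈ Ioc t₀ t, g r < f r := by
    intro r hr
    by_contra! hle
    exact absurd (le_csSup hAc.bddAbove ⟨⟨ht₀.1.1.trans hr.1.le, hr.2⟩, hle⟩) (not_le.2 hr.1)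
  -- Since `f t₀ ≤ g t₀ < M`, the barrier condition persists for a short time after `t₀`. There the
  -- inequality is available while `f > g`, which forces `f` to grow no more than `g`: a
  -- contradiction.
  have hev := (hf t₀ (hsub ht₀.1)).eventually_lt_const (lt_of_le_of_lt ht₀.2 (hgM t₀ ht₀.1.1))
  rw [eventually_nhdsWithin_iff, Metric.eventually_nhds_iff] at hev
  obtain ⟨ε, hε, hball⟩ := hev
  set t₂ := min t (t₀ + ε / 2)
  have h02 : t₀ < t₂ := lt_min hlt₀ (by linarith)
  have h2t : t₂ ≤ t := min_le_left _ _
  have h2ε : t₂ ≤ t₀ + ε / 2 := min_le_right _ _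
  have hbar : ∀ r ∈ Icc t₀ t₂, f r ≤ M := by
    intro r hr
    refine (hball ?_ ⟨ht₀.1.1.trans hr.1, hr.2.trans (h2t.trans ht.2)⟩).le
    rw [Real.dist_eq, abs_lt]
    constructor <;> linarith [hr.1, hr.2]
  have h1 := h t₀ t₂ ht₀.1.1 h02.le (h2t.trans ht.2) hbar
  have hfi : IntervalIntegrable (fun r => -κ * f r + κ * R) volume t₀ t₂ := by
    refine ContinuousOn.intervalIntegrable ?_
    rw [uIcc_of_le h02.le]
    have : ContinuousOn f (Icc t₀ t₂) :=
      hf.mono (Icc_subset_Icc ht₀.1.1 (h2t.trans ht.2))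
    fun_prop
  have h2 : ∫ r in t₀..t₂, (-κ * f r + κ * R) ≤ ∫ r in t₀..t₂, (-κ * g r + κ * R) := by
    refine intervalIntegral.integral_mono_on_of_le_Ioo h02.le hfi
      (Continuous.intervalIntegrable (by fun_prop) _ _) fun r hr => ?_
    have := habove r ⟨hr.1, hr.2.le.trans h2t⟩
    nlinarith
  rw [hg] at h2
  have h3 := habove t₂ ⟨h02, h2t⟩
  have h4 : f t₀ ≤ g t₀ := ht₀.2
  linarith

/-! ### Drift and diffusion in terms of the variance -/

namespace IsL2Density

variable {d : ℕ} {g : Sph d → ℝ}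

theorem integral_norm_sub_sq (hg : IsL2Density g) (z : Vec d) :
    ∫ v, ‖(v : Vec d) - z‖ ^ 2 * g v ∂(surf d) = 1 - 2 * ⟪z, mean g⟫_ℝ + ‖z‖ ^ 2 := by
  have e : ∀ v : Sph d, ‖(v : Vec d) - z‖ ^ 2 * g v =
      (1 + ‖z‖ ^ 2) * g v - 2 * (⟪z, (v : Vec d)⟫_ℝ * g v) := by
    intro v
    rw [norm_sub_sq_real, norm_coe_sph, real_inner_comm]
    ring
  simp_rw [e]
  rw [integral_sub (hg.integrable.const_mul _)
    ((hg.integrable_mul (f := fun v => ⟪z, (v : Vec d)⟫_ℝ) (by fun_prop)).const_mul _),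
    MeasureTheory.integral_const_mul, MeasureTheory.integral_const_mul, hg.mass, hg.inner_mean]
  ring

theorem variance_eq (hg : IsL2Density g) : variance g = (1 - ‖mean g‖ ^ 2) / 2 := by
  rw [variance, hg.integral_norm_sub_sq, real_inner_self_eq_norm_sq]
  ring

theorem variance_nonneg (hg : IsL2Density g) : 0 ≤ variance g := by
  rw [hg.variance_eq]
  nlinarith [hg.norm_mean_le, norm_nonneg (mean g)]

/-- Jensen at `z = mean g`, with the weight bounded above in the numerator and below in the
denominator; the ratio of these bounds is `cAlpha`. -/
theorem norm_mean_sub_consensus_sq_le (hg : IsL2Density g) {𝓔 : Vec d → ℝ}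
    (h : Continuous fun v : Sph d => 𝓔 v) {α : ℝ} (hα : 0 < α) :
    ‖mean g - consensus α 𝓔 g‖ ^ 2 ≤ 2 * cAlpha α 𝓔 * variance g := by
  have h1 := hg.norm_sub_consensus_sq_mul_le h hα (mean g)
  have hw := continuous_weight h α
  have h2 := hg.integral_mul_le
    (f := fun v : Sph d => ‖(v : Vec d) - mean g‖ ^ 2 * weight α 𝓔 v)
    (h := fun v : Sph d => Real.exp (-α * infE 𝓔) * ‖(v : Vec d) - mean g‖ ^ 2)
    (by fun_prop) (by fun_prop) (fun v => by
      rw [mul_comm]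
      refine mul_le_mul_of_nonneg_right (Real.exp_le_exp.2 ?_) (by positivity)
      nlinarith [infE_le h v])
  have h3 : ∫ v, Real.exp (-α * infE 𝓔) * ‖(v : Vec d) - mean g‖ ^ 2 * g v ∂(surf d) =
      Real.exp (-α * infE 𝓔) * (2 * variance g) := by
    simp_rw [mul_assoc]
    rw [MeasureTheory.integral_const_mul, variance]
    ring
  rw [h3] at h2
  have h4 := hg.weightNorm_pos h hα
  have h5 : Real.exp (-α * infE 𝓔) = cAlpha α 𝓔 * Real.exp (-α * supE 𝓔) := by
    rw [cAlpha, ← Real.exp_add]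
    congr 1
    ring
  have h6 : ‖mean g - consensus α 𝓔 g‖ ^ 2 * Real.exp (-α * supE 𝓔) ≤
      2 * cAlpha α 𝓔 * variance g * Real.exp (-α * supE 𝓔) := by
    rw [h5] at h2
    have := mul_le_mul_of_nonneg_left h4 (sq_nonneg ‖mean g - consensus α 𝓔 g‖)
    linarith
  exact le_of_mul_le_mul_right h6 (Real.exp_pos _)

theorem _root_.SphereCBO.one_le_cAlpha {d : ℕ} [NeZero d] {𝓔 : Vec d → ℝ}
    (h : Continuous fun v : Sph d => 𝓔 v) {α : ℝ} (hα : 0 < α) : 1 ≤ cAlpha α 𝓔 := by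
  obtain ⟨v⟩ : Nonempty (Sph d) := (NormedSpace.sphere_nonempty.2 zero_le_one).to_subtype
  refine Real.one_le_exp (mul_nonneg hα.le ?_)
  linarith [infE_le h v, le_supE h v]

/-- The integral equals `2V + |E - m|²`, and both terms are at most `2 C_α V` as `C_α ≥ 1`. -/
theorem integral_norm_sub_consensus_sq_le (hg : IsL2Density g) [NeZero d] {𝓔 : Vec d → ℝ}
    (h : Continuous fun v : Sph d => 𝓔 v) {α : ℝ} (hα : 0 < α) :
    ∫ v, ‖(v : Vec d) - consensus α 𝓔 g‖ ^ 2 * g v ∂(surf d) ≤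
      4 * cAlpha α 𝓔 * variance g := by
  have h1 := hg.norm_mean_sub_consensus_sq_le h hα
  have h2 := one_le_cAlpha h hα
  have h3 := hg.variance_nonneg
  rw [norm_sub_sq_real, real_inner_comm] at h1
  rw [hg.integral_norm_sub_sq]
  have h4 := hg.variance_eq
  nlinarith

/-- The covariance form of a density. -/
theorem integral_inner_mul_inner (hg : IsL2Density g) (w z : Vec d) :
    ∫ v, ⟪w, (v : Vec d)⟫_ℝ * ⟪z, (v : Vec d)⟫_ℝ * g v ∂(surf d) =
      ∫ v, ⟪w, (v : Vec d) - mean g⟫_ℝ * ⟪z, (v : Vec d) - mean g⟫_ℝ * g v ∂(surf d)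
        + ⟪w, mean g⟫_ℝ * ⟪z, mean g⟫_ℝ := by
  have i1 := hg.integrable_mul (f := fun v : Sph d =>
    ⟪w, (v : Vec d) - mean g⟫_ℝ * ⟪z, (v : Vec d) - mean g⟫_ℝ) (by fun_prop)
  have i2 := hg.integrable_mul (f := fun v : Sph d => ⟪w, (v : Vec d)⟫_ℝ) (by fun_prop)
  have i3 := hg.integrable_mul (f := fun v : Sph d => ⟪z, (v : Vec d)⟫_ℝ) (by fun_prop)
  have e : ∀ v : Sph d, ⟪w, (v : Vec d)⟫_ℝ * ⟪z, (v : Vec d)⟫_ℝ * g v =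
      (⟪w, (v : Vec d) - mean g⟫_ℝ * ⟪z, (v : Vec d) - mean g⟫_ℝ * g v) +
      ((⟪z, mean g⟫_ℝ * (⟪w, (v : Vec d)⟫_ℝ * g v) + ⟪w, mean g⟫_ℝ * (⟪z, (v : Vec d)⟫_ℝ * g v))
        - ⟪w, mean g⟫_ℝ * ⟪z, mean g⟫_ℝ * g v) := by
    intro v
    simp only [inner_sub_right]
    ring
  have i4 : Integrable (fun v : Sph d => ⟪z, mean g⟫_ℝ * (⟪w, (v : Vec d)⟫_ℝ * g v) +
      ⟪w, mean g⟫_ℝ * (⟪z, (v : Vec d)⟫_ℝ * g v)) (surf d) :=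
    (i2.const_mul ⟪z, mean g⟫_ℝ).add (i3.const_mul ⟪w, mean g⟫_ℝ)
  have i5 := hg.integrable.const_mul (⟪w, mean g⟫_ℝ * ⟪z, mean g⟫_ℝ)
  have i6 : Integrable (fun v : Sph d => (⟪z, mean g⟫_ℝ * (⟪w, (v : Vec d)⟫_ℝ * g v) +
      ⟪w, mean g⟫_ℝ * (⟪z, (v : Vec d)⟫_ℝ * g v)) - ⟪w, mean g⟫_ℝ * ⟪z, mean g⟫_ℝ * g v)
      (surf d) := i4.sub i5
  simp_rw [e]
  rw [integral_add i1 i6, integral_sub i4 i5,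
    integral_add (i2.const_mul _) (i3.const_mul _), MeasureTheory.integral_const_mul,
    MeasureTheory.integral_const_mul, MeasureTheory.integral_const_mul, ← hg.inner_mean,
    ← hg.inner_mean, hg.mass]
  ring

theorem capMass_nonneg (hg : IsL2Density g) (u : Sph d) (δ : ℝ) : 0 ≤ capMass g u δ :=
  setIntegral_nonneg_of_ae hg.nonneg

theorem integral_inner_tangProj (hg : IsL2Density g) (w z : Vec d) :
    ∫ v, ⟪tangProj (v : Vec d) w, z⟫_ℝ * g v ∂(surf d) =
      ⟪w, z⟫_ℝ - ∫ v, ⟪w, (v : Vec d)⟫_ℝ * ⟪z, (v : Vec d)⟫_ℝ * g v ∂(surf d) := by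
  have e : ∀ v : Sph d, ⟪tangProj (v : Vec d) w, z⟫_ℝ * g v =
      ⟪w, z⟫_ℝ * g v - ⟪w, (v : Vec d)⟫_ℝ * ⟪z, (v : Vec d)⟫_ℝ * g v := by
    intro v
    rw [tangProj_apply, inner_sub_left, inner_smul_left, RCLike.conj_to_real,
      real_inner_comm w (v : Vec d), real_inner_comm z (v : Vec d)]
    ring
  simp_rw [e]
  rw [integral_sub (hg.integrable.const_mul _) (hg.integrable_mul
    (f := fun v : Sph d => ⟪w, (v : Vec d)⟫_ℝ * ⟪z, (v : Vec d)⟫_ℝ) (by fun_prop)),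
    hg.integral_const_mul]

/-- With `x = ⟨u, v⟩` and `s = |E|` the integrand is `s² (1 - x²)`. Off the cap `1 + x ≥ δ` gives `1
- x² ≥ δ (1 - x)`; on the cap `δ (1 - x) - 2 ≤ 0` suffices. Since `1 - x` has integral `1 - s`, the
bound is linear in `1 - s`. -/
theorem drift_mean_ge (hg : IsL2Density g) {u : Sph d} (hu : mean g = ‖mean g‖ • (u : Vec d))
    {δ : ℝ} (hδ : 0 < δ) (hδ1 : δ < 1) :
    δ * variance g * (1 - 2 * variance g) - 4 * capMass g u δ ≤
      ∫ v, ⟪tangProj (v : Vec d) (mean g), mean g⟫_ℝ * g v ∂(surf d) := by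
  set S := {v : Sph d | ⟪(v : Vec d), (u : Vec d)⟫_ℝ ≤ -1 + δ}
  have hS : MeasurableSet S := measurableSet_cap u δ
  set s := ‖mean g‖
  have hs1 : s ≤ 1 := hg.norm_mean_le
  have hs0 : 0 ≤ s := norm_nonneg _
  have hcap := hg.capMass_nonneg u δ
  have h1 : s ^ 2 * (δ * (1 - s) - 2 * capMass g u δ) ≤
      ∫ v, ⟪tangProj (v : Vec d) (mean g), mean g⟫_ℝ * g v ∂(surf d) := by
    have hi1 : Integrable (fun v : Sph d => (1 - ⟪(u : Vec d), (v : Vec d)⟫_ℝ) * g v) (surf d) :=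
      hg.integrable_mul (by fun_prop)
    have hi2 : Integrable (S.indicator g) (surf d) := hg.integrable.indicator hS
    have e1 : ∫ v, (1 - ⟪(u : Vec d), (v : Vec d)⟫_ℝ) * g v ∂(surf d) = 1 - s := by
      simp_rw [sub_mul, one_mul]
      rw [integral_sub hg.integrable (hg.integrable_mul (by fun_prop)), hg.mass, ← hg.inner_mean,
        hu, inner_smul_right, inner_coe_self, mul_one]
    have e2 : ∫ v, S.indicator g v ∂(surf d) = capMass g u δ := integral_indicator hS
    have e3 : s ^ 2 * (δ * (1 - s) - 2 * capMass g u δ) =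
        ∫ v, s ^ 2 * (δ * ((1 - ⟪(u : Vec d), (v : Vec d)⟫_ℝ) * g v) - 2 * S.indicator g v)
          ∂(surf d) := by
      rw [MeasureTheory.integral_const_mul, integral_sub (hi1.const_mul _) (hi2.const_mul _),
        MeasureTheory.integral_const_mul, MeasureTheory.integral_const_mul, e1, e2]
    rw [e3]
    refine integral_mono_ae (((hi1.const_mul _).sub (hi2.const_mul _)).const_mul _)
      (hg.integrable_mul ?_) ?_
    · exact (continuous_tangProj_apply continuous_subtype_val continuous_const).inner
        continuous_const
    · filter_upwards [hg.nonneg] with v hv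
      have e4 : ⟪tangProj (v : Vec d) (mean g), mean g⟫_ℝ =
          s ^ 2 * (1 - ⟪(u : Vec d), (v : Vec d)⟫_ℝ ^ 2) := by
        rw [hu, map_smul, inner_smul_left, inner_smul_right, tangProj_apply, inner_sub_left,
          inner_smul_left, inner_coe_self, real_inner_comm (u : Vec d) (v : Vec d)]
        simp only [RCLike.conj_to_real]
        ring
      have hx := abs_real_inner_le_norm (u : Vec d) (v : Vec d)
      rw [norm_coe_sph, norm_coe_sph, mul_one, abs_le] at hx
      rw [e4, mul_assoc]
      refine mul_le_mul_of_nonneg_left ?_ (by positivity)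
      by_cases hvS : v ∈ S
      · rw [indicator_of_mem hvS]
        have : δ * (1 - ⟪(u : Vec d), (v : Vec d)⟫_ℝ) - 2 ≤
            1 - ⟪(u : Vec d), (v : Vec d)⟫_ℝ ^ 2 := by nlinarith
        nlinarith
      · rw [indicator_of_notMem hvS]
        have h2 : -1 + δ < ⟪(u : Vec d), (v : Vec d)⟫_ℝ := by
          rw [real_inner_comm]
          exact not_le.1 hvS
        have : δ * (1 - ⟪(u : Vec d), (v : Vec d)⟫_ℝ) ≤
            1 - ⟪(u : Vec d), (v : Vec d)⟫_ℝ ^ 2 := by nlinarith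
        nlinarith
  refine le_trans ?_ h1
  have hV : variance g = (1 - s ^ 2) / 2 := hg.variance_eq
  have hs2 : s ^ 2 ≤ 1 := by nlinarith
  -- `V = (1 - s)(1 + s)/2` and `s ≤ 1`.
  have h2 : variance g ≤ 1 - s := by rw [hV]; nlinarith
  have h3 : 1 - 2 * variance g = s ^ 2 := by rw [hV]; ring
  rw [h3]
  have h4 : δ * variance g * s ^ 2 ≤ s ^ 2 * (δ * (1 - s)) := by
    have := mul_le_mul_of_nonneg_left h2 hδ.le
    nlinarith [sq_nonneg s]
  nlinarith

/-- Replacing `m` by `E` must cost a multiple of `V`, not merely of `|E - m|`. It does: the error is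
`⟨m - E, E⟩ (1 - |E|²)` minus a covariance, where `1 - |E|² = 2V` and the covariance is at most `2V
|E - m|`. -/
theorem drift_ge (hg : IsL2Density g) (m : Vec d) {u : Sph d}
    (hu : mean g = ‖mean g‖ • (u : Vec d)) {δ : ℝ} (hδ : 0 < δ) (hδ1 : δ < 1) :
    variance g * (δ - 2 * variance g - 4 * ‖mean g - m‖) - 4 * capMass g u δ ≤
      ∫ v, ⟪tangProj (v : Vec d) m, mean g⟫_ℝ * g v ∂(surf d) := by
  have h1 := hg.drift_mean_ge hu hδ hδ1
  set e := mean g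
  have hV := hg.variance_nonneg
  have hVe := hg.variance_eq
  have he : ‖e‖ ≤ 1 := hg.norm_mean_le
  have h2 : ∫ v, ⟪tangProj (v : Vec d) m, e⟫_ℝ * g v ∂(surf d) =
      ∫ v, ⟪tangProj (v : Vec d) e, e⟫_ℝ * g v ∂(surf d)
        + ∫ v, ⟪tangProj (v : Vec d) (m - e), e⟫_ℝ * g v ∂(surf d) := by
    have hc : ∀ w : Vec d, Continuous fun v : Sph d => ⟪tangProj (v : Vec d) w, e⟫_ℝ := fun w =>
      (continuous_tangProj_apply continuous_subtype_val continuous_const).inner continuous_const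
    rw [← integral_add (hg.integrable_mul (hc _)) (hg.integrable_mul (hc _))]
    refine integral_congr_ae (Filter.Eventually.of_forall fun v => ?_)
    simp only [map_sub, inner_sub_left]
    ring
  have h3 := hg.integral_inner_tangProj (m - e) e
  rw [hg.integral_inner_mul_inner (m - e) e] at h3
  have h4 : |∫ v, ⟪m - e, (v : Vec d) - e⟫_ℝ * ⟪e, (v : Vec d) - e⟫_ℝ * g v ∂(surf d)| ≤
      ‖e - m‖ * (2 * variance g) := by
    have hi := hg.integrable_mul (f := fun v : Sph d =>
      ⟪m - e, (v : Vec d) - e⟫_ℝ * ⟪e, (v : Vec d) - e⟫_ℝ) (by fun_prop)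
    have hi2 := hg.integrable_mul (f := fun v : Sph d => ‖(v : Vec d) - e‖ ^ 2) (by fun_prop)
    refine abs_integral_le_integral_abs.trans ?_
    have e5 : ‖e - m‖ * (2 * variance g) =
        ∫ v, ‖e - m‖ * (‖(v : Vec d) - e‖ ^ 2 * g v) ∂(surf d) := by
      rw [MeasureTheory.integral_const_mul, variance]
      ring
    rw [e5]
    refine integral_mono_ae hi.abs (hi2.const_mul _) ?_
    filter_upwards [hg.nonneg] with v hv
    rw [abs_mul, abs_of_nonneg hv, ← mul_assoc]
    refine mul_le_mul_of_nonneg_right ?_ hv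
    rw [abs_mul]
    have h5 := abs_real_inner_le_norm (m - e) ((v : Vec d) - e)
    have h6 := abs_real_inner_le_norm e ((v : Vec d) - e)
    rw [norm_sub_rev m e] at h5
    have h7 : ‖e‖ * ‖(v : Vec d) - e‖ ≤ ‖(v : Vec d) - e‖ :=
      mul_le_of_le_one_left (norm_nonneg _) he
    calc _ ≤ (‖e - m‖ * ‖(v : Vec d) - e‖) * ‖(v : Vec d) - e‖ :=
          mul_le_mul h5 (h6.trans h7) (abs_nonneg _) (by positivity)
      _ = _ := by ring
  have h5 : |⟪m - e, e⟫_ℝ| ≤ ‖e - m‖ := by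
    refine (abs_real_inner_le_norm _ _).trans ?_
    rw [norm_sub_rev]
    exact mul_le_of_le_one_right (norm_nonneg _) he
  have h6 : ⟪e, e⟫_ℝ = 1 - 2 * variance g := by
    rw [real_inner_self_eq_norm_sq, hVe]; ring
  rw [h6] at h3
  rw [h2, h3]
  have h7 := (abs_le.1 h4).2
  have h8 := (abs_le.1 h5).1
  have h9 := mul_le_mul_of_nonneg_right h8 hV
  nlinarith [mul_nonneg hV hV]

end IsL2Density

theorem flux_inner {d : ℕ} (lam σ : ℝ) (m : Vec d) (g : Sph d → ℝ)
    (z : Vec d) : flux lam σ m g (fun x => ⟪z, x⟫_ℝ) =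
      lam * ∫ v, ⟪tangProj (v : Vec d) m, z⟫_ℝ * g v ∂(surf d)
      - cSigma σ d * ∫ v, (‖(v : Vec d) - m‖ ^ 2 * ⟪z, (v : Vec d)⟫_ℝ) * g v ∂(surf d) := by
  have e1 : ∀ v : Sph d, ⟪⟪m, (v : Vec d)⟫_ℝ • (v : Vec d) - m,
      sphGrad (fun x => ⟪z, x⟫_ℝ) v⟫_ℝ * g v = -(⟪tangProj (v : Vec d) m, z⟫_ℝ * g v) := by
    intro v
    rw [inner_drift_eq, sphGrad_inner, ← inner_tangProj_comm,
      tangProj_of_tangential _ _ (inner_tangProj_self v m)]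
    ring
  have e2 : ∀ v : Sph d, ‖(v : Vec d) - m‖ ^ 2 * sphLap (fun x => ⟪z, x⟫_ℝ) v * g v =
      -((d : ℝ) - 1) * ((‖(v : Vec d) - m‖ ^ 2 * ⟪z, (v : Vec d)⟫_ℝ) * g v) := by
    intro v
    rw [sphLap_inner]
    ring
  rw [flux]
  simp_rw [e1, e2]
  rw [integral_neg, integral_const_mul, cSigma]
  ring

/-- Below the barrier the loss `2V + 4|E - m|` in `drift_ge` is at most `δ - ϑ`, so the drift
contracts with coefficient `λ ϑ`, while the diffusion subtracts `4 C_α C_σ`. -/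
theorem IsL2Density.neg_flux_mean_le {d : ℕ} [NeZero d] {g : Sph d → ℝ} (hg : IsL2Density g)
    {𝓔 : Vec d → ℝ} (h : Continuous fun v : Sph d => 𝓔 v) {lam σ α δ ϑ : ℝ} (hα : 0 < α)
    (hlam : 0 < lam) (hδ : 0 < δ) (hδ1 : δ < 1) {u : Sph d}
    (hu : mean g = ‖mean g‖ • (u : Vec d)) (hϑ : ϑ < δ)
    (hV : cAlpha α 𝓔 * variance g ≤ ((δ - ϑ) / 8) ^ 2) (hϑ0 : 0 < ϑ) :
    -flux lam σ (consensus α 𝓔 g) g (fun x => ⟪mean g, x⟫_ℝ) ≤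
      -rate lam σ α ϑ 𝓔 * variance g + lam * (4 * capMass g u δ) := by
  set m := consensus α 𝓔 g
  set e := mean g
  have hV0 := hg.variance_nonneg
  have hC := one_le_cAlpha h hα
  have hd : 0 ≤ cSigma σ d := by
    have : (1 : ℝ) ≤ d := by exact_mod_cast NeZero.one_le
    rw [cSigma]
    have h1 : 0 ≤ (d : ℝ) - 1 := by linarith
    positivity
  have hdiff : ∫ v, (‖(v : Vec d) - m‖ ^ 2 * ⟪e, (v : Vec d)⟫_ℝ) * g v ∂(surf d) ≤
      4 * cAlpha α 𝓔 * variance g := by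
    refine le_trans (hg.integral_mul_le (by fun_prop)
      (h := fun v : Sph d => ‖(v : Vec d) - m‖ ^ 2) (by fun_prop) fun v => ?_)
      (hg.integral_norm_sub_consensus_sq_le h hα)
    refine mul_le_of_le_one_right (by positivity) ?_
    have := (le_abs_self _).trans (abs_real_inner_le_norm e (v : Vec d))
    rw [norm_coe_sph, mul_one] at this
    exact this.trans hg.norm_mean_le
  have hdrift := hg.drift_ge m hu hδ hδ1
  set q := (δ - ϑ) / 8
  have hq : 0 < q := by simp only [q]; linarith
  have hq1 : q < 1 / 8 := by simp only [q]; linarith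
  set x := √(cAlpha α 𝓔 * variance g)
  have hx0 : 0 ≤ x := Real.sqrt_nonneg _
  have hxsq : x ^ 2 = cAlpha α 𝓔 * variance g := Real.sq_sqrt (by positivity)
  have hxq : x ≤ q := by
    refine le_of_sq_le_sq ?_ hq.le
    rw [hxsq]
    exact hV
  have hVx : variance g ≤ x ^ 2 := by rw [hxsq]; nlinarith
  -- `3/2` replaces `√2` to keep the constants rational.
  have hw : ‖e - m‖ ≤ 3 / 2 * x := by
    refine le_of_sq_le_sq ?_ (by positivity)
    have h1 := hg.norm_mean_sub_consensus_sq_le h hα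
    have h2 : (3 / 2 * x) ^ 2 = 9 / 4 * (cAlpha α 𝓔 * variance g) := by rw [mul_pow, hxsq]; ring
    rw [h2]
    have : 0 ≤ cAlpha α 𝓔 * variance g := by positivity
    linarith
  -- The loss is at most `2x² + 6x ≤ 8q = δ - ϑ`, using `x ≤ q < 1`; this fixes the `8` in the
  -- barrier.
  have hgap : ϑ ≤ δ - 2 * variance g - 4 * ‖e - m‖ := by
    have h1 : δ - ϑ = 8 * q := by simp only [q]; ring
    nlinarith
  have hD : variance g * ϑ - 4 * capMass g u δ ≤
      ∫ v, ⟪tangProj (v : Vec d) m, e⟫_ℝ * g v ∂(surf d) := by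
    have := mul_le_mul_of_nonneg_left hgap hV0
    linarith
  rw [flux_inner, rate]
  have h1 := mul_le_mul_of_nonneg_left hD hlam.le
  have h2 := mul_le_mul_of_nonneg_left hdiff hd
  linarith

/-! ### The variance along a solution -/

namespace IsWeakSolution

variable {d : ℕ} {lam σ α T : ℝ} {𝓔 : Vec d → ℝ} {ρ₀ : Sph d → ℝ} {ρ : ℝ → Sph d → ℝ}

theorem variance_initial (hρ : IsWeakSolution lam σ α 𝓔 T ρ₀ ρ) : variance (ρ 0) = variance ρ₀ := by
  have h1 : mean (ρ 0) = mean ρ₀ := by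
    refine integral_congr_ae ?_
    filter_upwards [hρ.initial] with v hv
    rw [hv]
  rw [variance, variance, h1]
  congr 1
  refine integral_congr_ae ?_
  filter_upwards [hρ.initial] with v hv
  rw [hv]

theorem measurable_mean (hρ : IsWeakSolution lam σ α 𝓔 T ρ₀ ρ) :
    Measurable fun s => mean (ρ s) :=
  (StronglyMeasurable.integral_prod_right (f := fun s (v : Sph d) => ρ s v • (v : Vec d))
    (hρ.measurable.smul (measurable_subtype_coe.comp measurable_snd)).stronglyMeasurable).measurable

/-- The test function `⟨mean (ρ r), ·⟩` varies in time, so the mean is split into orthonormal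
coordinates. Each is the integral against a fixed linear function, and the squares of the
coordinates sum to `|E|² = 1 - 2V`. -/
theorem variance_sub_eq (hρ : IsWeakSolution lam σ α 𝓔 T ρ₀ ρ)
    (h : Continuous fun v : Sph d => 𝓔 v) (hα : 0 < α) {s t : ℝ} (hs : 0 ≤ s) (hst : s ≤ t)
    (ht : t ≤ T) :
    IntervalIntegrable (fun r => -flux lam σ (consensus α 𝓔 (ρ r)) (ρ r)
        (fun x => ⟪mean (ρ r), x⟫_ℝ)) volume s t ∧
    variance (ρ t) - variance (ρ s) = ∫ r in s..t, -flux lam σ (consensus α 𝓔 (ρ r)) (ρ r)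
      (fun x => ⟪mean (ρ r), x⟫_ℝ) := by
  have hT : 0 ≤ T := hs.trans (hst.trans ht)
  set e := stdOrthonormalBasis ℝ (Vec d)
  set b : Fin _ → ℝ → ℝ := fun i r =>
    flux lam σ (consensus α 𝓔 (ρ r)) (ρ r) (fun x => ⟪e i, x⟫_ℝ)
  have hb : ∀ i, IntervalIntegrable (b i) volume 0 T := fun i =>
    hρ.intervalIntegrable_flux h hα hT (contDiff_inner_const (e i))
  have hbm : ∀ i, Measurable (b i) := fun i => hρ.measurable_flux h (contDiff_inner_const (e i))
  have hd : ∀ r ∈ Icc s t, IsL2Density (ρ r) := fun r hr =>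
    hρ.density r ⟨hs.trans hr.1, hr.2.trans ht⟩
  have hprod : ∀ i, IntervalIntegrable (fun r => 2 * (⟪e i, mean (ρ r)⟫_ℝ * b i r)) volume s t := by
    intro i
    obtain ⟨C, hC⟩ := hρ.exists_abs_flux_le h hα (contDiff_inner_const (e i))
    refine intervalIntegrable_of_measurable_of_bound (C := 2 * (1 * C)) ?_ hst fun r hr => ?_
    · have hm : Measurable fun r => ⟪e i, mean (ρ r)⟫_ℝ :=
        measurable_const.inner hρ.measurable_mean
      exact (hm.mul (hbm i)).const_mul 2
    · have h1 : |⟪e i, mean (ρ r)⟫_ℝ| ≤ 1 := by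
        refine (abs_real_inner_le_norm _ _).trans ?_
        rw [e.orthonormal.1 i, one_mul]
        exact (hd r hr).norm_mean_le
      rw [abs_mul, abs_mul, abs_two]
      exact mul_le_mul_of_nonneg_left (mul_le_mul h1
        (hC r ⟨hs.trans hr.1, hr.2.trans ht⟩) (abs_nonneg _) zero_le_one) (by norm_num)
  have hsum : ∀ r ∈ Icc s t, -flux lam σ (consensus α 𝓔 (ρ r)) (ρ r)
      (fun x => ⟪mean (ρ r), x⟫_ℝ) =
        (-1 / 2) * ∑ i, 2 * (⟪e i, mean (ρ r)⟫_ℝ * b i r) := by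
    intro r hr
    have h1 := flux_sum lam σ (consensus α 𝓔 (ρ r)) (hd r hr).memLp Finset.univ
      (fun i => ⟪e i, mean (ρ r)⟫_ℝ) (fun i => contDiff_inner_const (e i))
    have h2 : (fun x : Vec d => ∑ i, ⟪e i, mean (ρ r)⟫_ℝ * ⟪e i, x⟫_ℝ) =
        fun x => ⟪mean (ρ r), x⟫_ℝ := by
      ext x
      rw [← e.sum_inner_mul_inner (mean (ρ r)) x]
      exact Finset.sum_congr rfl fun i _ => by rw [real_inner_comm]
    rw [h2] at h1
    rw [h1, ← Finset.mul_sum]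
    ring
  have hF : IntervalIntegrable (fun r => (-1 / 2) * ∑ i, 2 * (⟪e i, mean (ρ r)⟫_ℝ * b i r))
      volume s t := by
    refine IntervalIntegrable.const_mul ?_ _
    have := IntervalIntegrable.sum Finset.univ (fun i _ => hprod i)
    exact this.congr fun r _ => by simp
  have hsum' : EqOn (fun r => (-1 / 2) * ∑ i, 2 * (⟪e i, mean (ρ r)⟫_ℝ * b i r))
      (fun r => -flux lam σ (consensus α 𝓔 (ρ r)) (ρ r) (fun x => ⟪mean (ρ r), x⟫_ℝ))
      (uIcc s t) := by
    intro r hr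
    rw [uIcc_of_le hst] at hr
    exact (hsum r hr).symm
  refine ⟨hF.congr fun r hr => hsum' (uIoc_subset_uIcc hr), ?_⟩
  rw [← intervalIntegral.integral_congr hsum', intervalIntegral.integral_const_mul,
    intervalIntegral.integral_finsetSum fun i _ => hprod i]
  have hsq : ∀ i, ∫ r in s..t, 2 * (⟪e i, mean (ρ r)⟫_ℝ * b i r) =
      ⟪e i, mean (ρ t)⟫_ℝ ^ 2 - ⟪e i, mean (ρ s)⟫_ℝ ^ 2 := by
    intro i
    refine (sq_sub_sq_of_eq_integral (hb i) (c := fun r => ⟪e i, mean (ρ r)⟫_ℝ)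
      (fun r hr => ?_) hs hst ht).symm
    rw [(hρ.density r hr).inner_mean, (hρ.density 0 ⟨le_rfl, hT⟩).inner_mean]
    exact hρ.integral_eq (contDiff_inner_const (e i)) hr
  simp_rw [hsq]
  rw [Finset.sum_sub_distrib, e.sum_sq_inner_right, e.sum_sq_inner_right,
    (hd t ⟨hst, le_rfl⟩).variance_eq, (hd s ⟨le_rfl, hst⟩).variance_eq]
  ring

theorem varianceDecay (hρ : IsWeakSolution lam σ α 𝓔 T ρ₀ ρ) [NeZero d]
    (h : Continuous fun v : Sph d => 𝓔 v) {β C ε δ ϑ : ℝ} (hα : 0 < α) (hlam : 0 < lam)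
    (hT : 0 < T)
    (hcap : ∀ t ∈ Icc 0 T, ∀ u : Sph d, mean (ρ t) = ‖mean (ρ t)‖ • (u : Vec d) →
      4 * capMass (ρ t) u δ ≤ C * δ ^ (((d : ℝ) - 2) / 4))
    (hwp : WellPrepared lam σ α T β ε δ ϑ C 16 𝓔 ρ₀) :
    VarianceDecay lam σ α T δ ϑ C 𝓔 ρ₀ ρ := by
  have h0T : (0 : ℝ) ∈ Icc 0 T := ⟨le_rfl, hT.le⟩
  have hδp : 0 < δ ^ (((d : ℝ) - 2) / 4) := Real.rpow_pos_of_pos hwp.delta_pos _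
  have hu : ∀ e : Vec d, ∃ u : Sph d, e = ‖e‖ • (u : Vec d) := by
    intro e
    by_cases he : e = 0
    · obtain ⟨u⟩ : Nonempty (Sph d) := (NormedSpace.sphere_nonempty.2 zero_le_one).to_subtype
      exact ⟨u, by simp [he]⟩
    · refine ⟨⟨‖e‖⁻¹ • e, by simpa using norm_smul_inv_norm_eq_one he⟩, ?_⟩
      rw [smul_smul, mul_inv_cancel₀ (norm_ne_zero_iff.2 he), one_smul]
  -- Cap masses are nonnegative, so the cap hypothesis at time zero forces the sign of `C`.
  have hC : 0 ≤ C := by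
    obtain ⟨u, hu⟩ := hu (mean (ρ 0))
    have h1 := hcap 0 h0T u hu
    have h2 := (hρ.density 0 h0T).capMass_nonneg u δ
    by_contra! hneg
    nlinarith
  have hκ := hwp.rate_pos
  set κ := rate lam σ α ϑ 𝓔
  set R := remainder lam σ α δ ϑ C 𝓔 with hR
  have hR0 : 0 ≤ R := by
    rw [hR, remainder]
    positivity
  have hκR : κ * R = lam * (C * δ ^ (((d : ℝ) - 2) / 4)) := by
    rw [hR, remainder]
    change κ * (lam * C / κ * _) = _
    field_simp
  set c := cAlpha α 𝓔
  have hc : 1 ≤ c := one_le_cAlpha h hα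
  have hV0 : 0 ≤ variance ρ₀ := hwp.datum.variance_nonneg
  set M₀ := variance ρ₀ + R
  have hM0 : 0 ≤ M₀ := add_nonneg hV0 hR0
  have hM38 : M₀ ≤ 3 / 8 := hwp.bound.trans ((min_le_right _ _).trans (min_le_right _ _))
  set q := (δ - ϑ) / 8
  have hq : 0 < q := by
    have := hwp.theta_lt
    simp only [q]
    linarith
  -- As `c ≥ 1` and `M₀ ≤ 3/8 < 1`, the exponents `2 max(1, β) ≥ 1/2` and `min(1, β)/2 ≤ 1/2` can
  -- both be replaced by `1/2`. With `C^* = 16` the bound `(δ - ϑ)/16` is below `q = (δ - ϑ)/8`.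
  have hsmall : √c * √M₀ < q := by
    have h1 := hwp.small
    have h2 : 0 ≤ ε ^ β := Real.rpow_nonneg hwp.eps_pos.le _
    have h3 : √c ≤ c ^ (2 * max 1 β) := by
      rw [Real.sqrt_eq_rpow]
      refine Real.rpow_le_rpow_of_exponent_le hc ?_
      linarith [le_max_left 1 β]
    have h4 : √M₀ ≤ M₀ ^ ((1 / 2) * min 1 β) := by
      rcases hM0.eq_or_lt with h0 | h0
      · rw [← h0, Real.sqrt_zero]
        exact Real.rpow_nonneg le_rfl _
      · rw [Real.sqrt_eq_rpow]
        refine Real.rpow_le_rpow_of_exponent_ge h0 (by linarith) ?_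
        linarith [min_le_left 1 β]
    have h5 := mul_le_mul h3 h4 (Real.sqrt_nonneg _) (by positivity)
    have h6 : (δ - ϑ) / 16 < q := by
      simp only [q] at hq ⊢
      linarith
    linarith
  have hcM : c * M₀ < q ^ 2 := by
    have h1 := pow_lt_pow_left₀ hsmall (by positivity) two_ne_zero
    rwa [mul_pow, Real.sq_sqrt (by positivity), Real.sq_sqrt hM0] at h1
  have hc0 : 0 < c := by linarith
  -- The barrier: `V ≤ M` is precisely the smallness required by `neg_flux_mean_le`, and `M₀ = V(ρ₀)
  -- + R` lies strictly below it.
  set M := q ^ 2 / c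
  have hM0M : M₀ < M := by
    rw [lt_div_iff₀ hc0]
    linarith
  have hcont : ContinuousOn (fun t => variance (ρ t)) (Icc 0 T) := by
    have h1 := (hρ.variance_sub_eq h hα le_rfl hT.le le_rfl).1
    have h2 := intervalIntegral.continuousOn_primitive_interval' h1 left_mem_uIcc
    rw [uIcc_of_le hT.le] at h2
    refine ((continuousOn_const (c := variance (ρ 0))).add h2).congr fun t ht => ?_
    have h3 := (hρ.variance_sub_eq h hα le_rfl ht.1 ht.2).2
    simp only [Pi.add_apply]
    linarith
  intro t ht
  rw [← hρ.variance_initial]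
  refine le_exp_of_conditional_integral_le (M := M) hcont ?_ hκ hR0 ?_ ?_ ht
  · exact (hρ.density 0 h0T).variance_nonneg
  · rw [hρ.variance_initial]
    exact hM0M
  · intro s t hs hst ht hbar
    obtain ⟨hint, heq⟩ := hρ.variance_sub_eq h hα hs hst ht
    have hVint : IntervalIntegrable (fun r => -κ * variance (ρ r) + κ * R) volume s t := by
      refine ContinuousOn.intervalIntegrable ?_
      rw [uIcc_of_le hst]
      have := hcont.mono (Icc_subset_Icc hs ht)
      fun_prop
    rw [heq]
    refine intervalIntegral.integral_mono_on hst hint hVint fun r hr => ?_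
    have hrT : r ∈ Icc 0 T := ⟨hs.trans hr.1, hr.2.trans ht⟩
    obtain ⟨u, hu⟩ := hu (mean (ρ r))
    have hVM := hbar r hr
    have h1 : c * variance (ρ r) ≤ q ^ 2 := by
      rw [le_div_iff₀ hc0] at hVM
      linarith
    have h3 := (hρ.density r hrT).neg_flux_mean_le h (σ := σ) hα hlam hwp.delta_pos hwp.delta_lt hu
      hwp.theta_lt h1 hwp.theta_pos
    have h4 := mul_le_mul_of_nonneg_left (hcap r hrT u hu) hlam.le
    rw [← hκR] at h4
    exact h3.trans (add_le_add le_rfl h4)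

end IsWeakSolution

end SphereCBO

/-! ### Choice of the constants and conclusion -/

open SphereCBO

theorem proposition3p2 :
    ∃ (CT : ℝ → ℝ → ℝ → ℝ → ℝ) (Cstar : ℝ → ℝ → ℝ → ℝ),
      (∀ lam σ T r, 0 < CT lam σ T r) ∧ (∀ c₁ β C₀, 0 < Cstar c₁ β C₀) ∧
      ∀ (d : ℕ), 2 ≤ d →
      ∀ (𝓔 : Vec d → ℝ) (c₁ C₀ β : ℝ), IsObjective 𝓔 c₁ C₀ β →
      ∀ (lam σ α T : ℝ), 0 < lam → 0 < σ → 0 < α → 0 < T →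
      ∀ (ρ₀ : Sph d → ℝ), IsL2Density ρ₀ →
      ∀ (ρ : ℝ → Sph d → ℝ), IsWeakSolution lam σ α 𝓔 T ρ₀ ρ →
        -- `CT` controls the mass of every cap, uniformly in the dimension
        (∀ δ : ℝ, 0 < δ → δ < 1 → ∀ t ∈ Set.Icc 0 T, ∀ u : Sph d,
          4 * capMass (ρ t) u δ ≤ CT lam σ T (norm2 ρ₀) * δ ^ (((d : ℝ) - 2) / 4)) ∧
        -- decay of the variance for well-prepared data
        (∀ ε δ ϑ : ℝ,
          WellPrepared lam σ α T β ε δ ϑ (CT lam σ T (norm2 ρ₀)) (Cstar c₁ β C₀) 𝓔 ρ₀ →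
          VarianceDecay lam σ α T δ ϑ (CT lam σ T (norm2 ρ₀)) 𝓔 ρ₀ ρ) ∧
        -- the same with any constant that controls the mass of the cap opposite to the mean
        (∀ C ε δ ϑ : ℝ,
          (∀ t ∈ Set.Icc 0 T, ∀ u : Sph d, mean (ρ t) = ‖mean (ρ t)‖ • (u : Vec d) →
            4 * capMass (ρ t) u δ ≤ C * δ ^ (((d : ℝ) - 2) / 4)) →
          WellPrepared lam σ α T β ε δ ϑ C (Cstar c₁ β C₀) 𝓔 ρ₀ →
          VarianceDecay lam σ α T δ ϑ C 𝓔 ρ₀ ρ) := by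
  obtain ⟨A, hA, hcap⟩ := exists_surf_cap_le
  -- `A` comes from the cap area and the exponential from `norm2_le`; `|r| + 1` keeps the constant
  -- positive for every real `r`.
  refine ⟨fun lam σ T r =>
    4 * A * (|r| + 1) * Real.exp ((lam + σ ^ 2) ^ 2 / (2 * σ ^ 2) * T), fun _ _ _ => 16,
    fun lam σ T r => by positivity, fun _ _ _ => by norm_num, ?_⟩
  intro d hd 𝓔 c₁ C₀ β hE lam σ α T hlam hσ hα hT ρ₀ hρ₀ ρ hρ
  have : NeZero d := ⟨by omega⟩
  have h := hE.continuous
  have part : ∀ δ : ℝ, 0 < δ → δ < 1 → ∀ t ∈ Set.Icc 0 T, ∀ u : Sph d,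
      4 * capMass (ρ t) u δ ≤
        4 * A * (|norm2 ρ₀| + 1) * Real.exp ((lam + σ ^ 2) ^ 2 / (2 * σ ^ 2) * T) *
          δ ^ (((d : ℝ) - 2) / 4) := by
    intro δ hδ hδ1 t ht u
    have h1 := capMass_le (hρ.density t ht).memLp u δ
    have h2 := hcap d u δ hδ hδ1
    have h3 := hρ.norm2_le h hα hlam.le hσ ht
    have h4 : norm2 ρ₀ ≤ |norm2 ρ₀| + 1 := by linarith [le_abs_self (norm2 ρ₀)]
    have h5 := h3.trans (mul_le_mul_of_nonneg_right h4 (Real.exp_pos _).le)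
    have h6 := mul_le_mul h5 h2 (Real.sqrt_nonneg _) (by positivity)
    calc 4 * capMass (ρ t) u δ ≤ 4 * _ := mul_le_mul_of_nonneg_left (h1.trans h6) (by norm_num)
      _ = _ := by ring
  refine ⟨part, fun ε δ ϑ hwp => ?_, fun C ε δ ϑ hC hwp => ?_⟩
  · exact hρ.varianceDecay h hα hlam hT
      (fun t ht u _ => part δ hwp.delta_pos hwp.delta_lt t ht u) hwp
  · exact hρ.varianceDecay h hα hlam hT hC hwp
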